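/- Let $n\ge 1$ be an integer, $\lambda\in\mathbb{C}$ and $N,P\ge 0$ real. Put $\langle x\rangle=\sqrt{1+|x|^2}$, $\beta_c=\max\{2-2P,\tfrac{4-2N}{3}\}$ and $\beta_0=\max\{\beta_c,1\}$. Assume that either (a) $\beta_0=\beta_c>1$ and $n=2$, or (b) $\beta_c<1$ and $\lambda\notin\mathbb{R}_{\ge 0}$. Then there exist measurable complex-valued potentials $V:\mathbb{R}^n\to\mathbb{C}$ and $W:\mathbb{R}^n\to\mathbb{C}^n$, at least one of which is identically zero, and a $C^2$ function $u:\mathbb{R}^n\to\mathbb{C}$, not identically zero, such that $$-\Delta u+W\cdot\nabla u+Vu=\lambda u\quad\text{in }\mathbb{R}^n$$ (here $W\cdot\nabla u=\sum_i W_i\,\partial_i u$), together with constants $C,c>0$ and $A\in\{-1,0\}$, such that $$|V(x)|\le C\langle x\rangle^{-N},\qquad |W(x)|\le C\langle x\rangle^{-P}\qquad\text{for all }x\in\mathbb{R}^n,$$ $$|u(x)|\le C\exp\left(-c\,|x|^{\beta_0}(\log|x|)^{A}\right)\qquad\text{for all }|x|\ge 2.$$ -/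

import Mathlib

noncomputable section

/-- The critical exponent `max {2 - 2P, (4 - 2N)/3}`. -/
def betaC (N P : ℝ) : ℝ := max (2 - 2 * P) ((4 - 2 * N) / 3)

/-- The exponent `max {betaC, 1}`. -/
def betaZero (N P : ℝ) : ℝ := max (betaC N P) 1

/-- The Japanese bracket `⟨x⟩ = √(1 + |x|²)`. -/
def japaneseBracket {n : ℕ} (x : EuclideanSpace ℝ (Fin n)) : ℝ := Real.sqrt (1 + ‖x‖ ^ 2)

/-- The (bilinear, not sesquilinear) first-order term `W · ∇u = ∑ i, Wᵢ ∂ᵢu` at the point `x`. -/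
def dotGrad {n : ℕ} (W : EuclideanSpace ℝ (Fin n) → EuclideanSpace ℂ (Fin n))
    (u : EuclideanSpace ℝ (Fin n) → ℂ) (x : EuclideanSpace ℝ (Fin n)) : ℂ :=
  ∑ i : Fin n, W x i * fderiv ℝ u x (EuclideanSpace.single i (1 : ℝ))

/-- `u` is a classical (twice continuously differentiable) solution of
`-Δu + W · ∇u + V u = lam u` on all of `ℝⁿ`. -/
structure IsClassicalSolution {n : ℕ} (lam : ℂ) (V : EuclideanSpace ℝ (Fin n) → ℂ)
    (W : EuclideanSpace ℝ (Fin n) → EuclideanSpace ℂ (Fin n))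
    (u : EuclideanSpace ℝ (Fin n) → ℂ) : Prop where
  contDiff : ContDiff ℝ 2 u
  equation : ∀ x, -(Laplacian.laplacian u x) + dotGrad W u x + V x * u x = lam * u x

end

/-! ### The Laplacian as a sum of second partial derivatives -/

open Laplacian InnerProductSpace Topology Filter

/-! Case (a) is a construction of Meshkov type in the plane. Let β = β_c > 1 and s = log r, so that
r²(Δ + λ) = ∂_s² + ∂_θ² + λr². Cut the plane along the radii r_j = j^{2/β}. Across the j-th annulus
u passes from a mode of angular frequency ±j² to one of frequency ∓(j+1)², the signs alternating
with j. The radial exponent is -q_j with q_j² = j⁴ - λr_j² and Re q_j ≥ 0. Because β > 1, the frozen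
term λr_j² is o(j⁴), and λr² varies over the annulus by only O(j³).

Let w be the outgoing mode and T the ratio of the incoming to the outgoing mode. The modulus of T
grows through 1, so w(1 - T) has zeros, and its error contains ATw with A = O(j³), which is not
divisible by 1 - T. A third harmonic repairs this. Let B be the defect of wT², and choose ε = O(1/j)
with εB = (1+ε)A. Then u = w(1 - (1+ε)T + εT²) = w(1 - T)(1 - εT), and the frozen operator maps it
to -(1+ε)ATw(1 - T). The zeros cancel and |(Δ+λ)u| ≲ j³r⁻²|u|. Away from |T| = 1 a single mode
dominates, so cutoffs do no harm there (`transition_estimates`). A first-order combination of the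
radial and angular derivatives nearly kills the incoming mode but not the outgoing one, whence |∇u|
≳ j²r⁻¹|u|.

The pieces agree near the common circles (`gluedFun_local`). Each annulus multiplies the amplitude
by roughly exp(-j/β), so |u| ≲ exp(-cj²) with j² comparable to r^β (`exists_decaying_function`).
Solving the equation algebraically for V, or for W along the conjugate gradient, gives potentials of
size r^{3β/2-2} and r^{β/2-1} respectively (`exists_zeroth_order_potential`,
`exists_first_order_potential`). These are r^{-N} for β = (4-2N)/3 and r^{-P} for β = 2-2P.

Case (b) is a WKB expansion. For λ outside [0,∞) take μ with μ² = -λ and Re μ > 0, and put u = exp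
F(⟨x⟩) with F' = p(1/⟨x⟩), p a polynomial, p(0) = -μ. Then (Δu + λu)/u is a polynomial in 1/⟨x⟩
(`laplacian_expFun`) which a suitable p makes vanish to any prescribed order
(`exists_riccati_approx`). So V decays as fast as desired while u decays exponentially. -/

theorem laplacian_eq_sum_fderiv {n : ℕ} {f : EuclideanSpace ℝ (Fin n) → ℂ}
    {x : EuclideanSpace ℝ (Fin n)} (hf : ContDiffAt ℝ 2 f x) :
    Δ f x = ∑ i : Fin n, fderiv ℝ (fun y => fderiv ℝ f y (EuclideanSpace.single i 1)) x
      (EuclideanSpace.single i 1) := by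
  rw [laplacian_eq_iteratedFDeriv_orthonormalBasis f (EuclideanSpace.basisFun (Fin n) ℝ)]
  have hd : DifferentiableAt ℝ (fderiv ℝ f) x :=
    (hf.fderiv_right (m := 1) (by norm_num)).differentiableAt (by norm_num)
  refine Finset.sum_congr rfl fun i _ => ?_
  rw [iteratedFDeriv_two_apply, fderiv_clm_apply hd (differentiableAt_const _)]
  simp

/-- Polar formulas for the first partials hold only away from the origin, so closed forms are
required only near the point. -/
theorem laplacian_eq_sum_of_hasFDerivAt {n : ℕ} {f : EuclideanSpace ℝ (Fin n) → ℂ}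
    {x : EuclideanSpace ℝ (Fin n)} (hf : ContDiffAt ℝ 2 f x)
    (g : Fin n → EuclideanSpace ℝ (Fin n) → ℂ) (a : Fin n → ℂ)
    (hg : ∀ᶠ y in 𝓝 x, ∀ i, fderiv ℝ f y (EuclideanSpace.single i 1) = g i y)
    (ha : ∀ i, fderiv ℝ (g i) x (EuclideanSpace.single i 1) = a i) :
    Δ f x = ∑ i, a i := by
  rw [laplacian_eq_sum_fderiv hf]
  refine Finset.sum_congr rfl fun i _ => ?_
  rw [← ha i]
  have : (fun y => fderiv ℝ f y (EuclideanSpace.single i 1)) =ᶠ[𝓝 x] g i :=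
    hg.mono fun y hy => hy i
  rw [this.fderiv_eq]

/-! ### Logarithmic polar coordinates in the plane -/

/-- The complex coordinate `x₀ + i x₁` of a point of the plane. -/
noncomputable def planeCoord : EuclideanSpace ℝ (Fin 2) →L[ℝ] ℂ :=
  (EuclideanSpace.proj (0 : Fin 2)).smulRight (1 : ℂ) +
    (EuclideanSpace.proj (1 : Fin 2)).smulRight Complex.I

/-- The differential of `log |x|`. -/
noncomputable def radialForm (x : EuclideanSpace ℝ (Fin 2)) : EuclideanSpace ℝ (Fin 2) →L[ℝ] ℝ :=
  (x 0 / ‖x‖ ^ 2) • EuclideanSpace.proj (0 : Fin 2) +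
    (x 1 / ‖x‖ ^ 2) • EuclideanSpace.proj (1 : Fin 2)

/-- The differential of the polar angle. -/
noncomputable def angularForm (x : EuclideanSpace ℝ (Fin 2)) : EuclideanSpace ℝ (Fin 2) →L[ℝ] ℝ :=
  (-x 1 / ‖x‖ ^ 2) • EuclideanSpace.proj (0 : Fin 2) +
    (x 0 / ‖x‖ ^ 2) • EuclideanSpace.proj (1 : Fin 2)

/-- The unit complex number `e^{iθ}` attached to a point of the plane with polar angle `θ`. -/
noncomputable def phase (x : EuclideanSpace ℝ (Fin 2)) : ℂ := planeCoord x * ((‖x‖⁻¹ : ℝ) : ℂ)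

/-- The function `f (log r) e^{imθ}` on the plane. -/
noncomputable def mode (f : ℝ → ℂ) (m : ℤ) (x : EuclideanSpace ℝ (Fin 2)) : ℂ :=
  f (Real.log ‖x‖) * phase x ^ m

theorem norm_sq_plane (x : EuclideanSpace ℝ (Fin 2)) : ‖x‖ ^ 2 = x 0 ^ 2 + x 1 ^ 2 := by
  rw [EuclideanSpace.norm_sq_eq]; simp

theorem planeCoord_apply (x : EuclideanSpace ℝ (Fin 2)) :
    planeCoord x = x 0 + x 1 * Complex.I := by
  simp [planeCoord]

theorem norm_planeCoord (x : EuclideanSpace ℝ (Fin 2)) : ‖planeCoord x‖ = ‖x‖ := by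
  have : ‖planeCoord x‖ ^ 2 = ‖x‖ ^ 2 := by
    rw [norm_sq_plane, planeCoord_apply, ← Complex.normSq_eq_norm_sq, Complex.normSq_add_mul_I]
  exact (pow_left_inj₀ (norm_nonneg _) (norm_nonneg _) two_ne_zero).1 this

theorem norm_phase {x : EuclideanSpace ℝ (Fin 2)} (hx : x ≠ 0) : ‖phase x‖ = 1 := by
  have : ‖x‖ ≠ 0 := norm_ne_zero_iff.2 hx
  simp [phase, norm_planeCoord, this]

theorem phase_ne_zero {x : EuclideanSpace ℝ (Fin 2)} (hx : x ≠ 0) : phase x ≠ 0 := by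
  rw [← norm_ne_zero_iff, norm_phase hx]; exact one_ne_zero

theorem hasFDerivAt_proj_plane (i : Fin 2) (x : EuclideanSpace ℝ (Fin 2)) :
    HasFDerivAt (fun y : EuclideanSpace ℝ (Fin 2) => y i)
      (EuclideanSpace.proj i : EuclideanSpace ℝ (Fin 2) →L[ℝ] ℝ) x :=
  (EuclideanSpace.proj i : EuclideanSpace ℝ (Fin 2) →L[ℝ] ℝ).hasFDerivAt

theorem hasFDerivAt_norm_sq_plane (x : EuclideanSpace ℝ (Fin 2)) :
    HasFDerivAt (fun y : EuclideanSpace ℝ (Fin 2) => ‖y‖ ^ 2)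
      ((2 * x 0) • (EuclideanSpace.proj 0 : EuclideanSpace ℝ (Fin 2) →L[ℝ] ℝ) +
        (2 * x 1) • (EuclideanSpace.proj 1 : EuclideanSpace ℝ (Fin 2) →L[ℝ] ℝ)) x := by
  have h := ((hasFDerivAt_proj_plane 0 x).pow 2).add ((hasFDerivAt_proj_plane 1 x).pow 2)
  refine (h.congr_of_eventuallyEq (Eventually.of_forall norm_sq_plane)).congr_fderiv ?_
  ext v; simp

theorem hasFDerivAt_log_norm {x : EuclideanSpace ℝ (Fin 2)} (hx : x ≠ 0) :
    HasFDerivAt (fun y : EuclideanSpace ℝ (Fin 2) => Real.log ‖y‖) (radialForm x) x := by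
  have hx' : ‖x‖ ^ 2 ≠ 0 := pow_ne_zero _ (norm_ne_zero_iff.2 hx)
  have h := ((hasFDerivAt_norm_sq_plane x).log hx').const_mul (1 / 2 : ℝ)
  refine (h.congr_of_eventuallyEq (Eventually.of_forall fun y => ?_)).congr_fderiv ?_
  · simp [Real.log_pow]
  · ext v
    simp [radialForm]
    field_simp

theorem hasFDerivAt_phase {x : EuclideanSpace ℝ (Fin 2)} (hx : x ≠ 0) :
    HasFDerivAt phase ((angularForm x).smulRight (Complex.I * phase x)) x := by
  have hx' : ‖x‖ ≠ 0 := norm_ne_zero_iff.2 hx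
  have h1 : HasFDerivAt (fun y : EuclideanSpace ℝ (Fin 2) => ‖y‖⁻¹)
      ((-‖x‖⁻¹) • radialForm x) x := by
    have h := ((hasFDerivAt_log_norm hx).neg).exp
    have he : (fun y : EuclideanSpace ℝ (Fin 2) => ‖y‖⁻¹) =ᶠ[𝓝 x]
        fun y => Real.exp (-Real.log ‖y‖) := by
      filter_upwards [isOpen_ne.mem_nhds hx] with y hy
      rw [Real.exp_neg, Real.exp_log (norm_pos_iff.2 hy)]
    refine (h.congr_of_eventuallyEq he).congr_fderiv ?_
    rw [Pi.neg_apply, Real.exp_neg, Real.exp_log (norm_pos_iff.2 hx)]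
    ext v
    simp
  have h2 := planeCoord.hasFDerivAt.mul
    ((Complex.ofRealCLM.hasFDerivAt (x := ‖x‖⁻¹)).comp x h1)
  refine h2.congr_fderiv ?_
  have hc : (‖x‖ : ℂ) ≠ 0 := Complex.ofReal_ne_zero.2 hx'
  have hs : (‖x‖ : ℂ) ^ 2 = (x 0 : ℂ) ^ 2 + (x 1 : ℂ) ^ 2 := by
    exact_mod_cast norm_sq_plane x
  ext v
  simp [radialForm, angularForm, phase, planeCoord_apply]
  field_simp
  rw [hs]
  ring_nf
  simp only [Complex.I_sq]
  ring

theorem hasFDerivAt_mode {f : ℝ → ℂ} {f' : ℂ} {m : ℤ} {x : EuclideanSpace ℝ (Fin 2)} (hx : x ≠ 0)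
    (hf : HasDerivAt f f' (Real.log ‖x‖)) :
    HasFDerivAt (mode f m) ((radialForm x).smulRight (f' * phase x ^ m) +
      (angularForm x).smulRight (Complex.I * m * mode f m x)) x := by
  have h1 := hf.hasFDerivAt.comp x (hasFDerivAt_log_norm hx)
  have h2 := (((hasDerivAt_zpow m (phase x) (Or.inl (phase_ne_zero hx))).hasFDerivAt).restrictScalars
    ℝ).comp x (hasFDerivAt_phase hx)
  refine (h1.mul h2).congr_fderiv ?_
  ext v
  have : phase x ^ m = phase x ^ (m - 1) * phase x := by
    rw [zpow_sub_one₀ (phase_ne_zero hx), inv_mul_cancel_right₀ (phase_ne_zero hx)]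
  simp [mode, this]
  ring

theorem contDiffAt_phase {x : EuclideanSpace ℝ (Fin 2)} (hx : x ≠ 0) {k : WithTop ℕ∞} :
    ContDiffAt ℝ k phase x := by
  refine planeCoord.contDiff.contDiffAt.mul ?_
  exact Complex.ofRealCLM.contDiff.contDiffAt.comp x
    ((contDiffAt_norm ℝ hx).inv (norm_ne_zero_iff.2 hx))

theorem contDiffAt_mode {f : ℝ → ℂ} {m : ℤ} {x : EuclideanSpace ℝ (Fin 2)} (hx : x ≠ 0)
    {k : WithTop ℕ∞} (hf : ContDiffAt ℝ k f (Real.log ‖x‖)) : ContDiffAt ℝ k (mode f m) x := by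
  refine ContDiffAt.mul (hf.comp x ((contDiffAt_norm ℝ hx).log (norm_ne_zero_iff.2 hx))) ?_
  cases m with
  | ofNat m => simpa using (contDiffAt_phase hx).pow m
  | negSucc m =>
    simp only [zpow_negSucc]
    exact ((contDiffAt_phase hx).pow (m + 1)).inv (pow_ne_zero _ (phase_ne_zero hx))

/-- The Laplacian in logarithmic polar coordinates. -/
theorem laplacian_mode {f f' f'' : ℝ → ℂ} {m : ℤ} {x : EuclideanSpace ℝ (Fin 2)} (hx : x ≠ 0)
    (hc : ContDiffAt ℝ 2 f (Real.log ‖x‖))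
    (hf : ∀ s, HasDerivAt f (f' s) s) (hf' : ∀ s, HasDerivAt f' (f'' s) s) :
    Δ (mode f m) x = ((‖x‖ ^ 2)⁻¹ : ℝ) *
      ((f'' (Real.log ‖x‖) - m ^ 2 * f (Real.log ‖x‖)) * phase x ^ m) := by
  have hx' : ‖x‖ ≠ 0 := norm_ne_zero_iff.2 hx
  have hx2 : ‖x‖ ^ 2 ≠ 0 := pow_ne_zero _ hx'
  have hs : (‖x‖ : ℂ) ^ 2 = (x 0 : ℂ) ^ 2 + (x 1 : ℂ) ^ 2 := by
    exact_mod_cast norm_sq_plane x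
  have hcx : (‖x‖ : ℂ) ≠ 0 := Complex.ofReal_ne_zero.2 hx'
  have hq : ∀ i : Fin 2, HasFDerivAt (fun y : EuclideanSpace ℝ (Fin 2) => ((y i / ‖y‖ ^ 2 : ℝ) : ℂ))
      (Complex.ofRealCLM.comp (x i • (-((‖x‖ ^ 2) ^ 2)⁻¹ •
        ((2 * x 0) • (EuclideanSpace.proj 0 : EuclideanSpace ℝ (Fin 2) →L[ℝ] ℝ) +
        (2 * x 1) • (EuclideanSpace.proj 1 : EuclideanSpace ℝ (Fin 2) →L[ℝ] ℝ)))
        + (‖x‖ ^ 2)⁻¹ • (EuclideanSpace.proj i : EuclideanSpace ℝ (Fin 2) →L[ℝ] ℝ))) x := by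
    intro i
    have h2 : HasFDerivAt (fun y : EuclideanSpace ℝ (Fin 2) => (‖y‖ ^ 2)⁻¹) _ x :=
      (hasDerivAt_inv hx2).comp_hasFDerivAt x (hasFDerivAt_norm_sq_plane x)
    exact (Complex.ofRealCLM.hasFDerivAt).comp x ((hasFDerivAt_proj_plane i x).mul h2)
  have hm := hasFDerivAt_mode (m := m) hx (hf (Real.log ‖x‖))
  have hm' := hasFDerivAt_mode (m := m) hx (hf' (Real.log ‖x‖))
  -- The Cartesian partials in polar form: r⁻²(x₀∂_s - x₁∂_θ) and r⁻²(x₁∂_s + x₀∂_θ), with ∂_θ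
  -- acting as multiplication by im.
  rw [laplacian_eq_sum_of_hasFDerivAt (contDiffAt_mode hx hc)
    ![fun y => ((y 0 / ‖y‖ ^ 2 : ℝ) : ℂ) * mode f' m y -
        Complex.I * m * (((y 1 / ‖y‖ ^ 2 : ℝ) : ℂ) * mode f m y),
      fun y => ((y 1 / ‖y‖ ^ 2 : ℝ) : ℂ) * mode f' m y +
        Complex.I * m * (((y 0 / ‖y‖ ^ 2 : ℝ) : ℂ) * mode f m y)] _ ?_ (fun i => rfl)]
  · rw [Fin.sum_univ_two]
    simp only [Matrix.cons_val_zero, Matrix.cons_val_one]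
    have h0 : HasFDerivAt (fun y : EuclideanSpace ℝ (Fin 2) => ((y 0 / ‖y‖ ^ 2 : ℝ) : ℂ) *
        mode f' m y - Complex.I * m * (((y 1 / ‖y‖ ^ 2 : ℝ) : ℂ) * mode f m y)) _ x :=
      ((hq 0).mul hm').sub (((hq 1).mul hm).const_mul (Complex.I * m))
    have h1 : HasFDerivAt (fun y : EuclideanSpace ℝ (Fin 2) => ((y 1 / ‖y‖ ^ 2 : ℝ) : ℂ) *
        mode f' m y + Complex.I * m * (((y 0 / ‖y‖ ^ 2 : ℝ) : ℂ) * mode f m y)) _ x :=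
      ((hq 1).mul hm').add (((hq 0).mul hm).const_mul (Complex.I * m))
    rw [h0.fderiv, h1.fderiv]
    simp [radialForm, angularForm, mode]
    field_simp
    simp only [hs]
    ring_nf
    simp only [Complex.I_sq]
    ring
  · filter_upwards [isOpen_ne.mem_nhds hx] with y hy i
    rw [(hasFDerivAt_mode hy (hf (Real.log ‖y‖))).fderiv]
    fin_cases i <;> simp [radialForm, angularForm, mode] <;> ring

/-! ### Pointwise algebra and estimates on one transition annulus -/

/-- Size conditions on the parameters of one transition annulus, in which the angular frequency
passes from `J ^ 2` to `-(J + 1) ^ 2`. -/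
structure TransitionParams (K J p : ℝ) (q ε A B Λ : ℂ) : Prop where
  one_le_K : 1 ≤ K
  one_le_J : 1 ≤ J
  two_mul_le : 2 * J + 1 ≤ J ^ 2 / 1000
  p_nonneg : 0 ≤ p
  p_le : p ≤ K * J
  p_small : K * p ≤ J ^ 2 / 1000
  q_re : 0 ≤ q.re
  q_sq : q ^ 2 = (J : ℂ) ^ 4 - Λ
  q_norm : ‖q‖ ≤ 2 * J ^ 2
  q_near : ‖q - (J : ℂ) ^ 2‖ ≤ J ^ 2 / 100
  A_eq : A = (-q + p) ^ 2 - (((J : ℂ) + 1) ^ 2) ^ 2 + Λ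
  B_eq : B = (-q + 2 * p) ^ 2 - ((J : ℂ) ^ 2 + 2 * ((J : ℂ) + 1) ^ 2) ^ 2 + Λ
  A_le : ‖A‖ ≤ K * J ^ 3
  eps_mul : ε * (B - A) = A
  eps_le : ‖ε‖ ≤ 1 / 1000

/-- Values and derivatives of the three cutoff factors at a point `τ` of a transition annulus,
with `e` the value there of the exponential ramp. -/
structure CutoffValues (K τ : ℝ) (e x x' x'' y y' y'' z z' z'' : ℂ) : Prop where
  x_le : ‖x‖ ≤ 1
  x'_le : ‖x'‖ ≤ K
  x''_le : ‖x''‖ ≤ K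
  y_le : ‖y‖ ≤ ‖e‖
  y'_le : ‖y'‖ ≤ K * ‖e‖
  y''_le : ‖y''‖ ≤ K * ‖e‖
  z_le : ‖z‖ ≤ 1
  z'_le : ‖z'‖ ≤ K
  z''_le : ‖z''‖ ≤ K
  e_eq : τ ≤ 7 → e = 1
  x_eq : τ < 6 → x = 1 ∧ x' = 0 ∧ x'' = 0
  y_eq : 3 < τ → y = e
  flat : 3 < τ → τ < 6 → y = 1 ∧ y' = 0 ∧ y'' = 0 ∧ z = 1 ∧ z' = 0 ∧ z'' = 0
  tail : 7 < τ → x = 0 ∧ x' = 0 ∧ x'' = 0 ∧ z = 0 ∧ z' = 0 ∧ z'' = 0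

/-- The value of `(∂ₛ² - m² + ℓ)` applied to `X (p s) e^{μ s}`, divided by `e^{μ s}`; here `k`
stands for `μ ^ 2 - m ^ 2`. -/
theorem norm_modeOp_le {K J p E : ℝ} {a μ k l x x' x'' : ℂ} (hK : 1 ≤ K) (hJ : 1 ≤ J)
    (hp : 0 ≤ p) (hpJ : p ≤ K * J) (hμ : ‖μ‖ ≤ 3 * J ^ 2) (ha : ‖a‖ ≤ 2) (hk : ‖a * k‖ ≤ 3 * K * J ^ 3)
    (hl : ‖l‖ ≤ K * J ^ 3) (hx : ‖x‖ ≤ K * E) (hx' : ‖x'‖ ≤ K * E) (hx'' : ‖x''‖ ≤ K * E) :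
    ‖a * ((k + l) * x + 2 * μ * p * x' + p ^ 2 * x'')‖ ≤ 25 * K ^ 3 * J ^ 3 * E := by
  have hE : 0 ≤ K * E := (norm_nonneg _).trans hx
  have h1 : ‖(a * k) * x‖ ≤ 3 * K * J ^ 3 * (K * E) := by
    rw [norm_mul]; gcongr
  have h2 : ‖(a * l) * x‖ ≤ 2 * (K * J ^ 3) * (K * E) := by
    rw [norm_mul, norm_mul]; gcongr
  have hpn : ‖(p : ℂ)‖ ≤ K * J := by rwa [Complex.norm_real, Real.norm_of_nonneg hp]
  have h3 : ‖a * (2 * μ * p * x')‖ ≤ 2 * (2 * (3 * J ^ 2) * (K * J) * (K * E)) := by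
    simp only [norm_mul, Complex.norm_ofNat]; gcongr
  have h4 : ‖a * (p ^ 2 * x'')‖ ≤ 2 * ((K * J) ^ 2 * (K * E)) := by
    simp only [norm_mul, norm_pow]; gcongr
  have e : a * ((k + l) * x + 2 * μ * p * x' + p ^ 2 * x'') =
      (a * k) * x + (a * l) * x + a * (2 * μ * p * x') + a * (p ^ 2 * x'') := by ring
  rw [e]
  have hJ3 : J ^ 2 ≤ J ^ 3 := pow_le_pow_right₀ hJ (by norm_num)
  have hK2 : K ≤ K ^ 2 := by nlinarith
  calc _ ≤ 3 * K * J ^ 3 * (K * E) + 2 * (K * J ^ 3) * (K * E) +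
        2 * (2 * (3 * J ^ 2) * (K * J) * (K * E)) + 2 * ((K * J) ^ 2 * (K * E)) :=
        norm_add_le_of_le (norm_add_le_of_le (norm_add_le_of_le h1 h2) h3) h4
    _ = (K * J ^ 3 * 5 + K * J ^ 3 * 12 + 2 * K ^ 2 * J ^ 2) * (K * E) := by ring
    _ ≤ (K ^ 2 * J ^ 3 * 5 + K ^ 2 * J ^ 3 * 12 + 2 * K ^ 2 * J ^ 3) * (K * E) := by gcongr
    _ = 19 * K ^ 2 * J ^ 3 * (K * E) := by ring
    _ ≤ 25 * K ^ 2 * J ^ 3 * (K * E) := by gcongr; norm_num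
    _ = _ := by ring

section Transition

variable {K J p τ : ℝ} {q ε A B Λ l e x x' x'' y y' y'' z z' z'' T w : ℂ}

/-- The function on a transition annulus, in terms of the values of its ingredients. -/
noncomputable def trU (ε x y z T w : ℂ) : ℂ := w * (x - (1 + ε) * y * T + ε * z * T ^ 2)

/-- Its derivative in the logarithm of the radius. -/
noncomputable def trS (p : ℝ) (q ε x x' y y' z z' T w : ℂ) : ℂ :=
  w * ((-q * x + p * x') - (1 + ε) * ((-q + p) * y + p * y') * T +
    ε * ((-q + 2 * p) * z + p * z') * T ^ 2)

/-- Its normalized angular derivative. -/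
noncomputable def trV (J : ℝ) (ε x y z T w : ℂ) : ℂ :=
  w * ((J : ℂ) ^ 2 * x + (1 + ε) * ((J : ℂ) + 1) ^ 2 * y * T -
    ε * ((J : ℂ) ^ 2 + 2 * ((J : ℂ) + 1) ^ 2) * z * T ^ 2)

/-- Its image under `∂ₛ² + ∂_θ² + l`. -/
noncomputable def trL (J p : ℝ) (q ε l x x' x'' y y' y'' z z' z'' T w : ℂ) : ℂ :=
  w * ((q ^ 2 * x + 2 * (-q) * p * x' + p ^ 2 * x'' - ((J : ℂ) ^ 2) ^ 2 * x + l * x)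
    - (1 + ε) * ((-q + p) ^ 2 * y + 2 * (-q + p) * p * y' + p ^ 2 * y''
      - (((J : ℂ) + 1) ^ 2) ^ 2 * y + l * y) * T
    + ε * ((-q + 2 * p) ^ 2 * z + 2 * (-q + 2 * p) * p * z' + p ^ 2 * z''
      - ((J : ℂ) ^ 2 + 2 * ((J : ℂ) + 1) ^ 2) ^ 2 * z + l * z) * T ^ 2)

theorem TransitionParams.norm_p (h : TransitionParams K J p q ε A B Λ) : ‖(p : ℂ)‖ = p := by
  rw [Complex.norm_real, Real.norm_of_nonneg h.p_nonneg]

theorem TransitionParams.p_le_sq (h : TransitionParams K J p q ε A B Λ) : p ≤ J ^ 2 / 1000 := by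
  have := h.p_small
  have := h.one_le_K
  nlinarith [h.p_nonneg]

theorem TransitionParams.norm_one_add (h : TransitionParams K J p q ε A B Λ) :
    ‖1 + ε‖ ≤ 1001 / 1000 := by
  have := norm_add_le_of_le (a₁ := (1 : ℂ)) norm_one.le h.eps_le
  linarith

theorem TransitionParams.le_norm_one_add (h : TransitionParams K J p q ε A B Λ) :
    999 / 1000 ≤ ‖1 + ε‖ := by
  have := norm_sub_norm_le (1 : ℂ) (-ε)
  rw [norm_neg, norm_one, sub_neg_eq_add] at this
  linarith [h.eps_le]

theorem TransitionParams.norm_mu (h : TransitionParams K J p q ε A B Λ) {c : ℂ} (hc : ‖c‖ ≤ 2) :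
    ‖-q + c * p‖ ≤ 3 * J ^ 2 := by
  have h1 : ‖c * p‖ ≤ 2 * p := by
    rw [norm_mul, h.norm_p]; exact mul_le_mul_of_nonneg_right hc h.p_nonneg
  have h2 := norm_add_le_of_le (a₁ := -q) (norm_neg q).le h1
  have := h.q_norm
  have := h.p_le_sq
  nlinarith [sq_nonneg J]

/-- Upper bound for `∂ₛ² + ∂_θ² + l` by the leading factor. -/
theorem norm_trL_le (h : TransitionParams K J p q ε A B Λ)
    (hc : CutoffValues K τ e x x' x'' y y' y'' z z' z'') (hl : ‖l - Λ‖ ≤ K * J ^ 3)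
    (he : τ ≤ 7) (hT : ‖T‖ ≤ 8) :
    ‖trL J p q ε l x x' x'' y y' y'' z z' z'' T w‖ ≤ 2000 * K ^ 3 * J ^ 3 * ‖w‖ := by
  have hK := h.one_le_K
  have hJ := h.one_le_J
  have hK0 : 0 ≤ K := by linarith
  have hJ3 : 0 ≤ K * J ^ 3 := by positivity
  have he1 : ‖e‖ = 1 := by rw [hc.e_eq he, norm_one]
  -- This identity makes the defect of the third mode, weighted by ε, of order J³, although B itself
  -- may be of order J⁴.
  have hεB : ε * B = (1 + ε) * A := by linear_combination h.eps_mul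
  have ho := h.norm_one_add
  have h1 := norm_modeOp_le (E := 1) (a := 1) (μ := -q) (k := 0) (l := l - Λ) (x := x) (x' := x')
    (x'' := x'') hK hJ h.p_nonneg h.p_le (by simpa using h.norm_mu (c := 0) (by simp)) (by simp)
    (by simp; positivity) hl (by linarith [hc.x_le]) (by simpa using hc.x'_le)
    (by simpa using hc.x''_le)
  have h2 := norm_modeOp_le (E := 1) (a := 1 + ε) (μ := -q + p) (k := A) (l := l - Λ) (x := y)
    (x' := y') (x'' := y'') hK hJ h.p_nonneg h.p_le (by simpa using h.norm_mu (c := 1) (by simp))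
    (by linarith) (by
      rw [norm_mul]
      calc _ ≤ 2 * (K * J ^ 3) := by
            gcongr
            · linarith
            · exact h.A_le
        _ ≤ _ := by linarith)
    hl (by linarith [hc.y_le]) (by simpa [he1] using hc.y'_le)
    (by simpa [he1] using hc.y''_le)
  have h3 := norm_modeOp_le (E := 1) (a := ε) (μ := -q + 2 * p) (k := B) (l := l - Λ) (x := z)
    (x' := z') (x'' := z'') hK hJ h.p_nonneg h.p_le (by simpa using h.norm_mu (c := 2) (by simp))
    (by linarith [h.eps_le]) (by
      rw [hεB, norm_mul]
      calc _ ≤ 2 * (K * J ^ 3) := by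
            gcongr
            · linarith
            · exact h.A_le
        _ ≤ _ := by linarith)
    hl (by linarith [hc.z_le]) (by simpa using hc.z'_le) (by simpa using hc.z''_le)
  set S := 25 * K ^ 3 * J ^ 3 * 1 with hS
  have hS0 : 0 ≤ S := by positivity
  -- Split l = Λ + (l - Λ). The frozen part has defect 0, A, B on the three modes, by the choice of
  -- q² and the definitions of A and B.
  have e1 : trL J p q ε l x x' x'' y y' y'' z z' z'' T w =
      w * (1 * ((0 + (l - Λ)) * x + 2 * -q * p * x' + p ^ 2 * x'')
        - (1 + ε) * ((A + (l - Λ)) * y + 2 * (-q + p) * p * y' + p ^ 2 * y'') * T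
        + ε * ((B + (l - Λ)) * z + 2 * (-q + 2 * p) * p * z' + p ^ 2 * z'') * T ^ 2) := by
    rw [trL, h.A_eq, h.B_eq]
    linear_combination w * x * h.q_sq
  rw [e1, norm_mul, mul_comm]
  gcongr
  have hT2 : ‖T ^ 2‖ ≤ 64 := by
    rw [norm_pow]; nlinarith [norm_nonneg T]
  have h2' := norm_mul_le_of_le h2 hT
  have h3' := norm_mul_le_of_le h3 hT2
  have := norm_add_le_of_le (norm_sub_le_of_le h1 h2') h3'
  refine this.trans ?_
  rw [hS]
  nlinarith [show 0 ≤ K ^ 3 * J ^ 3 by positivity]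

/-- In the region where the function may vanish, the equation holds with a controlled potential. -/
theorem norm_trL_le_of_flat (h : TransitionParams K J p q ε A B Λ)
    (hc : CutoffValues K τ e x x' x'' y y' y'' z z' z'') (hl : ‖l - Λ‖ ≤ K * J ^ 3)
    (h3 : 3 < τ) (h6 : τ < 6) (hT : ‖T‖ ≤ 3) :
    ‖trL J p q ε l x x' x'' y y' y'' z z' z'' T w‖ ≤ 8 * K * J ^ 3 * ‖trU ε x y z T w‖ := by
  obtain ⟨rfl, rfl, rfl⟩ := hc.x_eq h6
  obtain ⟨rfl, rfl, rfl, rfl, rfl, rfl⟩ := hc.flat h3 h6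
  have hεB : ε * B = (1 + ε) * A := by linear_combination h.eps_mul
  have hε := h.eps_le
  have hεT : ‖ε * T‖ ≤ 1 / 2 := by
    rw [norm_mul]; nlinarith [norm_nonneg T, norm_nonneg ε]
  have hd : 1 / 2 ≤ ‖1 - ε * T‖ := by
    have := norm_sub_norm_le (1 : ℂ) (ε * T)
    rw [norm_one] at this; linarith
  -- The quadratic in T has roots 1 and 1/ε, and the second lies outside |T| ≤ 3. By εB = (1+ε)A the
  -- defect below has the same factor 1 - T, so the quotient stays bounded across the zeros of u.
  have hU : trU ε 1 1 1 T w = w * ((1 - T) * (1 - ε * T)) := by rw [trU]; ring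
  have hL : trL J p q ε l 1 0 0 1 0 0 1 0 0 T w =
      (l - Λ) * trU ε 1 1 1 T w - (1 + ε) * A * T * (w * (1 - T)) := by
    rw [trL, hU]
    rw [h.A_eq, h.B_eq] at hεB
    rw [h.A_eq]
    linear_combination w * h.q_sq + w * T ^ 2 * hεB
  rw [hL]
  have hw : ‖w * (1 - T)‖ ≤ 2 * ‖trU ε 1 1 1 T w‖ := by
    rw [hU, ← mul_assoc, norm_mul (w * (1 - T))]
    nlinarith [norm_nonneg (w * (1 - T))]
  have hKJ : 0 ≤ K * J ^ 3 := (norm_nonneg _).trans h.A_le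
  have hA : ‖(1 + ε) * A * T‖ ≤ 1001 / 1000 * (K * J ^ 3) * 3 := by
    rw [norm_mul, norm_mul]
    have := h.norm_one_add
    have := h.A_le
    gcongr
  have h1 := norm_mul_le_of_le hl (le_refl ‖trU ε 1 1 1 T w‖)
  have h2 := norm_mul_le_of_le hA hw
  refine (norm_sub_le_of_le h1 h2).trans ?_
  nlinarith [mul_nonneg hKJ (norm_nonneg (trU ε 1 1 1 T w))]

/-- Only the incoming mode survives. Its factor is the exponential e itself, with derivatives
bounded by K‖e‖, so dividing by the function costs nothing. -/
theorem norm_trL_le_of_tail (h : TransitionParams K J p q ε A B Λ)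
    (hc : CutoffValues K τ e x x' x'' y y' y'' z z' z'') (hl : ‖l - Λ‖ ≤ K * J ^ 3)
    (h7 : 7 < τ) :
    ‖trL J p q ε l x x' x'' y y' y'' z z' z'' T w‖ ≤ 25 * K ^ 3 * J ^ 3 * ‖trU ε x y z T w‖ := by
  obtain ⟨rfl, rfl, rfl, rfl, rfl, rfl⟩ := hc.tail h7
  have hK := h.one_le_K
  have hJ := h.one_le_J
  have hK0 : 0 ≤ K := by linarith
  have hye := hc.y_eq (by linarith)
  have hKJ : 0 ≤ K * J ^ 3 := (norm_nonneg _).trans h.A_le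
  have h2 := norm_modeOp_le (E := ‖e‖) (a := 1) (μ := -q + p) (k := A) (l := l - Λ) (x := y)
    (x' := y') (x'' := y'') hK hJ h.p_nonneg h.p_le (by simpa using h.norm_mu (c := 1) (by simp))
    (by simp) (by simpa using h.A_le.trans (by linarith))
    hl (hc.y_le.trans (le_mul_of_one_le_left (norm_nonneg _) hK)) hc.y'_le hc.y''_le
  have e1 : trL J p q ε l 0 0 0 y y' y'' 0 0 0 T w = -(w * (1 + ε) * T) *
      (1 * ((A + (l - Λ)) * y + 2 * (-q + p) * p * y' + p ^ 2 * y'')) := by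
    rw [trL, h.A_eq]; ring
  have e2 : trU ε 0 y 0 T w = -(w * (1 + ε) * T) * e := by rw [trU, hye]; ring
  rw [e1, e2, norm_mul, norm_mul _ e]
  calc _ ≤ ‖-(w * (1 + ε) * T)‖ * (25 * K ^ 3 * J ^ 3 * ‖e‖) := by gcongr
    _ = _ := by ring

/-- Away from the possible zeros the leading factor is controlled by the function. -/
theorem norm_w_le_of_lt (h : TransitionParams K J p q ε A B Λ)
    (hc : CutoffValues K τ e x x' x'' y y' y'' z z' z'') (h6 : τ < 6) (hT : ‖T‖ ≤ 1 / 2) :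
    ‖w‖ ≤ 4 * ‖trU ε x y z T w‖ := by
  obtain ⟨rfl, rfl, rfl⟩ := hc.x_eq h6
  have he := hc.e_eq (by linarith)
  have hy : ‖y‖ ≤ 1 := by simpa [he] using hc.y_le
  have hz := hc.z_le
  have ho := h.norm_one_add
  have hε := h.eps_le
  have h1 : ‖(1 + ε) * y * T‖ ≤ 1001 / 1000 * 1 * (1 / 2) := by
    rw [norm_mul, norm_mul]; gcongr
  have h2 : ‖ε * z * T ^ 2‖ ≤ 1 / 1000 * 1 * (1 / 2) ^ 2 := by
    rw [norm_mul, norm_mul, norm_pow]; gcongr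
  have h3 : 1 / 4 ≤ ‖1 - (1 + ε) * y * T + ε * z * T ^ 2‖ := by
    have := norm_sub_norm_le (1 : ℂ) ((1 + ε) * y * T - ε * z * T ^ 2)
    have h4 := norm_sub_le_of_le h1 h2
    rw [norm_one, show (1 : ℂ) - ((1 + ε) * y * T - ε * z * T ^ 2) =
      1 - (1 + ε) * y * T + ε * z * T ^ 2 by ring] at this
    linarith
  rw [trU, norm_mul]
  nlinarith [norm_nonneg w]

/-- The incoming mode dominates: it has relative size at least 1.49, against at most 1 + 0.064 for
the other two together. -/
theorem norm_w_le_of_le (h : TransitionParams K J p q ε A B Λ)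
    (hc : CutoffValues K τ e x x' x'' y y' y'' z z' z'') (h3 : 3 < τ) (h7 : τ ≤ 7)
    (hT : 3 / 2 ≤ ‖T‖) (hT8 : ‖T‖ ≤ 8) :
    ‖w‖ ≤ 4 * ‖trU ε x y z T w‖ := by
  have hy : y = 1 := by rw [hc.y_eq h3, hc.e_eq h7]
  have hx := hc.x_le
  have hz := hc.z_le
  have ho := h.le_norm_one_add
  have hε := h.eps_le
  have h1 : 999 / 1000 * (3 / 2) ≤ ‖(1 + ε) * y * T‖ := by
    rw [hy, mul_one, norm_mul]; gcongr
  have h2 : ‖ε * z * T ^ 2‖ ≤ 1 / 1000 * 1 * 8 ^ 2 := by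
    rw [norm_mul, norm_mul, norm_pow]; gcongr
  have h3 : 1 / 4 ≤ ‖x - (1 + ε) * y * T + ε * z * T ^ 2‖ := by
    have := norm_sub_norm_le ((1 + ε) * y * T) (x + ε * z * T ^ 2)
    have h4 := norm_add_le_of_le hx h2
    rw [norm_sub_rev, show x + ε * z * T ^ 2 - (1 + ε) * y * T =
      x - (1 + ε) * y * T + ε * z * T ^ 2 by ring] at this
    linarith
  rw [trU, norm_mul]
  nlinarith [norm_nonneg w]

theorem norm_trU_le (h : TransitionParams K J p q ε A B Λ)
    (hc : CutoffValues K τ e x x' x'' y y' y'' z z' z'') {t : ℝ} (hT : ‖T‖ ≤ t) :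
    ‖trU ε x y z T w‖ ≤ (1 + 2 * ‖e‖ * t + t ^ 2 / 1000) * ‖w‖ := by
  have hx := hc.x_le
  have hy := hc.y_le
  have hz := hc.z_le
  have ho : ‖1 + ε‖ ≤ 2 := h.norm_one_add.trans (by norm_num)
  have hε := h.eps_le
  have h1 : ‖(1 + ε) * y * T‖ ≤ 2 * ‖e‖ * t := by
    rw [norm_mul, norm_mul]; gcongr
  have h2 : ‖ε * z * T ^ 2‖ ≤ 1 / 1000 * 1 * t ^ 2 := by
    rw [norm_mul, norm_mul, norm_pow]; gcongr
  rw [trU, norm_mul, mul_comm]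
  gcongr
  refine (norm_add_le_of_le (norm_sub_le_of_le hx h1) h2).trans (le_of_eq ?_)
  ring

/-- The difference of the radial and the normalized angular derivative acts like a Cauchy–Riemann
operator. It multiplies the outgoing mode by -(q + J²), of size at least J², and the incoming one by
a quantity small compared with J², since the two frequencies have opposite signs. Hence the gradient
controls J²‖w‖ even where the two modes cancel in u or in one of the derivatives. -/
theorem norm_trU_le_grad_of_lt (h : TransitionParams K J p q ε A B Λ)
    (hc : CutoffValues K τ e x x' x'' y y' y'' z z' z'') (h6 : τ < 6) (hT : ‖T‖ ≤ 3) :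
    J ^ 2 * ‖trU ε x y z T w‖ ≤
      100 * (‖trS p q ε x x' y y' z z' T w‖ + ‖trV J ε x y z T w‖) := by
  have hu := norm_trU_le (w := w) h hc hT
  obtain ⟨rfl, rfl, rfl⟩ := hc.x_eq h6
  have he := hc.e_eq (by linarith)
  have hy : ‖y‖ ≤ 1 := by simpa [he] using hc.y_le
  have hy' : ‖y'‖ ≤ K := by simpa [he] using hc.y'_le
  have hz := hc.z_le
  have hz' := hc.z'_le
  have ho := h.norm_one_add
  have hε := h.eps_le
  have hJ := h.one_le_J
  have hJ2 := h.two_mul_le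
  have hps := h.p_small
  have hp1 := h.p_le_sq
  have hp := h.p_nonneg
  have hpn := h.norm_p
  -- In the coefficient of T, -q + (J+1)² is written as -(q - J²) + (2J+1); both terms are small
  -- relative to J².
  have hD : trS p q ε 1 0 y y' z z' T w - trV J ε 1 y z T w =
      w * (-(q + (J : ℂ) ^ 2) - (1 + ε) * ((-(q - (J : ℂ) ^ 2) + (2 * J + 1 : ℝ) + p) * y + p * y') * T
        + ε * ((-q + 2 * p + (J ^ 2 + 2 * (J + 1) ^ 2 : ℝ)) * z + p * z') * T ^ 2) := by
    rw [trS, trV]; push_cast; ring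
  have h0 : J ^ 2 ≤ ‖-(q + (J : ℂ) ^ 2)‖ := by
    rw [norm_neg]
    refine le_trans ?_ (Complex.re_le_norm _)
    have : ((J : ℂ) ^ 2).re = J ^ 2 := by norm_cast
    rw [Complex.add_re, this]
    linarith [h.q_re]
  have hpy : ‖p * y'‖ ≤ J ^ 2 / 1000 := by
    rw [norm_mul, hpn]
    calc p * ‖y'‖ ≤ p * K := by gcongr
      _ ≤ _ := by linarith
  have hpz : ‖p * z'‖ ≤ J ^ 2 / 1000 := by
    rw [norm_mul, hpn]
    calc p * ‖z'‖ ≤ p * K := by gcongr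
      _ ≤ _ := by linarith
  have h1 : ‖(-(q - (J : ℂ) ^ 2) + (2 * J + 1 : ℝ) + p) * y + p * y'‖ ≤ J ^ 2 * (2 / 100) := by
    have a1 : ‖-(q - (J : ℂ) ^ 2)‖ ≤ J ^ 2 / 100 := by rw [norm_neg]; exact h.q_near
    have a2 : ‖((2 * J + 1 : ℝ) : ℂ)‖ ≤ J ^ 2 / 1000 := by
      rw [Complex.norm_real, Real.norm_of_nonneg (by linarith)]; exact hJ2
    have a3 : ‖(p : ℂ)‖ ≤ J ^ 2 / 1000 := by rw [hpn]; exact hp1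
    have := norm_add_le_of_le (norm_mul_le_of_le (norm_add_le_of_le (norm_add_le_of_le a1 a2) a3) hy)
      hpy
    refine this.trans ?_
    nlinarith [sq_nonneg J]
  have h2 : ‖(-q + 2 * p + (J ^ 2 + 2 * (J + 1) ^ 2 : ℝ)) * z + p * z'‖ ≤ J ^ 2 * 6 := by
    have a1 : ‖-q‖ ≤ 2 * J ^ 2 := by rw [norm_neg]; exact h.q_norm
    have a2 : ‖2 * (p : ℂ)‖ ≤ 2 * (J ^ 2 / 1000) := by
      rw [norm_mul, hpn, Complex.norm_ofNat]; linarith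
    have a3 : ‖((J ^ 2 + 2 * (J + 1) ^ 2 : ℝ) : ℂ)‖ ≤ J ^ 2 * (31 / 10) := by
      rw [Complex.norm_real, Real.norm_of_nonneg (by positivity)]
      nlinarith
    have := norm_add_le_of_le (norm_mul_le_of_le (norm_add_le_of_le (norm_add_le_of_le a1 a2) a3) hz)
      hpz
    refine this.trans ?_
    nlinarith [sq_nonneg J]
  have h1' := norm_mul_le_of_le (norm_mul_le_of_le ho h1) hT
  have h2' := norm_mul_le_of_le (norm_mul_le_of_le hε h2)
    (show ‖T ^ 2‖ ≤ 9 by rw [norm_pow]; nlinarith [norm_nonneg T])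
  set X := (1 + ε) * ((-(q - (J : ℂ) ^ 2) + (2 * J + 1 : ℝ) + p) * y + p * y') * T
  set Y := ε * ((-q + 2 * p + (J ^ 2 + 2 * (J + 1) ^ 2 : ℝ)) * z + p * z') * T ^ 2
  have h3 : J ^ 2 / 2 ≤ ‖-(q + (J : ℂ) ^ 2) - X + Y‖ := by
    have := norm_sub_norm_le (-(q + (J : ℂ) ^ 2)) (X - Y)
    have h4 := norm_sub_le_of_le h1' h2'
    rw [← sub_add] at this
    nlinarith [sq_nonneg J]
  have h5 := norm_sub_le (trS p q ε 1 0 y y' z z' T w) (trV J ε 1 y z T w)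
  rw [hD, norm_mul] at h5
  rw [he, norm_one] at hu
  have h6 : J ^ 2 * ‖trU ε 1 y z T w‖ ≤ J ^ 2 * (10 * ‖w‖) := by
    gcongr
    refine hu.trans ?_
    gcongr
    norm_num
  have h7 : ‖w‖ * (J ^ 2 / 2) ≤ ‖w‖ * ‖-(q + (J : ℂ) ^ 2) - X + Y‖ := by gcongr
  nlinarith [mul_nonneg (sq_nonneg J) (norm_nonneg w)]

/-- Once |T| ≥ 3/2 the angular derivative suffices: the incoming mode contributes at least 1.4 J²,
the outgoing one at most J², and the factor ε makes the third harmless. -/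
theorem norm_trU_le_grad_of_le (h : TransitionParams K J p q ε A B Λ)
    (hc : CutoffValues K τ e x x' x'' y y' y'' z z' z'') (h3 : 3 < τ) (h7 : τ ≤ 7)
    (hT : 3 / 2 ≤ ‖T‖) (hT8 : ‖T‖ ≤ 8) :
    J ^ 2 * ‖trU ε x y z T w‖ ≤ 100 * ‖trV J ε x y z T w‖ := by
  have hu := norm_trU_le (w := w) h hc hT8
  have he := hc.e_eq h7
  have hy : y = 1 := by rw [hc.y_eq h3, he]
  have hx := hc.x_le
  have hz := hc.z_le
  have hε := h.eps_le
  have hJ := h.one_le_J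
  have hJ2 := h.two_mul_le
  rw [he, norm_one] at hu
  have hJn : ∀ r : ℝ, 0 ≤ r → ‖(r : ℂ)‖ = r := fun r hr => by
    rw [Complex.norm_real, Real.norm_of_nonneg hr]
  have h0 : J ^ 2 * (14 / 10) ≤ ‖(1 + ε) * ((J : ℂ) + 1) ^ 2 * y * T‖ := by
    have : ((J : ℂ) + 1) ^ 2 = (((J + 1) ^ 2 : ℝ) : ℂ) := by push_cast; ring
    rw [hy, mul_one, norm_mul, norm_mul, this, hJn _ (by positivity)]
    calc J ^ 2 * (14 / 10) ≤ 999 / 1000 * J ^ 2 * (3 / 2) := by nlinarith [sq_nonneg J]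
      _ ≤ _ := by
        have := h.le_norm_one_add
        gcongr
        linarith
  have h1 : ‖(J : ℂ) ^ 2 * x‖ ≤ J ^ 2 * 1 := by
    rw [norm_mul, norm_pow, hJn J (by linarith)]; gcongr
  have h2 : ‖ε * ((J : ℂ) ^ 2 + 2 * ((J : ℂ) + 1) ^ 2) * z * T ^ 2‖ ≤
      1 / 1000 * (J ^ 2 * (31 / 10)) * 1 * 8 ^ 2 := by
    have : (J : ℂ) ^ 2 + 2 * ((J : ℂ) + 1) ^ 2 = ((J ^ 2 + 2 * (J + 1) ^ 2 : ℝ) : ℂ) := by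
      push_cast; ring
    rw [norm_mul, norm_mul, norm_mul, this, hJn _ (by positivity), norm_pow]
    gcongr
    nlinarith
  have h3 : J ^ 2 / 5 ≤ ‖(J : ℂ) ^ 2 * x + (1 + ε) * ((J : ℂ) + 1) ^ 2 * y * T -
      ε * ((J : ℂ) ^ 2 + 2 * ((J : ℂ) + 1) ^ 2) * z * T ^ 2‖ := by
    have := norm_sub_norm_le ((1 + ε) * ((J : ℂ) + 1) ^ 2 * y * T)
      (ε * ((J : ℂ) ^ 2 + 2 * ((J : ℂ) + 1) ^ 2) * z * T ^ 2 - (J : ℂ) ^ 2 * x)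
    have h4 := norm_sub_le_of_le h2 h1
    rw [← sub_add, sub_add_eq_add_sub, add_comm ((1 + ε) * ((J : ℂ) + 1) ^ 2 * y * T)] at this
    nlinarith [sq_nonneg J]
  rw [trV, norm_mul]
  have h6 : J ^ 2 * ‖trU ε x y z T w‖ ≤ J ^ 2 * (20 * ‖w‖) := by
    gcongr
    refine hu.trans ?_
    gcongr
    norm_num
  have h7 := mul_le_mul_of_nonneg_left h3 (norm_nonneg w)
  nlinarith

theorem norm_trU_le_grad_of_tail (h : TransitionParams K J p q ε A B Λ)
    (hc : CutoffValues K τ e x x' x'' y y' y'' z z' z'') (h7 : 7 < τ) :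
    J ^ 2 * ‖trU ε x y z T w‖ ≤ ‖trV J ε x y z T w‖ := by
  obtain ⟨rfl, rfl, rfl, rfl, rfl, rfl⟩ := hc.tail h7
  have : trV J ε 0 y 0 T w = -(((J + 1) ^ 2 : ℝ) * trU ε 0 y 0 T w) := by
    rw [trV, trU]; push_cast; ring
  rw [this, norm_neg, norm_mul, Complex.norm_real, Real.norm_of_nonneg (by positivity)]
  have := h.one_le_J
  gcongr
  linarith

/-- The two pointwise estimates on a transition annulus. -/
theorem transition_estimates (h : TransitionParams K J p q ε A B Λ)
    (hc : CutoffValues K τ e x x' x'' y y' y'' z z' z'') (hl : ‖l - Λ‖ ≤ K * J ^ 3)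
    (hT : ‖T‖ = Real.exp (τ - 5)) :
    ‖trL J p q ε l x x' x'' y y' y'' z z' z'' T w‖ ≤
        8000 * K ^ 3 * J ^ 3 * ‖trU ε x y z T w‖ ∧
      J ^ 2 * ‖trU ε x y z T w‖ ≤
        100 * (‖trS p q ε x x' y y' z z' T w‖ + ‖trV J ε x y z T w‖) := by
  have hK := h.one_le_K
  have hJ := h.one_le_J
  have hKJ : 0 ≤ K ^ 3 * J ^ 3 := by positivity
  have hU := norm_nonneg (trU ε x y z T w)
  have hS := norm_nonneg (trS p q ε x x' y y' z z' T w)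
  have hV := norm_nonneg (trV J ε x y z T w)
  have e1 : Real.exp 1 < 2.7182818286 := Real.exp_one_lt_d9
  have e1' : 2.7182818283 < Real.exp 1 := Real.exp_one_gt_d9
  -- Since |T| = e^{τ-5}, the outgoing mode dominates for τ < 7/2 and the incoming one for τ ≥ 11/2.
  -- Between them all cutoffs are constant and the factorization through 1 - T applies; beyond τ = 7
  -- one mode remains.
  rcases lt_or_ge τ (7 / 2) with h1 | h1
  · have hT' : ‖T‖ ≤ 1 / 2 := by
      rw [hT]
      calc Real.exp (τ - 5) ≤ Real.exp (-1) := Real.exp_le_exp.2 (by linarith)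
        _ ≤ 1 / 2 := by
          rw [Real.exp_neg, inv_le_comm₀ (Real.exp_pos _) (by norm_num)]; linarith
    refine ⟨?_, norm_trU_le_grad_of_lt h hc (by linarith) (by linarith)⟩
    have a := norm_trL_le (w := w) h hc hl (by linarith) (hT'.trans (by norm_num))
    have b := norm_w_le_of_lt (w := w) h hc (by linarith) hT'
    nlinarith
  rcases lt_or_ge τ (11 / 2) with h2 | h2
  · have hT' : ‖T‖ ≤ 3 := by
      rw [hT]
      calc Real.exp (τ - 5) ≤ Real.exp 1 := Real.exp_le_exp.2 (by linarith)
        _ ≤ 3 := by linarith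
    refine ⟨?_, norm_trU_le_grad_of_lt h hc (by linarith) (by linarith)⟩
    have a := norm_trL_le_of_flat (w := w) h hc hl (by linarith) (by linarith) hT'
    have : 8 * K * J ^ 3 ≤ 8000 * K ^ 3 * J ^ 3 := by
      gcongr
      · norm_num
      · exact le_self_pow₀ hK (by norm_num)
    exact a.trans (mul_le_mul_of_nonneg_right this hU)
  rcases le_or_gt τ 7 with h3 | h3
  · have hT1 : 3 / 2 ≤ ‖T‖ := by
      rw [hT]
      have := Real.add_one_le_exp (τ - 5)
      linarith
    have hT8 : ‖T‖ ≤ 8 := by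
      rw [hT]
      calc Real.exp (τ - 5) ≤ Real.exp (1 + 1) := Real.exp_le_exp.2 (by linarith)
        _ ≤ 8 := by rw [Real.exp_add]; nlinarith [Real.exp_pos 1]
    have g := norm_trU_le_grad_of_le (w := w) h hc (by linarith) h3 hT1 hT8
    refine ⟨?_, by linarith⟩
    have a := norm_trL_le (w := w) h hc hl (by linarith) hT8
    have b := norm_w_le_of_le (w := w) h hc (by linarith) h3 hT1 hT8
    nlinarith
  · have g := norm_trU_le_grad_of_tail (T := T) (w := w) h hc h3
    refine ⟨?_, by linarith⟩
    have a := norm_trL_le_of_tail (T := T) (w := w) h hc hl h3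
    nlinarith

end Transition

/-! ### Cutoffs and the ramp that bends the radial exponent -/

/-- A smooth function equal to `0` on `(-∞, 2]` and to `1` on `[3, ∞)`. -/
noncomputable def cutIn (τ : ℝ) : ℝ := Real.smoothTransition (τ - 2)

/-- A smooth function equal to `1` on `(-∞, 6]` and to `0` on `[7, ∞)`. -/
noncomputable def cutOut (τ : ℝ) : ℝ := 1 - Real.smoothTransition (τ - 6)

/-- A smooth function equal to `0` on `(-∞, 7]` and of slope one on `[8, ∞)`. -/
noncomputable def ramp (τ : ℝ) : ℝ := ∫ x in (7 : ℝ)..τ, Real.smoothTransition (x - 7)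

theorem contDiff_cutIn {k : ℕ∞} : ContDiff ℝ k cutIn :=
  Real.smoothTransition.contDiff.comp (contDiff_id.sub contDiff_const)

theorem contDiff_cutOut {k : ℕ∞} : ContDiff ℝ k cutOut :=
  contDiff_const.sub (Real.smoothTransition.contDiff.comp (contDiff_id.sub contDiff_const))

theorem hasDerivAt_ramp (τ : ℝ) : HasDerivAt ramp (Real.smoothTransition (τ - 7)) τ := by
  have hc : Continuous fun x : ℝ => Real.smoothTransition (x - 7) :=
    Real.smoothTransition.continuous.comp (continuous_id.sub continuous_const)
  exact intervalIntegral.integral_hasDerivAt_right (hc.intervalIntegrable _ _)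
    (hc.stronglyMeasurableAtFilter _ _) hc.continuousAt

theorem deriv_ramp : deriv ramp = fun τ => Real.smoothTransition (τ - 7) :=
  funext fun τ => (hasDerivAt_ramp τ).deriv

theorem contDiff_ramp : ContDiff ℝ 2 ramp := by
  rw [show (2 : WithTop ℕ∞) = 1 + 1 by norm_num, contDiff_succ_iff_deriv]
  refine ⟨fun τ => (hasDerivAt_ramp τ).differentiableAt, by simp, ?_⟩
  rw [deriv_ramp]
  exact (Real.smoothTransition.contDiff (n := 1)).comp (contDiff_id.sub contDiff_const)

theorem ramp_of_le {τ : ℝ} (h : τ ≤ 7) : ramp τ = 0 := by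
  rw [ramp, intervalIntegral.integral_symm, neg_eq_zero]
  refine (intervalIntegral.integral_congr (g := fun _ => (0 : ℝ)) fun x hx => ?_).trans (by simp)
  rw [Set.uIcc_of_le h] at hx
  exact Real.smoothTransition.zero_of_nonpos (by linarith [hx.2])

theorem ramp_nonneg (τ : ℝ) : 0 ≤ ramp τ := by
  rcases le_total τ 7 with h | h
  · rw [ramp_of_le h]
  · exact intervalIntegral.integral_nonneg h fun x _ => Real.smoothTransition.nonneg _

theorem ramp_le {τ : ℝ} (h : 7 ≤ τ) : ramp τ ≤ τ - 7 := by
  have hc : Continuous fun x : ℝ => Real.smoothTransition (x - 7) :=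
    Real.smoothTransition.continuous.comp (continuous_id.sub continuous_const)
  have := intervalIntegral.integral_mono_on (μ := MeasureTheory.volume) h
    (hc.intervalIntegrable _ _) (continuous_const.intervalIntegrable 7 τ)
    (g := fun _ => (1 : ℝ)) fun x _ => Real.smoothTransition.le_one _
  simpa [ramp] using this

/-- The offset of the linear part of `ramp`. -/
noncomputable def rampOffset : ℝ := 8 - ramp 8

theorem ramp_of_ge {τ : ℝ} (h : 8 ≤ τ) : ramp τ = τ - rampOffset := by
  have hc : Continuous fun x : ℝ => Real.smoothTransition (x - 7) :=
    Real.smoothTransition.continuous.comp (continuous_id.sub continuous_const)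
  have h1 : ∫ x in (8 : ℝ)..τ, Real.smoothTransition (x - 7) = τ - 8 := by
    refine (intervalIntegral.integral_congr (g := fun _ => (1 : ℝ)) fun x hx => ?_).trans (by simp)
    rw [Set.uIcc_of_le h] at hx
    exact Real.smoothTransition.one_of_one_le (by linarith [hx.1])
  have h2 := intervalIntegral.integral_add_adjacent_intervals
    (μ := MeasureTheory.volume) (hc.intervalIntegrable 7 8) (hc.intervalIntegrable 8 τ)
  rw [rampOffset, ramp, ramp, ← h2, h1]
  ring

theorem cutIn_of_le {τ : ℝ} (h : τ ≤ 2) : cutIn τ = 0 :=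
  Real.smoothTransition.zero_of_nonpos (by linarith)

theorem cutIn_of_ge {τ : ℝ} (h : 3 ≤ τ) : cutIn τ = 1 :=
  Real.smoothTransition.one_of_one_le (by linarith)

theorem cutOut_of_le {τ : ℝ} (h : τ ≤ 6) : cutOut τ = 1 := by
  rw [cutOut, Real.smoothTransition.zero_of_nonpos (by linarith), sub_zero]

theorem cutOut_of_ge {τ : ℝ} (h : 7 ≤ τ) : cutOut τ = 0 := by
  rw [cutOut, Real.smoothTransition.one_of_one_le (by linarith), sub_self]

theorem abs_cutIn_le (τ : ℝ) : |cutIn τ| ≤ 1 := by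
  rw [cutIn, abs_of_nonneg (Real.smoothTransition.nonneg _)]
  exact Real.smoothTransition.le_one _

theorem abs_cutOut_le (τ : ℝ) : |cutOut τ| ≤ 1 := by
  have h1 := Real.smoothTransition.le_one (τ - 6)
  have h2 := Real.smoothTransition.nonneg (τ - 6)
  rw [cutOut, abs_le]; constructor <;> linarith

theorem deriv_eq_zero_of_eventuallyEq_const {f : ℝ → ℂ} {c : ℂ} {τ : ℝ}
    (h : ∀ᶠ t in 𝓝 τ, f t = c) : deriv f τ = 0 ∧ deriv (deriv f) τ = 0 := by
  have h0 : f =ᶠ[𝓝 τ] fun _ => c := h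
  have h1 := h0.deriv
  have h2 := h1.deriv
  refine ⟨?_, ?_⟩
  · rw [h0.deriv_eq]; simp
  · rw [h2.self_of_nhds]; simp

/-- The cutoff factor of the outgoing mode. -/
noncomputable def cutoffX (τ : ℝ) : ℂ := cutOut τ

/-- The cutoff factor of the incoming mode. -/
noncomputable def cutoffY (b : ℂ) (τ : ℝ) : ℂ := cutIn τ * Complex.exp (b * ramp τ)

/-- The cutoff factor of the correcting mode. -/
noncomputable def cutoffZ (τ : ℝ) : ℂ := ((cutOut τ * cutIn τ : ℝ) : ℂ)

theorem contDiff_cutoffX : ContDiff ℝ 2 cutoffX :=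
  Complex.ofRealCLM.contDiff.comp (contDiff_cutOut (k := 2))

theorem contDiff_cutoffZ : ContDiff ℝ 2 cutoffZ :=
  Complex.ofRealCLM.contDiff.comp ((contDiff_cutOut (k := 2)).mul (contDiff_cutIn (k := 2)))

theorem contDiff_cutoffY (b : ℂ) : ContDiff ℝ 2 (cutoffY b) := by
  refine ContDiff.mul (Complex.ofRealCLM.contDiff.comp (contDiff_cutIn (k := 2))) ?_
  exact Complex.contDiff_exp.comp
    (contDiff_const.mul (Complex.ofRealCLM.contDiff.comp contDiff_ramp))

theorem deriv_cutoffY (b : ℂ) : deriv (cutoffY b) = fun τ =>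
    ((deriv cutIn τ : ℝ) + cutIn τ * (b * Real.smoothTransition (τ - 7))) *
      Complex.exp (b * ramp τ) := by
  funext τ
  have h1 : HasDerivAt cutIn (deriv cutIn τ) τ :=
    ((contDiff_cutIn (k := 1)).differentiable (by norm_num) τ).hasDerivAt
  have h2 := h1.ofReal_comp.mul (((hasDerivAt_ramp τ).ofReal_comp.const_mul b).cexp)
  refine h2.deriv.trans ?_
  ring

theorem deriv_deriv_cutoffY (b : ℂ) (τ : ℝ) : deriv (deriv (cutoffY b)) τ =
    ((deriv (deriv cutIn) τ : ℝ) + 2 * (deriv cutIn τ : ℝ) * (b * Real.smoothTransition (τ - 7)) +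
      cutIn τ * (b * (deriv (fun t => Real.smoothTransition (t - 7)) τ : ℝ)) +
      cutIn τ * (b * Real.smoothTransition (τ - 7)) ^ 2) * Complex.exp (b * ramp τ) := by
  rw [deriv_cutoffY]
  have h1 : HasDerivAt cutIn (deriv cutIn τ) τ :=
    ((contDiff_cutIn (k := 1)).differentiable (by norm_num) τ).hasDerivAt
  have h1' : HasDerivAt (deriv cutIn) (deriv (deriv cutIn) τ) τ := by
    have : ContDiff ℝ 1 (deriv cutIn) :=
      ((contDiff_succ_iff_deriv (n := 1)).1 (contDiff_cutIn (k := 2))).2.2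
    exact (this.differentiable (by norm_num) τ).hasDerivAt
  have h3 : HasDerivAt (fun t : ℝ => Real.smoothTransition (t - 7))
      (deriv (fun t => Real.smoothTransition (t - 7)) τ) τ := by
    have : ContDiff ℝ 1 fun t : ℝ => Real.smoothTransition (t - 7) :=
      (Real.smoothTransition.contDiff (n := 1)).comp (contDiff_id.sub contDiff_const)
    exact (this.differentiable (by norm_num) τ).hasDerivAt
  have h2 := (h1'.ofReal_comp.add (h1.ofReal_comp.mul (h3.ofReal_comp.const_mul b))).mul
    (((hasDerivAt_ramp τ).ofReal_comp.const_mul b).cexp)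
  refine h2.deriv.trans ?_
  simp only [Pi.add_apply, Pi.mul_apply]
  ring

theorem continuous_deriv_deriv {E : Type*} [NormedAddCommGroup E] [NormedSpace ℝ E] {f : ℝ → E}
    (hf : ContDiff ℝ 2 f) : Continuous (deriv f) ∧ Continuous (deriv (deriv f)) := by
  have h1 : ContDiff ℝ 1 (deriv f) := ((contDiff_succ_iff_deriv (n := 1)).1 hf).2.2
  exact ⟨h1.continuous, h1.continuous_deriv le_rfl⟩

theorem exists_deriv_bound {E : Type*} [NormedAddCommGroup E] [NormedSpace ℝ E] {f : ℝ → E}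
    (hf : ContDiff ℝ 2 f) (a b : ℝ) :
    ∃ K : ℝ, ∀ τ ∈ Set.Icc a b, ‖deriv f τ‖ ≤ K ∧ ‖deriv (deriv f) τ‖ ≤ K := by
  obtain ⟨h1, h2⟩ := continuous_deriv_deriv hf
  obtain ⟨K1, hK1⟩ := isCompact_Icc.exists_bound_of_continuousOn (h1.continuousOn (s := Set.Icc a b))
  obtain ⟨K2, hK2⟩ := isCompact_Icc.exists_bound_of_continuousOn (h2.continuousOn (s := Set.Icc a b))
  exact ⟨max K1 K2, fun τ hτ => ⟨(hK1 τ hτ).trans (le_max_left _ _),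
    (hK2 τ hτ).trans (le_max_right _ _)⟩⟩

/-- Compactness of [0, 10] gives the bounds. Only the incoming factor depends on b, and explicitly,
so K can be chosen uniformly for ‖b‖ ≤ k and hence for all annuli at once. -/
theorem exists_cutoffValues (k : ℝ) : ∃ K₀ : ℝ, ∀ K, K₀ ≤ K → ∀ b : ℂ, ‖b‖ ≤ k →
    ∀ τ ∈ Set.Icc (0 : ℝ) 10, CutoffValues K τ (Complex.exp (b * ramp τ))
      (cutoffX τ) (deriv cutoffX τ) (deriv (deriv cutoffX) τ)
      (cutoffY b τ) (deriv (cutoffY b) τ) (deriv (deriv (cutoffY b)) τ)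
      (cutoffZ τ) (deriv cutoffZ τ) (deriv (deriv cutoffZ) τ) := by
  obtain ⟨K1, hK1⟩ := exists_deriv_bound contDiff_cutoffX 0 10
  obtain ⟨K2, hK2⟩ := exists_deriv_bound contDiff_cutoffZ 0 10
  obtain ⟨K3, hK3⟩ := exists_deriv_bound (contDiff_cutIn (k := 2)) 0 10
  obtain ⟨K4, hK4⟩ := exists_deriv_bound contDiff_ramp 0 10
  rw [deriv_ramp] at hK4
  -- The last two entries come from the triangle inequality in the product-rule formulas for the
  -- first and second derivatives of `cutoffY`.
  refine ⟨max (max K1 K2) (max (K3 + k) (K3 + 2 * K3 * k + k * K4 + k ^ 2)), ?_⟩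
  intro K hK b hb τ hτ
  simp only [max_le_iff] at hK
  have hk : 0 ≤ k := (norm_nonneg _).trans hb
  have hin : ‖((cutIn τ : ℝ) : ℂ)‖ ≤ 1 := by
    rw [Complex.norm_real]; exact abs_cutIn_le τ
  have hin1 : ‖((deriv cutIn τ : ℝ) : ℂ)‖ ≤ K3 := by
    rw [Complex.norm_real]; exact (hK3 τ hτ).1
  have hin2 : ‖((deriv (deriv cutIn) τ : ℝ) : ℂ)‖ ≤ K3 := by
    rw [Complex.norm_real]; exact (hK3 τ hτ).2
  have hst : ‖((Real.smoothTransition (τ - 7) : ℝ) : ℂ)‖ ≤ 1 := by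
    rw [Complex.norm_real, Real.norm_of_nonneg (Real.smoothTransition.nonneg _)]
    exact Real.smoothTransition.le_one _
  have hst1 : ‖((deriv (fun t => Real.smoothTransition (t - 7)) τ : ℝ) : ℂ)‖ ≤ K4 := by
    rw [Complex.norm_real]; exact (hK4 τ hτ).2
  have hbs := norm_mul_le_of_le hb hst
  have hopen1 : τ < 6 → ∀ᶠ t in 𝓝 τ, cutoffX t = 1 := fun h => by
    filter_upwards [Iio_mem_nhds h] with t ht
    rw [cutoffX, cutOut_of_le (le_of_lt ht), Complex.ofReal_one]
  refine ⟨?_, (hK1 τ hτ).1.trans hK.1.1, (hK1 τ hτ).2.trans hK.1.1, ?_, ?_, ?_, ?_,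
    (hK2 τ hτ).1.trans hK.1.2, (hK2 τ hτ).2.trans hK.1.2, ?_, ?_, ?_, ?_, ?_⟩
  · rw [cutoffX, Complex.norm_real]; exact abs_cutOut_le τ
  · rw [cutoffY, norm_mul]
    exact mul_le_of_le_one_left (norm_nonneg _) hin
  · rw [deriv_cutoffY, norm_mul]
    gcongr
    exact (norm_add_le_of_le hin1 (norm_mul_le_of_le hin hbs)).trans (by linarith [hK.2.1])
  · rw [deriv_deriv_cutoffY, norm_mul]
    gcongr
    have h2 : ‖(2 : ℂ) * (deriv cutIn τ : ℝ)‖ ≤ 2 * K3 := by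
      rw [norm_mul, Complex.norm_ofNat]; gcongr
    have h4 : ‖(b * Real.smoothTransition (τ - 7)) ^ 2‖ ≤ (k * 1) ^ 2 := by
      rw [norm_pow]; gcongr
    refine (norm_add_le_of_le (norm_add_le_of_le (norm_add_le_of_le hin2
      (norm_mul_le_of_le h2 hbs)) (norm_mul_le_of_le hin (norm_mul_le_of_le hb hst1)))
      (norm_mul_le_of_le hin h4)).trans ?_
    linarith [hK.2.2]
  · rw [cutoffZ, Complex.norm_real, norm_mul]
    exact mul_le_one₀ (abs_cutOut_le τ) (norm_nonneg _) (abs_cutIn_le τ)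
  · intro h; rw [ramp_of_le h]; simp
  · intro h
    have h0 := deriv_eq_zero_of_eventuallyEq_const (hopen1 h)
    exact ⟨(hopen1 h).self_of_nhds, h0.1, h0.2⟩
  · intro h; rw [cutoffY, cutIn_of_ge h.le]; simp
  · intro h3 h6
    have hy : ∀ᶠ t in 𝓝 τ, cutoffY b t = 1 := by
      filter_upwards [Ioo_mem_nhds h3 h6] with t ht
      rw [cutoffY, cutIn_of_ge ht.1.le, ramp_of_le (by linarith [ht.2])]; simp
    have hz : ∀ᶠ t in 𝓝 τ, cutoffZ t = 1 := by
      filter_upwards [Ioo_mem_nhds h3 h6] with t ht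
      rw [cutoffZ, cutIn_of_ge ht.1.le, cutOut_of_le ht.2.le]; simp
    have hy0 := deriv_eq_zero_of_eventuallyEq_const hy
    have hz0 := deriv_eq_zero_of_eventuallyEq_const hz
    exact ⟨hy.self_of_nhds, hy0.1, hy0.2, hz.self_of_nhds, hz0.1, hz0.2⟩
  · intro h7
    have hx : ∀ᶠ t in 𝓝 τ, cutoffX t = 0 := by
      filter_upwards [Ioi_mem_nhds h7] with t ht
      rw [cutoffX, cutOut_of_ge (le_of_lt ht)]; simp
    have hz : ∀ᶠ t in 𝓝 τ, cutoffZ t = 0 := by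
      filter_upwards [Ioi_mem_nhds h7] with t ht
      rw [cutoffZ, cutOut_of_ge (le_of_lt ht)]; simp
    have hx0 := deriv_eq_zero_of_eventuallyEq_const hx
    have hz0 := deriv_eq_zero_of_eventuallyEq_const hz
    exact ⟨hx.self_of_nhds, hx0.1, hx0.2, hz.self_of_nhds, hz0.1, hz0.2⟩

/-! ### The three-mode function on an annulus -/

/-- The radial amplitude `C X(p (s - s₀)) e^{μ (s - s₀)}`. -/
noncomputable def amp (C μ : ℂ) (X : ℝ → ℂ) (p s₀ s : ℝ) : ℂ :=
  C * X (p * (s - s₀)) * Complex.exp (μ * ((s - s₀ : ℝ) : ℂ))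

theorem hasDerivAt_amp {C μ : ℂ} {X X' : ℝ → ℂ} {p s₀ : ℝ} (hX : ∀ τ, HasDerivAt X (X' τ) τ)
    (s : ℝ) :
    HasDerivAt (amp C μ X p s₀) (amp C μ (fun τ => μ * X τ + p * X' τ) p s₀ s) s := by
  have h0 : HasDerivAt (fun t : ℝ => t - s₀) 1 s := (hasDerivAt_id s).sub_const s₀
  have h1 : HasDerivAt (fun t : ℝ => X (p * (t - s₀))) ((p * 1) • X' (p * (s - s₀))) s :=
    (hX (p * (s - s₀))).scomp s (h0.const_mul p)
  have h2 : HasDerivAt (fun t : ℝ => Complex.exp (μ * ((t - s₀ : ℝ) : ℂ)))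
      (Complex.exp (μ * ((s - s₀ : ℝ) : ℂ)) * (μ * ((1 : ℝ) : ℂ))) s :=
    (h0.ofReal_comp.const_mul μ).cexp
  refine ((h1.const_mul C).mul h2).congr_deriv ?_
  simp only [amp, Complex.real_smul]
  push_cast
  ring

theorem contDiff_amp {C μ : ℂ} {X : ℝ → ℂ} {p s₀ : ℝ} (hX : ContDiff ℝ 2 X) :
    ContDiff ℝ 2 (amp C μ X p s₀) := by
  have h0 : ContDiff ℝ 2 fun t : ℝ => t - s₀ := contDiff_id.sub contDiff_const
  refine ContDiff.mul (contDiff_const.mul (hX.comp (contDiff_const.mul h0))) ?_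
  exact Complex.contDiff_exp.comp (contDiff_const.mul (Complex.ofRealCLM.contDiff.comp h0))

theorem ContDiff.hasDerivAt_two {X : ℝ → ℂ} (hX : ContDiff ℝ 2 X) :
    (∀ τ, HasDerivAt X (deriv X τ) τ) ∧ ∀ τ, HasDerivAt (deriv X) (deriv (deriv X) τ) τ := by
  have h1 : ContDiff ℝ 1 (deriv X) := ((contDiff_succ_iff_deriv (n := 1)).1 hX).2.2
  exact ⟨fun τ => (hX.differentiable (by norm_num) τ).hasDerivAt,
    fun τ => (h1.differentiable (by norm_num) τ).hasDerivAt⟩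

/-- The mode with amplitude `amp`: its derivative and its Laplacian. -/
theorem mode_amp_spec {C μ : ℂ} {X : ℝ → ℂ} {p s₀ : ℝ} {m : ℤ} (hX : ContDiff ℝ 2 X)
    {x : EuclideanSpace ℝ (Fin 2)} (hx : x ≠ 0) :
    ContDiffAt ℝ 2 (mode (amp C μ X p s₀) m) x ∧
    HasFDerivAt (mode (amp C μ X p s₀) m)
      ((radialForm x).smulRight (amp C μ (fun τ => μ * X τ + p * deriv X τ) p s₀ (Real.log ‖x‖) *
          phase x ^ m) +
        (angularForm x).smulRight (Complex.I * m * mode (amp C μ X p s₀) m x)) x ∧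
    Δ (mode (amp C μ X p s₀) m) x = ((‖x‖ ^ 2)⁻¹ : ℝ) *
      (amp C μ (fun τ => μ ^ 2 * X τ + 2 * μ * p * deriv X τ + p ^ 2 * deriv (deriv X) τ - m ^ 2 * X τ)
        p s₀ (Real.log ‖x‖) * phase x ^ m) := by
  obtain ⟨h1, h2⟩ := hX.hasDerivAt_two
  have h3 : ∀ τ, HasDerivAt (fun τ => μ * X τ + p * deriv X τ)
      (μ * deriv X τ + p * deriv (deriv X) τ) τ := fun τ =>
    ((h1 τ).const_mul μ).add ((h2 τ).const_mul (p : ℂ))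
  refine ⟨contDiffAt_mode hx (contDiff_amp hX).contDiffAt,
    hasFDerivAt_mode hx (hasDerivAt_amp h1 _), ?_⟩
  rw [laplacian_mode hx (contDiff_amp hX).contDiffAt (hasDerivAt_amp h1) (hasDerivAt_amp h3)]
  simp only [amp]
  ring

/-- The function on a transition annulus. -/
noncomputable def transitionFun (C q ε b : ℂ) (p s₀ : ℝ) (m m' : ℤ)
    (x : EuclideanSpace ℝ (Fin 2)) : ℂ :=
  mode (amp C (-q) cutoffX p s₀) m x +
    mode (amp (-C * (1 + ε) * Complex.exp (-5)) (-q + p) (cutoffY b) p s₀) m' x +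
    mode (amp (C * ε * Complex.exp (-10)) (-q + 2 * p) cutoffZ p s₀) (2 * m' - m) x

/-- Reduces the analysis at a point to the scalar quantities w, T and τ = p(s - s₀). The sign σ
covers both parities of the annulus: it enters the angular derivative linearly and disappears from
the Laplacian. -/
theorem transitionFun_spec {C q ε b : ℂ} {p s₀ J : ℝ} {m m' : ℤ} {σ : ℂ} (hσ : σ ^ 2 = 1)
    (hm : (m : ℂ) = σ * (J : ℂ) ^ 2) (hm' : (m' : ℂ) = -σ * ((J : ℂ) + 1) ^ 2)
    {x : EuclideanSpace ℝ (Fin 2)} (hx : x ≠ 0) (lam : ℂ) :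
    ∃ T w : ℂ, ‖T‖ = Real.exp (p * (Real.log ‖x‖ - s₀) - 5) ∧
      ‖w‖ = ‖C‖ * Real.exp (-q.re * (Real.log ‖x‖ - s₀)) ∧
      ContDiffAt ℝ 2 (transitionFun C q ε b p s₀ m m') x ∧
      transitionFun C q ε b p s₀ m m' x =
        trU ε (cutoffX (p * (Real.log ‖x‖ - s₀))) (cutoffY b (p * (Real.log ‖x‖ - s₀)))
          (cutoffZ (p * (Real.log ‖x‖ - s₀))) T w ∧
      fderiv ℝ (transitionFun C q ε b p s₀ m m') x =
        (radialForm x).smulRight (trS p q ε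
          (cutoffX (p * (Real.log ‖x‖ - s₀))) (deriv cutoffX (p * (Real.log ‖x‖ - s₀)))
          (cutoffY b (p * (Real.log ‖x‖ - s₀))) (deriv (cutoffY b) (p * (Real.log ‖x‖ - s₀)))
          (cutoffZ (p * (Real.log ‖x‖ - s₀))) (deriv cutoffZ (p * (Real.log ‖x‖ - s₀))) T w) +
        (angularForm x).smulRight (Complex.I * σ * trV J ε (cutoffX (p * (Real.log ‖x‖ - s₀)))
          (cutoffY b (p * (Real.log ‖x‖ - s₀))) (cutoffZ (p * (Real.log ‖x‖ - s₀))) T w) ∧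
      Δ (transitionFun C q ε b p s₀ m m') x + lam * transitionFun C q ε b p s₀ m m' x =
        ((‖x‖ ^ 2)⁻¹ : ℝ) * trL J p q ε (lam * ((‖x‖ ^ 2 : ℝ) : ℂ))
          (cutoffX (p * (Real.log ‖x‖ - s₀))) (deriv cutoffX (p * (Real.log ‖x‖ - s₀)))
          (deriv (deriv cutoffX) (p * (Real.log ‖x‖ - s₀)))
          (cutoffY b (p * (Real.log ‖x‖ - s₀))) (deriv (cutoffY b) (p * (Real.log ‖x‖ - s₀)))
          (deriv (deriv (cutoffY b)) (p * (Real.log ‖x‖ - s₀)))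
          (cutoffZ (p * (Real.log ‖x‖ - s₀))) (deriv cutoffZ (p * (Real.log ‖x‖ - s₀)))
          (deriv (deriv cutoffZ) (p * (Real.log ‖x‖ - s₀))) T w := by
  obtain ⟨c1, d1, l1⟩ := mode_amp_spec (C := C) (μ := -q) (p := p) (s₀ := s₀) (m := m)
    contDiff_cutoffX hx
  obtain ⟨c2, d2, l2⟩ := mode_amp_spec (C := -C * (1 + ε) * Complex.exp (-5)) (μ := -q + p) (p := p)
    (s₀ := s₀) (m := m') (contDiff_cutoffY b) hx
  obtain ⟨c3, d3, l3⟩ := mode_amp_spec (C := C * ε * Complex.exp (-10)) (μ := -q + 2 * p) (p := p)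
    (s₀ := s₀) (m := 2 * m' - m) contDiff_cutoffZ hx
  have hph := phase_ne_zero hx
  set s := Real.log ‖x‖ with hs
  set τ := p * (s - s₀) with hτ
  set P := phase x with hP
  have hPn : ‖P‖ = 1 := norm_phase hx
  -- Without cutoffs, w is the outgoing mode and, up to the constant -(1+ε), wT is the incoming one.
  -- The coefficients e^{-5} and e^{-10} place |T| = 1 at τ = 5, the middle of the annulus.
  set w : ℂ := C * Complex.exp (-q * ((s - s₀ : ℝ) : ℂ)) * P ^ m with hw
  set T : ℂ := Complex.exp ((τ : ℂ) - 5) * P ^ (m' - m) with hT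
  have hx0 : (‖x‖ : ℂ) ≠ 0 := Complex.ofReal_ne_zero.2 (norm_ne_zero_iff.2 hx)
  have E1 : ∀ X : ℝ → ℂ, amp C (-q) X p s₀ s * P ^ m = w * X τ := fun X => by
    rw [amp, hw]; ring
  have E2 : ∀ X : ℝ → ℂ, amp (-C * (1 + ε) * Complex.exp (-5)) (-q + p) X p s₀ s * P ^ m' =
      -(w * (1 + ε) * X τ * T) := fun X => by
    have h1 : Complex.exp (-5) * Complex.exp ((-q + p) * ((s - s₀ : ℝ) : ℂ)) =
        Complex.exp (-q * ((s - s₀ : ℝ) : ℂ)) * Complex.exp ((τ : ℂ) - 5) := by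
      rw [← Complex.exp_add, ← Complex.exp_add, hτ]; congr 1; push_cast; ring
    have h2 : P ^ m' = P ^ m * P ^ (m' - m) := by
      rw [← zpow_add₀ hph]; congr 1; ring
    rw [amp, hw, hT, h2]
    linear_combination (-C * (1 + ε) * X τ * P ^ m * P ^ (m' - m)) * h1
  have E3 : ∀ X : ℝ → ℂ, amp (C * ε * Complex.exp (-10)) (-q + 2 * p) X p s₀ s * P ^ (2 * m' - m) =
      w * ε * X τ * T ^ 2 := fun X => by
    have h1 : Complex.exp (-10) * Complex.exp ((-q + 2 * p) * ((s - s₀ : ℝ) : ℂ)) =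
        Complex.exp (-q * ((s - s₀ : ℝ) : ℂ)) * (Complex.exp ((τ : ℂ) - 5) *
          Complex.exp ((τ : ℂ) - 5)) := by
      rw [← Complex.exp_add, ← Complex.exp_add, ← Complex.exp_add, hτ]; congr 1; push_cast; ring
    have h2 : P ^ (2 * m' - m) = P ^ m * (P ^ (m' - m) * P ^ (m' - m)) := by
      rw [← zpow_add₀ hph, ← zpow_add₀ hph]; congr 1; ring
    rw [amp, hw, hT, h2]
    linear_combination (C * ε * X τ * P ^ m * (P ^ (m' - m) * P ^ (m' - m))) * h1
  have U1 : mode (amp C (-q) cutoffX p s₀) m x = w * cutoffX τ := E1 _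
  have U2 : mode (amp (-C * (1 + ε) * Complex.exp (-5)) (-q + p) (cutoffY b) p s₀) m' x =
      -(w * (1 + ε) * cutoffY b τ * T) := E2 _
  have U3 : mode (amp (C * ε * Complex.exp (-10)) (-q + 2 * p) cutoffZ p s₀) (2 * m' - m) x =
      w * ε * cutoffZ τ * T ^ 2 := E3 _
  rw [E1, U1] at d1
  rw [E2, U2] at d2
  rw [E3, U3] at d3
  rw [E1] at l1
  rw [E2] at l2
  rw [E3] at l3
  have hval : transitionFun C q ε b p s₀ m m' x =
      trU ε (cutoffX τ) (cutoffY b τ) (cutoffZ τ) T w := by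
    rw [transitionFun, U1, U2, U3, trU]; ring
  refine ⟨T, w, ?_, ?_, (c1.add c2).add c3, hval, ?_, ?_⟩
  · rw [hT, norm_mul, norm_zpow, hPn, one_zpow, mul_one, Complex.norm_exp]
    congr 1
  · rw [hw, norm_mul, norm_mul, norm_zpow, hPn, one_zpow, mul_one, Complex.norm_exp,
      Complex.re_mul_ofReal, Complex.neg_re]
  · have hd : HasFDerivAt (transitionFun C q ε b p s₀ m m') _ x := (d1.add d2).add d3
    rw [hd.fderiv]
    ext v
    simp only [add_apply, ContinuousLinearMap.smulRight_apply, Complex.real_smul]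
    push_cast
    rw [hm, hm', trS, trV]
    ring
  · have h12 := c1.laplacian_add c2
    have hl : Δ (transitionFun C q ε b p s₀ m m') x =
        Δ (mode (amp C (-q) cutoffX p s₀) m +
          mode (amp (-C * (1 + ε) * Complex.exp (-5)) (-q + p) (cutoffY b) p s₀) m') x +
        Δ (mode (amp (C * ε * Complex.exp (-10)) (-q + 2 * p) cutoffZ p s₀) (2 * m' - m)) x :=
      (c1.add c2).laplacian_add c3
    rw [hl, h12, l1, l2, l3, hval, trU, trL]
    push_cast
    rw [hm, hm']
    have hR : ((‖x‖ : ℂ) ^ 2)⁻¹ * (‖x‖ : ℂ) ^ 2 = 1 := inv_mul_cancel₀ (pow_ne_zero _ hx0)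
    linear_combination (-((‖x‖ : ℂ) ^ 2)⁻¹ * w * (cutoffX τ * J ^ 4
      - (1 + ε) * cutoffY b τ * T * ((J : ℂ) + 1) ^ 4
      + ε * cutoffZ τ * T ^ 2 * ((J : ℂ) ^ 2 + 2 * ((J : ℂ) + 1) ^ 2) ^ 2)) * hσ
      - lam * w * (cutoffX τ - (1 + ε) * cutoffY b τ * T + ε * cutoffZ τ * T ^ 2) * hR

/-! ### Size of the parameters on the j-th annulus -/

section

theorem exists_sq_eq_re_nonneg (z : ℂ) : ∃ q : ℂ, q ^ 2 = z ∧ 0 ≤ q.re := by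
  have hq : (z ^ (1 / 2 : ℂ)) ^ 2 = z := by
    rw [← Complex.cpow_nat_mul]; simp
  rcases le_total 0 (z ^ (1 / 2 : ℂ)).re with h | h
  · exact ⟨_, hq, h⟩
  · exact ⟨-z ^ (1 / 2 : ℂ), by rw [neg_sq, hq], by rw [Complex.neg_re]; linarith⟩

/-- The square root with nonnegative real part. -/
noncomputable def csqrt (z : ℂ) : ℂ := (exists_sq_eq_re_nonneg z).choose

theorem csqrt_sq (z : ℂ) : csqrt z ^ 2 = z := (exists_sq_eq_re_nonneg z).choose_spec.1

theorem csqrt_re_nonneg (z : ℂ) : 0 ≤ (csqrt z).re := (exists_sq_eq_re_nonneg z).choose_spec.2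

/-- The logarithm of the inner radius of the `j`-th annulus. -/
noncomputable def logRadius (β : ℝ) (j : ℕ) : ℝ := 2 / β * Real.log j

/-- The logarithmic width of the `j`-th annulus. -/
noncomputable def logGap (β : ℝ) (j : ℕ) : ℝ := logRadius β (j + 1) - logRadius β j

/-- The rate at which the incoming mode overtakes the outgoing one in the `j`-th annulus. -/
noncomputable def rate (β : ℝ) (j : ℕ) : ℝ := 10 / logGap β j

/-- The eigenvalue frozen at the inner radius, in logarithmic coordinates. -/
noncomputable def frozen (β : ℝ) (lam : ℂ) (j : ℕ) : ℂ :=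
  lam * (Real.exp (2 * logRadius β j) : ℝ)

/-- The decay rate of the mode of angular frequency `j ^ 2`. -/
noncomputable def decay (β : ℝ) (lam : ℂ) (j : ℕ) : ℂ := csqrt ((j : ℂ) ^ 4 - frozen β lam j)

/-- The defect of the incoming mode. -/
noncomputable def defectA (β : ℝ) (lam : ℂ) (j : ℕ) : ℂ :=
  (-decay β lam j + rate β j) ^ 2 - (((j : ℂ) + 1) ^ 2) ^ 2 + frozen β lam j

/-- The defect of the correcting mode. -/
noncomputable def defectB (β : ℝ) (lam : ℂ) (j : ℕ) : ℂ :=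
  (-decay β lam j + 2 * rate β j) ^ 2 - ((j : ℂ) ^ 2 + 2 * ((j : ℂ) + 1) ^ 2) ^ 2 + frozen β lam j

/-- The relative size of the correcting mode. -/
noncomputable def corr (β : ℝ) (lam : ℂ) (j : ℕ) : ℂ :=
  defectA β lam j / (defectB β lam j - defectA β lam j)

/-- The slope change of the incoming mode, relative to `rate`. -/
noncomputable def bend (β : ℝ) (lam : ℂ) (j : ℕ) : ℂ :=
  (decay β lam j - rate β j - decay β lam (j + 1)) / rate β j

variable {β : ℝ} {lam : ℂ} {j : ℕ}

theorem logGap_bounds (hβ : 0 < β) (hj : 1 ≤ j) :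
    2 / β / (j + 1) ≤ logGap β j ∧ logGap β j ≤ 2 / β / j := by
  have hj0 : (0 : ℝ) < j := by exact_mod_cast hj
  have hj1 : (0 : ℝ) < (j : ℝ) + 1 := by linarith
  have e : logGap β j = 2 / β * (Real.log (j + 1) - Real.log j) := by
    simp only [logGap, logRadius]; push_cast; ring
  have h1 := Real.log_le_sub_one_of_pos (div_pos hj1 hj0)
  have h2 := Real.log_le_sub_one_of_pos (div_pos hj0 hj1)
  rw [Real.log_div hj1.ne' hj0.ne'] at h1
  rw [Real.log_div hj0.ne' hj1.ne'] at h2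
  have h3 : ((j : ℝ) + 1) / j - 1 = 1 / j := by field_simp; ring
  have h4 : (j : ℝ) / (j + 1) - 1 = -(1 / (j + 1)) := by field_simp; ring
  have hb : 0 < 2 / β := by positivity
  rw [e, div_eq_mul_one_div _ ((j : ℝ) + 1), div_eq_mul_one_div _ (j : ℝ)]
  constructor
  · exact mul_le_mul_of_nonneg_left (by linarith) hb.le
  · exact mul_le_mul_of_nonneg_left (by linarith) hb.le

theorem logGap_pos (hβ : 0 < β) (hj : 1 ≤ j) : 0 < logGap β j :=
  lt_of_lt_of_le (by positivity) (logGap_bounds hβ hj).1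

theorem rate_bounds (hβ : 0 < β) (hj : 1 ≤ j) :
    5 * β * j ≤ rate β j ∧ rate β j ≤ 10 * β * j := by
  have hj0 : (1 : ℝ) ≤ j := by exact_mod_cast hj
  obtain ⟨h1, h2⟩ := logGap_bounds hβ hj
  have hg := logGap_pos hβ hj
  rw [rate, le_div_iff₀ hg, div_le_iff₀ hg]
  constructor
  · calc 5 * β * j * logGap β j ≤ 5 * β * j * (2 / β / j) := by gcongr
      _ = 10 := by field_simp; norm_num
  · calc (10 : ℝ) = 5 * β * (j + 1) * (2 / β / (j + 1)) := by field_simp; norm_num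
      _ ≤ 10 * β * j * (2 / β / (j + 1)) := by gcongr ?_ * _; nlinarith
      _ ≤ 10 * β * j * logGap β j := by gcongr

theorem exp_two_logRadius_le (hβ : 1 ≤ β) (hj : 1 ≤ j) :
    Real.exp (2 * logRadius β j) ≤ (j : ℝ) ^ 4 := by
  have hj0 : (1 : ℝ) ≤ j := by exact_mod_cast hj
  have : (j : ℝ) ^ 4 = Real.exp (4 * Real.log j) := by
    rw [mul_comm, Real.exp_mul, Real.exp_log (by linarith)]; norm_cast
  rw [this, Real.exp_le_exp, logRadius]
  have hl := Real.log_nonneg hj0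
  have : 2 / β ≤ 2 := by rw [div_le_iff₀ (by linarith)]; linarith
  nlinarith

/-- The squared radius is j^{4/β}, and 4/β < 4 because β > 1. This makes the eigenvalue a small
perturbation of j⁴. -/
theorem eventually_exp_two_logRadius_le (hβ : 1 < β) {δ : ℝ} (hδ : 0 < δ) :
    ∀ᶠ j : ℕ in atTop, Real.exp (2 * logRadius β j) ≤ δ * (j : ℝ) ^ 4 := by
  have h1 : 0 < 4 - 4 / β := by
    rw [sub_pos, div_lt_iff₀ (by linarith)]; linarith
  have h2 := (tendsto_rpow_neg_atTop h1).comp (tendsto_natCast_atTop_atTop (R := ℝ))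
  filter_upwards [h2.eventually (gt_mem_nhds hδ), eventually_ge_atTop 1] with j hj hj1
  have hj0 : (0 : ℝ) < j := by exact_mod_cast hj1
  have e : Real.exp (2 * logRadius β j) = (j : ℝ) ^ (-(4 - 4 / β)) * (j : ℝ) ^ 4 := by
    rw [← Real.rpow_natCast, ← Real.rpow_add hj0, Real.rpow_def_of_pos hj0, logRadius]
    congr 1
    push_cast
    ring
  rw [e]
  exact mul_le_mul_of_nonneg_right hj.le (by positivity)

theorem norm_frozen : ‖frozen β lam j‖ = ‖lam‖ * Real.exp (2 * logRadius β j) := by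
  rw [frozen, norm_mul, Complex.norm_real, Real.norm_of_nonneg (Real.exp_pos _).le]

/-- Freezing the eigenvalue on an annulus costs a lower order term. -/
theorem norm_sub_frozen_le (hβ : 1 < β) (hj : 4 ≤ j) {s : ℝ} (h0 : logRadius β j ≤ s)
    (h1 : s ≤ logRadius β (j + 1)) :
    ‖lam * (Real.exp (2 * s) : ℝ) - frozen β lam j‖ ≤ 8 * ‖lam‖ * (j : ℝ) ^ 3 := by
  have hj0 : (4 : ℝ) ≤ j := by exact_mod_cast hj
  obtain ⟨-, h2⟩ := logGap_bounds (β := β) (by linarith) (show 1 ≤ j by omega)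
  have h3 : 2 / β / j ≤ 2 / j := by
    gcongr
    rw [div_le_iff₀ (by linarith)]; linarith
  have h4 : s - logRadius β j ≤ 2 / j := by
    rw [logGap] at h2; linarith
  have h5 : (2 : ℝ) / j ≤ 1 / 2 := by rw [div_le_iff₀ (by linarith)]; linarith
  set d := 2 * (s - logRadius β j) with hd
  have hd0 : 0 ≤ d := by rw [hd]; linarith
  have hd1 : |d| ≤ 1 := by rw [abs_of_nonneg hd0]; linarith
  have h6 := Real.abs_exp_sub_one_le hd1
  rw [abs_of_nonneg hd0, abs_of_nonneg (by linarith [Real.add_one_le_exp d])] at h6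
  have e : lam * (Real.exp (2 * s) : ℝ) - frozen β lam j =
      lam * ((Real.exp (2 * logRadius β j) * (Real.exp d - 1) : ℝ) : ℂ) := by
    rw [mul_sub, ← Real.exp_add, mul_one, hd, frozen, ← mul_sub, ← Complex.ofReal_sub]
    congr 4
    ring
  rw [e, norm_mul, Complex.norm_real, Real.norm_of_nonneg
    (mul_nonneg (Real.exp_pos _).le (by linarith [Real.add_one_le_exp d]))]
  calc ‖lam‖ * (Real.exp (2 * logRadius β j) * (Real.exp d - 1))
      ≤ ‖lam‖ * ((j : ℝ) ^ 4 * (8 / j)) := by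
        have := exp_two_logRadius_le hβ.le (show 1 ≤ j by omega)
        have h7 : Real.exp d - 1 ≤ 8 / j := by
          have : 8 / (j : ℝ) = 4 * (2 / j) := by ring
          linarith
        gcongr
        linarith [Real.add_one_le_exp d]
    _ = 8 * ‖lam‖ * (j : ℝ) ^ 3 := by field_simp

theorem decay_sq : decay β lam j ^ 2 = (j : ℂ) ^ 4 - frozen β lam j := csqrt_sq _

theorem decay_re_nonneg : 0 ≤ (decay β lam j).re := csqrt_re_nonneg _

theorem natCast_sq_re : ((j : ℂ) ^ 2).re = (j : ℝ) ^ 2 := by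
  norm_cast

/-- Factor q² - j⁴ = (q - j²)(q + j²). The choice of root with Re q ≥ 0 keeps the second factor at
least j² in modulus. -/
theorem norm_decay_sub_le (hj : 1 ≤ j) (h : ‖frozen β lam j‖ ≤ (j : ℝ) ^ 4 / 1000) :
    ‖decay β lam j - (j : ℂ) ^ 2‖ ≤ (j : ℝ) ^ 2 / 1000 := by
  have hj0 : (0 : ℝ) < j := by exact_mod_cast hj
  have e : (decay β lam j - (j : ℂ) ^ 2) * (decay β lam j + (j : ℂ) ^ 2) = -frozen β lam j := by
    linear_combination decay_sq (β := β) (lam := lam) (j := j)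
  have h1 : (j : ℝ) ^ 2 ≤ ‖decay β lam j + (j : ℂ) ^ 2‖ := by
    refine le_trans ?_ (Complex.re_le_norm _)
    rw [Complex.add_re, natCast_sq_re]
    linarith [decay_re_nonneg (β := β) (lam := lam) (j := j)]
  have h2 := congrArg norm e
  rw [norm_mul, norm_neg] at h2
  have h3 := mul_le_mul_of_nonneg_left h1 (norm_nonneg (decay β lam j - (j : ℂ) ^ 2))
  have h4 : (0 : ℝ) < (j : ℝ) ^ 2 := by positivity
  refine le_of_mul_le_mul_right ?_ h4
  calc _ ≤ (j : ℝ) ^ 4 / 1000 := by linarith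
    _ = _ := by ring

theorem decay_bounds (hj : 1 ≤ j) (h : ‖frozen β lam j‖ ≤ (j : ℝ) ^ 4 / 1000) :
    ‖decay β lam j‖ ≤ 2 * (j : ℝ) ^ 2 ∧ (j : ℝ) ^ 2 / 2 ≤ (decay β lam j).re := by
  have h1 := norm_decay_sub_le hj h
  have hn : ‖(j : ℂ) ^ 2‖ = (j : ℝ) ^ 2 := by simp
  have h2 := norm_sub_norm_le (decay β lam j) ((j : ℂ) ^ 2)
  have h3 := (Complex.abs_re_le_norm (decay β lam j - (j : ℂ) ^ 2))
  rw [Complex.sub_re, natCast_sq_re] at h3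
  have h4 := (abs_le.1 (h3.trans h1)).1
  have h5 : (0 : ℝ) ≤ (j : ℝ) ^ 2 := by positivity
  constructor <;> linarith

theorem pow_four_sub_le (hj : 1 ≤ j) : ((j : ℝ) + 1) ^ 4 - (j : ℝ) ^ 4 ≤ 15 * (j : ℝ) ^ 3 := by
  have hj0 : (1 : ℝ) ≤ j := by exact_mod_cast hj
  have h2 : (j : ℝ) ^ 2 ≤ (j : ℝ) ^ 3 := pow_le_pow_right₀ hj0 (by norm_num)
  have h1 : (j : ℝ) ≤ (j : ℝ) ^ 3 := le_self_pow₀ hj0 (by norm_num)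
  have h0 : (1 : ℝ) ≤ (j : ℝ) ^ 3 := one_le_pow₀ hj0
  nlinarith

theorem norm_rate (hβ : 0 < β) (hj : 1 ≤ j) : ‖(rate β j : ℂ)‖ ≤ 10 * β * j := by
  have h := rate_bounds hβ hj
  rw [Complex.norm_real, Real.norm_of_nonneg (le_trans (by positivity) h.1)]
  exact h.2

/-- The quartic terms cancel: q² = j⁴ - Λ leaves j⁴ - (j+1)⁴ - 2pq + p², where p is of order j and q
of order j². -/
theorem norm_defectA_le (hβ : 1 < β) (hj : 1 ≤ j) (h : ‖frozen β lam j‖ ≤ (j : ℝ) ^ 4 / 1000) :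
    ‖defectA β lam j‖ ≤ (15 + 40 * β + 100 * β ^ 2) * (j : ℝ) ^ 3 := by
  have hj0 : (1 : ℝ) ≤ j := by exact_mod_cast hj
  have hr := norm_rate (β := β) (by linarith) hj
  have e : defectA β lam j = -((((j + 1) ^ 4 - j ^ 4 : ℝ)) : ℂ) - 2 * (rate β j : ℂ) * decay β lam j +
      (rate β j : ℂ) ^ 2 := by
    rw [defectA]; push_cast
    linear_combination decay_sq (β := β) (lam := lam) (j := j)
  have h1 : ‖-((((j + 1) ^ 4 - j ^ 4 : ℝ)) : ℂ)‖ ≤ 15 * (j : ℝ) ^ 3 := by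
    rw [norm_neg, Complex.norm_real, Real.norm_of_nonneg]
    · exact pow_four_sub_le hj
    · rw [sub_nonneg]; gcongr; linarith
  have h2 : ‖2 * (rate β j : ℂ) * decay β lam j‖ ≤ 2 * (10 * β * j) * (2 * (j : ℝ) ^ 2) := by
    have := (decay_bounds hj h).1
    rw [norm_mul, norm_mul, Complex.norm_ofNat]; gcongr
  have h3 : ‖(rate β j : ℂ) ^ 2‖ ≤ (10 * β * j) ^ 2 := by
    rw [norm_pow]; gcongr
  rw [e]
  refine (norm_add_le_of_le (norm_sub_le_of_le h1 h2) h3).trans ?_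
  have h4 : (j : ℝ) ^ 2 ≤ (j : ℝ) ^ 3 := pow_le_pow_right₀ hj0 (by norm_num)
  nlinarith [mul_le_mul_of_nonneg_left h4 (sq_nonneg β)]

/-- The squared frequencies of the correcting and incoming modes differ by at least 8j⁴, while the
exponents contribute only O(j³). Together with A = O(j³) this gives ε = O(1/j). -/
theorem le_norm_defect_sub (hβ : 1 < β) (hj : 1 ≤ j) (h : ‖frozen β lam j‖ ≤ (j : ℝ) ^ 4 / 1000)
    (hbig : 40 * β + 300 * β ^ 2 ≤ j) :
    7 * (j : ℝ) ^ 4 ≤ ‖defectB β lam j - defectA β lam j‖ := by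
  have hj0 : (1 : ℝ) ≤ j := by exact_mod_cast hj
  have hr := norm_rate (β := β) (by linarith) hj
  have e : defectB β lam j - defectA β lam j =
      (3 * (rate β j : ℂ) ^ 2 - 2 * (rate β j : ℂ) * decay β lam j) -
      ((((j : ℝ) ^ 2 + (j + 1) ^ 2) * ((j : ℝ) ^ 2 + 3 * (j + 1) ^ 2) : ℝ) : ℂ) := by
    rw [defectA, defectB]; push_cast; ring
  have h2 : ‖2 * (rate β j : ℂ) * decay β lam j‖ ≤ 2 * (10 * β * j) * (2 * (j : ℝ) ^ 2) := by
    have := (decay_bounds hj h).1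
    rw [norm_mul, norm_mul, Complex.norm_ofNat]; gcongr
  have h3 : ‖3 * (rate β j : ℂ) ^ 2‖ ≤ 3 * (10 * β * j) ^ 2 := by
    rw [norm_mul, norm_pow, Complex.norm_ofNat]; gcongr
  have h4 := norm_sub_le_of_le h3 h2
  have h5 : 8 * (j : ℝ) ^ 4 ≤
      ‖((((j : ℝ) ^ 2 + (j + 1) ^ 2) * ((j : ℝ) ^ 2 + 3 * (j + 1) ^ 2) : ℝ) : ℂ)‖ := by
    rw [Complex.norm_real, Real.norm_of_nonneg (by positivity)]
    have : (j : ℝ) ^ 2 ≤ (j + 1) ^ 2 := by gcongr; linarith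
    calc 8 * (j : ℝ) ^ 4 = ((j : ℝ) ^ 2 + j ^ 2) * ((j : ℝ) ^ 2 + 3 * j ^ 2) := by ring
      _ ≤ _ := by gcongr
  have h6 := norm_sub_norm_le
    ((((j : ℝ) ^ 2 + (j + 1) ^ 2) * ((j : ℝ) ^ 2 + 3 * (j + 1) ^ 2) : ℝ) : ℂ)
    (3 * (rate β j : ℂ) ^ 2 - 2 * (rate β j : ℂ) * decay β lam j)
  rw [norm_sub_rev _ (3 * (rate β j : ℂ) ^ 2 - _), ← e] at h6
  have h7 : 3 * (10 * β * j) ^ 2 + 2 * (10 * β * j) * (2 * (j : ℝ) ^ 2) ≤ (j : ℝ) ^ 4 := by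
    calc 3 * (10 * β * j) ^ 2 + 2 * (10 * β * j) * (2 * (j : ℝ) ^ 2)
        = 300 * β ^ 2 * j ^ 2 + 40 * β * j ^ 3 := by ring
      _ ≤ 300 * β ^ 2 * j ^ 3 + 40 * β * j ^ 3 := by
        gcongr
        norm_num
      _ = (40 * β + 300 * β ^ 2) * j ^ 3 := by ring
      _ ≤ j * j ^ 3 := by gcongr
      _ = _ := by ring
  linarith

/-- The difference of q_j² and q_{j+1}² is O(j³), and their sum of roots has real part at least
j²/2, so the roots differ by O(j), the order of `rate`. The exponent can thus be readjusted at
bounded cost. -/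
theorem norm_bend_le (hβ : 1 < β) (hj : 4 ≤ j) (h : ‖frozen β lam j‖ ≤ (j : ℝ) ^ 4 / 1000) :
    ‖bend β lam j‖ ≤ 7 + 4 * ‖lam‖ := by
  have hj0 : (4 : ℝ) ≤ j := by exact_mod_cast hj
  have hj1 : 1 ≤ j := by omega
  have hr := rate_bounds (β := β) (by linarith) hj1
  have hr0 : 0 < rate β j := lt_of_lt_of_le (by positivity) hr.1
  have e : (decay β lam j - decay β lam (j + 1)) * (decay β lam j + decay β lam (j + 1)) =
      -((((j + 1) ^ 4 - j ^ 4 : ℝ)) : ℂ) + (lam * (Real.exp (2 * logRadius β (j + 1)) : ℝ) - frozen β lam j) := by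
    have h1 := decay_sq (β := β) (lam := lam) (j := j)
    have h2 := decay_sq (β := β) (lam := lam) (j := j + 1)
    have h3 : frozen β lam (j + 1) = lam * (Real.exp (2 * logRadius β (j + 1)) : ℝ) := rfl
    rw [← h3]
    push_cast at h2 ⊢
    linear_combination h1 - h2
  have h1 : ‖-((((j + 1) ^ 4 - j ^ 4 : ℝ)) : ℂ)‖ ≤ 15 * (j : ℝ) ^ 3 := by
    rw [norm_neg, Complex.norm_real, Real.norm_of_nonneg]
    · exact pow_four_sub_le hj1
    · rw [sub_nonneg]; gcongr; linarith
  have hg := (logGap_pos (β := β) (by linarith) hj1).le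
  rw [logGap] at hg
  have h2 := norm_sub_frozen_le (lam := lam) hβ hj (s := logRadius β (j + 1)) (by linarith) le_rfl
  have h3 := norm_add_le_of_le h1 h2
  rw [← e, norm_mul] at h3
  have h4 : (j : ℝ) ^ 2 / 2 ≤ ‖decay β lam j + decay β lam (j + 1)‖ := by
    refine le_trans ?_ (Complex.re_le_norm _)
    rw [Complex.add_re]
    linarith [decay_re_nonneg (β := β) (lam := lam) (j := j + 1), (decay_bounds hj1 h).2]
  have h5 : ‖decay β lam j - decay β lam (j + 1)‖ ≤ (30 + 16 * ‖lam‖) * j := by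
    have := mul_le_mul_of_nonneg_left h4 (norm_nonneg (decay β lam j - decay β lam (j + 1)))
    have hp : (0 : ℝ) < (j : ℝ) ^ 2 / 2 := by positivity
    refine le_of_mul_le_mul_right ?_ hp
    calc _ ≤ 15 * (j : ℝ) ^ 3 + 8 * ‖lam‖ * (j : ℝ) ^ 3 := by linarith
      _ = _ := by ring
  have e2 : bend β lam j = (decay β lam j - decay β lam (j + 1)) / rate β j - 1 := by
    have : (rate β j : ℂ) ≠ 0 := Complex.ofReal_ne_zero.2 hr0.ne'
    rw [bend]; field_simp; ring
  rw [e2]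
  have h6 : ‖(decay β lam j - decay β lam (j + 1)) / rate β j‖ ≤ 6 + 4 * ‖lam‖ := by
    rw [norm_div, Complex.norm_real, Real.norm_of_nonneg hr0.le, div_le_iff₀ hr0]
    have h7 : 5 * (j : ℝ) ≤ rate β j := by
      refine le_trans ?_ hr.1
      nlinarith
    have h8 : (30 + 16 * ‖lam‖) * j ≤ (6 + 4 * ‖lam‖) * (5 * (j : ℝ)) := by
      nlinarith [mul_nonneg (norm_nonneg lam) (show (0 : ℝ) ≤ j by linarith)]
    exact h5.trans (h8.trans (by gcongr))
  refine (norm_sub_le_of_le h6 norm_one.le).trans (by linarith)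

/-- For large `j` all size conditions on the `j`-th annulus are met. -/
theorem exists_transitionParams (hβ : 1 < β) (lam : ℂ) : ∃ K₁ : ℝ, ∀ K, K₁ ≤ K →
    ∀ᶠ j : ℕ in atTop, 4 ≤ j ∧ TransitionParams K j (rate β j) (decay β lam j) (corr β lam j)
        (defectA β lam j) (defectB β lam j) (frozen β lam j) ∧
      ‖bend β lam j‖ ≤ 7 + 4 * ‖lam‖ ∧ (j : ℝ) ^ 2 / 2 ≤ (decay β lam j).re ∧
      ∀ s, logRadius β j ≤ s → s ≤ logRadius β (j + 1) →
        ‖lam * (Real.exp (2 * s) : ℝ) - frozen β lam j‖ ≤ K * (j : ℝ) ^ 3 := by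
  refine ⟨15 + 40 * β + 100 * β ^ 2 + 8 * ‖lam‖, fun K hK => ?_⟩
  have hb2 := sq_nonneg β
  have hl0 := norm_nonneg lam
  have hδ : 0 < 1 / (1000 * (‖lam‖ + 1)) := by positivity
  have hnat := tendsto_natCast_atTop_atTop (R := ℝ)
  filter_upwards [eventually_exp_two_logRadius_le hβ hδ, eventually_ge_atTop 4,
    hnat.eventually_ge_atTop 3000, hnat.eventually_ge_atTop (1000 * (K * (10 * β))),
    hnat.eventually_ge_atTop (40 * β + 300 * β ^ 2), hnat.eventually_ge_atTop (1000 * K)]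
    with j h1 h4 h3000 hKj hbig hK1000
  have hj1 : 1 ≤ j := by omega
  have hj0 : (0 : ℝ) < j := by linarith
  have hK0 : 0 < K := by nlinarith
  have hfr : ‖frozen β lam j‖ ≤ (j : ℝ) ^ 4 / 1000 := by
    rw [norm_frozen]
    calc ‖lam‖ * Real.exp (2 * logRadius β j)
        ≤ (‖lam‖ + 1) * (1 / (1000 * (‖lam‖ + 1)) * (j : ℝ) ^ 4) := by gcongr; linarith
      _ = _ := by field_simp
  have hr := rate_bounds (β := β) (by linarith) hj1
  have hr0 : 0 < rate β j := lt_of_lt_of_le (by positivity) hr.1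
  have hA := norm_defectA_le hβ hj1 hfr
  have hBA := le_norm_defect_sub hβ hj1 hfr hbig
  have hBA0 : 0 < ‖defectB β lam j - defectA β lam j‖ := lt_of_lt_of_le (by positivity) hBA
  have hA' : ‖defectA β lam j‖ ≤ K * (j : ℝ) ^ 3 := by
    refine hA.trans ?_
    gcongr
    linarith
  refine ⟨h4, ⟨by nlinarith, by linarith, by nlinarith, hr0.le, ?_, ?_, decay_re_nonneg, ?_,
    (decay_bounds hj1 hfr).1, ?_, ?_, ?_, hA', ?_, ?_⟩, norm_bend_le hβ h4 hfr,
    (decay_bounds hj1 hfr).2, ?_⟩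
  · refine hr.2.trans ?_
    gcongr
    nlinarith
  · calc K * rate β j ≤ K * (10 * β * j) := by gcongr; exact hr.2
      _ = (1000 * (K * (10 * β))) * j / 1000 := by ring
      _ ≤ (j : ℝ) * j / 1000 := by gcongr
      _ = _ := by ring
  · exact_mod_cast decay_sq
  · rw [Complex.ofReal_natCast]
    refine (norm_decay_sub_le hj1 hfr).trans ?_
    have : (0 : ℝ) ≤ (j : ℝ) ^ 2 := by positivity
    linarith
  · simp [defectA]
  · simp [defectB]
  · rw [corr, div_mul_cancel₀ _ (norm_pos_iff.1 hBA0)]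
  · rw [corr, norm_div, div_le_iff₀ hBA0]
    calc ‖defectA β lam j‖ ≤ K * (j : ℝ) ^ 3 := hA'
      _ = 1 / 1000 * (1000 * K * (j : ℝ) ^ 3) := by ring
      _ ≤ 1 / 1000 * (j * (j : ℝ) ^ 3) := by gcongr
      _ = 1 / 1000 * (j : ℝ) ^ 4 := by ring
      _ ≤ 1 / 1000 * ‖defectB β lam j - defectA β lam j‖ := by
        gcongr
        refine le_trans ?_ hBA
        have : (0 : ℝ) ≤ (j : ℝ) ^ 4 := by positivity
        linarith
  · intro s hs0 hs1
    refine (norm_sub_frozen_le hβ h4 hs0 hs1).trans ?_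
    gcongr
    nlinarith

end

/-! ### Gluing the annuli and the inner disc -/

section

/-- The signed angular frequency of the `j`-th mode. -/
def freq (j : ℕ) : ℤ := (-1) ^ j * (j : ℤ) ^ 2

/-- The ratio of the normalizing coefficients of consecutive annuli. -/
noncomputable def stepFactor (β : ℝ) (lam : ℂ) (j : ℕ) : ℂ :=
  -(1 + corr β lam j) * Complex.exp (-5 - bend β lam j * rampOffset -
    decay β lam (j + 1) * logGap β j)

/-- The amplitude exponent of the function on the inner disc. -/
noncomputable def innerExp (β : ℝ) (lam : ℂ) (j₀ : ℕ) (s : ℝ) : ℂ :=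
  (j₀ : ℂ) ^ 2 * s - (decay β lam j₀ + (j₀ : ℂ) ^ 2) * ramp (s - logRadius β j₀ + 9)

/-- The function on the inner disc. -/
noncomputable def innerFun (β : ℝ) (lam : ℂ) (j₀ : ℕ) : EuclideanSpace ℝ (Fin 2) → ℂ :=
  mode (fun s => Complex.exp (innerExp β lam j₀ s)) ((j₀ : ℤ) ^ 2)

/-- The normalizing coefficient of the annulus of index `j₀ + i`. -/
noncomputable def coefAux (β : ℝ) (lam : ℂ) (j₀ : ℕ) : ℕ → ℂ
  | 0 => Complex.exp ((j₀ : ℂ) ^ 2 * logRadius β j₀ -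
      (decay β lam j₀ + (j₀ : ℂ) ^ 2) * (9 - rampOffset))
  | i + 1 => coefAux β lam j₀ i * stepFactor β lam (j₀ + i)

/-- The normalizing coefficient of the `j`-th annulus, for `j₀ ≤ j`. -/
noncomputable def coef (β : ℝ) (lam : ℂ) (j₀ j : ℕ) : ℂ := coefAux β lam j₀ (j - j₀)

/-- The function on the `j`-th annulus. -/
noncomputable def annulusFun (β : ℝ) (lam : ℂ) (j₀ j : ℕ) : EuclideanSpace ℝ (Fin 2) → ℂ :=
  transitionFun (coef β lam j₀ j) (decay β lam j) (corr β lam j) (bend β lam j) (rate β j)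
    (logRadius β j) (freq j) (freq (j + 1))

/-- The index of the annulus that contains a point. -/
noncomputable def annulusIndex (β : ℝ) (x : EuclideanSpace ℝ (Fin 2)) : ℕ :=
  ⌊Real.exp (β / 2 * Real.log ‖x‖)⌋₊

open Classical in
/-- The function glued from its pieces. -/
noncomputable def gluedFun (β : ℝ) (lam : ℂ) (j₀ : ℕ) (x : EuclideanSpace ℝ (Fin 2)) : ℂ :=
  if Real.log ‖x‖ < logRadius β j₀ then innerFun β lam j₀ x
  else annulusFun β lam j₀ (annulusIndex β x) x

variable {β : ℝ} {lam : ℂ} {j₀ j : ℕ} {x : EuclideanSpace ℝ (Fin 2)}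

theorem coef_succ (h : j₀ ≤ j) : coef β lam j₀ (j + 1) = coef β lam j₀ j * stepFactor β lam j := by
  rw [coef, coef, Nat.succ_sub h, coefAux, Nat.add_sub_cancel' h]

theorem freq_cast (j : ℕ) : (freq j : ℂ) = (-1) ^ j * ((j : ℝ) : ℂ) ^ 2 ∧
    (freq (j + 1) : ℂ) = -(-1) ^ j * (((j : ℝ) : ℂ) + 1) ^ 2 := by
  constructor
  · simp [freq]
  · simp [freq, pow_succ]

theorem logRadius_mono (hβ : 0 < β) {i j : ℕ} (hi : 1 ≤ i) (h : i ≤ j) :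
    logRadius β i ≤ logRadius β j := by
  have : (0 : ℝ) < i := by exact_mod_cast hi
  rw [logRadius, logRadius]
  gcongr

theorem logRadius_le_iff (hβ : 0 < β) (hj : 1 ≤ j) (s : ℝ) :
    logRadius β j ≤ s ↔ (j : ℝ) ≤ Real.exp (β / 2 * s) := by
  have hj0 : (0 : ℝ) < j := by exact_mod_cast hj
  rw [← Real.log_le_iff_le_exp hj0, logRadius, div_mul_eq_mul_div, div_le_iff₀ hβ]
  constructor <;> intro h <;> linarith

theorem annulusIndex_eq (hβ : 0 < β) (hj : 1 ≤ j) (h0 : logRadius β j ≤ Real.log ‖x‖)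
    (h1 : Real.log ‖x‖ < logRadius β (j + 1)) : annulusIndex β x = j := by
  rw [annulusIndex, Nat.floor_eq_iff (Real.exp_pos _).le]
  refine ⟨(logRadius_le_iff hβ hj _).1 h0, ?_⟩
  have := (logRadius_le_iff hβ (Nat.succ_le_succ (Nat.zero_le j)) (Real.log ‖x‖)).not.1
    (not_le.2 h1)
  push_cast at this
  exact not_le.1 this

theorem annulusIndex_spec (hβ : 0 < β) (hj₀ : 1 ≤ j₀) (h : logRadius β j₀ ≤ Real.log ‖x‖) :
    j₀ ≤ annulusIndex β x ∧ logRadius β (annulusIndex β x) ≤ Real.log ‖x‖ ∧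
      Real.log ‖x‖ < logRadius β (annulusIndex β x + 1) := by
  have h0 : j₀ ≤ annulusIndex β x := Nat.le_floor ((logRadius_le_iff hβ hj₀ _).1 h)
  refine ⟨h0, ?_, ?_⟩
  · rw [logRadius_le_iff hβ (hj₀.trans h0)]
    exact Nat.floor_le (Real.exp_pos _).le
  · rw [← not_le, logRadius_le_iff hβ (Nat.succ_le_succ (Nat.zero_le _)), not_le]
    push_cast
    exact Nat.lt_floor_add_one _

/-- Before the transition only the outgoing mode is present. -/
theorem transitionFun_of_le {C q ε b : ℂ} {p s₀ : ℝ} {m m' : ℤ}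
    (h : p * (Real.log ‖x‖ - s₀) ≤ 2) :
    transitionFun C q ε b p s₀ m m' x =
      C * Complex.exp (-q * ((Real.log ‖x‖ - s₀ : ℝ) : ℂ)) * phase x ^ m := by
  simp only [transitionFun, mode, amp, cutoffX, cutoffY, cutoffZ, cutIn_of_le h,
    cutOut_of_le (h.trans (by norm_num))]
  simp

/-- After the transition only the incoming mode is present. -/
theorem transitionFun_of_ge {C q ε b : ℂ} {p s₀ : ℝ} {m m' : ℤ}
    (h : 8 ≤ p * (Real.log ‖x‖ - s₀)) :
    transitionFun C q ε b p s₀ m m' x =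
      C * (-(1 + ε) * Complex.exp (-5 - b * rampOffset +
        (-q + p + b * p) * ((Real.log ‖x‖ - s₀ : ℝ) : ℂ))) * phase x ^ m' := by
  simp only [transitionFun, mode, amp, cutoffX, cutoffY, cutoffZ,
    cutOut_of_ge (show 7 ≤ p * (Real.log ‖x‖ - s₀) by linarith),
    cutIn_of_ge (show 3 ≤ p * (Real.log ‖x‖ - s₀) by linarith), ramp_of_ge h]
  have e : Complex.exp (-5 - b * rampOffset + (-q + p + b * p) * ((Real.log ‖x‖ - s₀ : ℝ) : ℂ)) =
      Complex.exp (-5) * Complex.exp (b * ((p * (Real.log ‖x‖ - s₀) - rampOffset : ℝ) : ℂ)) *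
        Complex.exp ((-q + p) * ((Real.log ‖x‖ - s₀ : ℝ) : ℂ)) := by
    rw [← Complex.exp_add, ← Complex.exp_add]
    congr 1
    push_cast
    ring
  rw [e]
  simp only [Complex.ofReal_zero, Complex.ofReal_one, zero_mul, mul_zero, zero_add, add_zero]
  ring

/-- Near the common circle both formulas reduce to one mode of frequency `freq (j + 1)`. `bend` is
chosen to equate the exponents and `stepFactor` to equate the amplitudes. -/
theorem annulusFun_eq_succ (hβ : 0 < β) (hj : 1 ≤ j) (hj₀ : j₀ ≤ j)
    (h8 : 8 ≤ rate β j * (Real.log ‖x‖ - logRadius β j))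
    (h2 : rate β (j + 1) * (Real.log ‖x‖ - logRadius β (j + 1)) ≤ 2) :
    annulusFun β lam j₀ j x = annulusFun β lam j₀ (j + 1) x := by
  have hr : (rate β j : ℂ) ≠ 0 := by
    have := (rate_bounds hβ hj).1
    have hj0 : (0 : ℝ) < j := by exact_mod_cast hj
    exact Complex.ofReal_ne_zero.2 (lt_of_lt_of_le (by positivity) this).ne'
  rw [annulusFun, annulusFun, transitionFun_of_ge h8, transitionFun_of_le h2, coef_succ hj₀,
    stepFactor]
  -- Beyond τ = 8 the ramp has slope one, so the exponent is -q_j + p + bp; b makes it -q_{j+1}.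
  have hb : -decay β lam j + rate β j + bend β lam j * rate β j = -decay β lam (j + 1) := by
    rw [bend, div_mul_cancel₀ _ hr]; ring
  have e : Complex.exp (-5 - bend β lam j * rampOffset +
      -decay β lam (j + 1) * ((Real.log ‖x‖ - logRadius β j : ℝ) : ℂ)) =
      Complex.exp (-5 - bend β lam j * rampOffset - decay β lam (j + 1) * logGap β j) *
      Complex.exp (-decay β lam (j + 1) * ((Real.log ‖x‖ - logRadius β (j + 1) : ℝ) : ℂ)) := by
    rw [← Complex.exp_add, logGap]
    congr 1
    push_cast
    ring
  rw [hb, e]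
  ring

/-- The shift by 9 in `innerExp` makes the ramp linear from s = s₀ - 1 on, where the inner exponent
has become -q. Evenness of j₀ gives both pieces the frequency +j₀². -/
theorem innerFun_eq (hev : Even j₀) (h8 : -1 ≤ Real.log ‖x‖ - logRadius β j₀)
    (h2 : rate β j₀ * (Real.log ‖x‖ - logRadius β j₀) ≤ 2) :
    innerFun β lam j₀ x = annulusFun β lam j₀ j₀ x := by
  rw [annulusFun, transitionFun_of_le h2, coef, Nat.sub_self, coefAux, innerFun, mode, freq,
    hev.neg_one_pow, one_mul, innerExp, ramp_of_ge (by linarith), ← Complex.exp_add]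
  congr 2
  push_cast
  ring

/-- Every point has a neighbourhood on which the glued function is one of its pieces. -/
theorem gluedFun_local (hβ : 0 < β) (hj₀ : 4 ≤ j₀) (hev : Even j₀)
    (x : EuclideanSpace ℝ (Fin 2)) :
    (Real.log ‖x‖ < logRadius β j₀ ∧ gluedFun β lam j₀ =ᶠ[𝓝 x] innerFun β lam j₀) ∨
    ∃ j, j₀ ≤ j ∧ x ≠ 0 ∧ logRadius β j ≤ Real.log ‖x‖ ∧ Real.log ‖x‖ ≤ logRadius β (j + 1) ∧
      gluedFun β lam j₀ =ᶠ[𝓝 x] annulusFun β lam j₀ j := by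
  have hj1 : 1 ≤ j₀ := by omega
  have hs0 : 0 < logRadius β j₀ := by
    have : (1 : ℝ) < j₀ := by exact_mod_cast (show 1 < j₀ by omega)
    exact mul_pos (by positivity) (Real.log_pos this)
  by_cases hx : x = 0
  · subst hx
    refine Or.inl ⟨by simpa using hs0, ?_⟩
    filter_upwards [Metric.ball_mem_nhds (0 : EuclideanSpace ℝ (Fin 2)) one_pos] with y hy
    rw [mem_ball_zero_iff] at hy
    rw [gluedFun, if_pos ((Real.log_nonpos (norm_nonneg _) hy.le).trans_lt hs0)]
  have hcont : ContinuousAt (fun y : EuclideanSpace ℝ (Fin 2) => Real.log ‖y‖) x :=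
    (hasFDerivAt_log_norm hx).continuousAt
  rcases lt_or_ge (Real.log ‖x‖) (logRadius β j₀) with h | h
  · refine Or.inl ⟨h, ?_⟩
    filter_upwards [hcont.eventually (gt_mem_nhds h)] with y hy
    rw [gluedFun, if_pos hy]
  · obtain ⟨a0, a1, a2⟩ := annulusIndex_spec hβ hj1 h
    set j := annulusIndex β x
    refine Or.inr ⟨j, a0, hx, a1, a2.le, ?_⟩
    have hjj : 1 ≤ j := hj1.trans a0
    rcases a1.lt_or_eq with a1 | a1
    · filter_upwards [hcont.eventually (gt_mem_nhds a2), hcont.eventually (lt_mem_nhds a1)]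
        with y h2 h1
      have := logRadius_mono hβ hj1 a0
      rw [gluedFun, if_neg (by linarith), annulusIndex_eq hβ hjj h1.le h2]
    -- The point lies on the circle between two pieces, where τ = 0 seen from outside and, for
    -- consecutive annuli, τ = 10 seen from inside. By continuity τ < 2 and τ > 8 persist nearby,
    -- which is where the formulas agree.
    · have t2 : ∀ᶠ y in 𝓝 x, rate β j * (Real.log ‖y‖ - logRadius β j) < 2 := by
        have hc : ContinuousAt (fun y : EuclideanSpace ℝ (Fin 2) =>
          rate β j * (Real.log ‖y‖ - logRadius β j)) x :=
          continuousAt_const.mul (hcont.sub continuousAt_const)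
        refine hc.eventually (gt_mem_nhds ?_)
        beta_reduce
        rw [a1, sub_self, mul_zero]; norm_num
      rcases a0.eq_or_lt with a0 | a0
      · have t8 : ∀ᶠ y in 𝓝 x, logRadius β j - 1 < Real.log ‖y‖ :=
          hcont.eventually (lt_mem_nhds (by linarith))
        filter_upwards [hcont.eventually (gt_mem_nhds a2), t2, t8] with y h1 h2 h8
        rcases lt_or_ge (Real.log ‖y‖) (logRadius β j₀) with hy | hy
        · rw [gluedFun, if_pos hy, ← a0]
          rw [← a0] at h2 h8
          exact innerFun_eq hev (by linarith) h2.le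
        · rw [gluedFun, if_neg (by linarith), annulusIndex_eq hβ hjj (by rwa [← a0]) h1]
      · obtain ⟨i, hi⟩ : ∃ i, j = i + 1 := ⟨j - 1, by omega⟩
        have hi0 : j₀ ≤ i := by omega
        have hi1 : 1 ≤ i := by omega
        have hg := logGap_pos hβ hi1
        have t8 : ∀ᶠ y in 𝓝 x, 8 < rate β i * (Real.log ‖y‖ - logRadius β i) := by
          have hc : ContinuousAt (fun y : EuclideanSpace ℝ (Fin 2) =>
            rate β i * (Real.log ‖y‖ - logRadius β i)) x :=
            continuousAt_const.mul (hcont.sub continuousAt_const)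
          refine hc.eventually (lt_mem_nhds ?_)
          beta_reduce
          rw [← a1, hi, ← logGap, rate, div_mul_cancel₀ _ hg.ne']; norm_num
        have t9 : ∀ᶠ y in 𝓝 x, logRadius β i < Real.log ‖y‖ := by
          refine hcont.eventually (lt_mem_nhds ?_)
          beta_reduce
          rw [← a1, hi]
          rw [logGap] at hg
          linarith
        filter_upwards [hcont.eventually (gt_mem_nhds a2), t2, t8, t9] with y h1 h2 h8 h9
        have := logRadius_mono hβ hj1 hi0
        rw [gluedFun, if_neg (by linarith)]
        rcases lt_or_ge (Real.log ‖y‖) (logRadius β j) with hy | hy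
        · rw [annulusIndex_eq hβ hi1 h9.le (by rwa [← hi])]
          rw [hi] at h2 ⊢
          exact annulusFun_eq_succ hβ hi1 hi0 h8.le h2.le
        · rw [annulusIndex_eq hβ hjj hy h1]

end

/-! ### Gradient, equation and decay on each piece -/

section

/-- The Euclidean length of the (complex) gradient. -/
noncomputable def gradNorm {n : ℕ} (u : EuclideanSpace ℝ (Fin n) → ℂ)
    (x : EuclideanSpace ℝ (Fin n)) : ℝ :=
  Real.sqrt (∑ i, ‖fderiv ℝ u x (EuclideanSpace.single i 1)‖ ^ 2)

theorem gradNorm_nonneg {n : ℕ} (u : EuclideanSpace ℝ (Fin n) → ℂ)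
    (x : EuclideanSpace ℝ (Fin n)) : 0 ≤ gradNorm u x := Real.sqrt_nonneg _

theorem norm_fderiv_apply_le {n : ℕ} (u : EuclideanSpace ℝ (Fin n) → ℂ)
    (x v : EuclideanSpace ℝ (Fin n)) : ‖fderiv ℝ u x v‖ ≤ ‖v‖ * gradNorm u x := by
  have hv : v = ∑ i, v i • EuclideanSpace.single i (1 : ℝ) := by
    have := (EuclideanSpace.basisFun (Fin n) ℝ).sum_repr v
    simpa using this.symm
  calc ‖fderiv ℝ u x v‖ = ‖∑ i, v i • fderiv ℝ u x (EuclideanSpace.single i 1)‖ := by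
        conv_lhs => rw [hv]
        rw [map_sum]; simp only [map_smul]
    _ ≤ ∑ i, ‖v i‖ * ‖fderiv ℝ u x (EuclideanSpace.single i 1)‖ :=
        (norm_sum_le _ _).trans (le_of_eq (Finset.sum_congr rfl fun i _ => norm_smul _ _))
    _ ≤ Real.sqrt (∑ i, ‖v i‖ ^ 2) *
        Real.sqrt (∑ i, ‖fderiv ℝ u x (EuclideanSpace.single i 1)‖ ^ 2) :=
        Real.sum_mul_le_sqrt_mul_sqrt _ _ _
    _ = _ := by rw [EuclideanSpace.norm_eq, gradNorm]

/-- The gradient bounds the radial and the angular derivative. -/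
theorem polar_le_gradNorm {u : EuclideanSpace ℝ (Fin 2) → ℂ} {x : EuclideanSpace ℝ (Fin 2)}
    (hx : x ≠ 0) {a b : ℂ}
    (h : fderiv ℝ u x = (radialForm x).smulRight a + (angularForm x).smulRight b) :
    ‖a‖ ≤ ‖x‖ * gradNorm u x ∧ ‖b‖ ≤ ‖x‖ * gradNorm u x := by
  have hx' : x 0 ^ 2 + x 1 ^ 2 ≠ 0 := by
    rw [← norm_sq_plane]; exact pow_ne_zero _ (norm_ne_zero_iff.2 hx)
  -- The vector x and its rotation by a right angle are dual to the two forms and both have length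
  -- |x|.
  have r1 : radialForm x x = 1 := by
    simp [radialForm, norm_sq_plane]
    field_simp
  have r2 : angularForm x x = 0 := by
    simp [angularForm, norm_sq_plane]
    field_simp
    ring
  have r3 : radialForm x !₂[-x 1, x 0] = 0 := by
    simp [radialForm, norm_sq_plane]
    field_simp
    ring
  have r4 : angularForm x !₂[-x 1, x 0] = 1 := by
    simp [angularForm, norm_sq_plane]
    field_simp
    ring
  have hn : ‖(!₂[-x 1, x 0] : EuclideanSpace ℝ (Fin 2))‖ = ‖x‖ := by
    rw [EuclideanSpace.norm_eq, EuclideanSpace.norm_eq]; simp [add_comm]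
  constructor
  · have := norm_fderiv_apply_le u x x
    rw [h] at this
    simpa [r1, r2] using this
  · have := norm_fderiv_apply_le u x !₂[-x 1, x 0]
    rw [h, hn] at this
    simpa [r3, r4] using this

variable {β : ℝ} {lam : ℂ} {j₀ j : ℕ} {x : EuclideanSpace ℝ (Fin 2)}

theorem exp_two_log_norm (hx : x ≠ 0) : Real.exp (2 * Real.log ‖x‖) = ‖x‖ ^ 2 := by
  rw [mul_comm, Real.exp_mul, Real.exp_log (norm_pos_iff.2 hx)]
  norm_cast

/-- The estimates on an annulus. -/
theorem annulusFun_estimates {K k : ℝ} (hβ : 0 < β) (hj : 1 ≤ j)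
    (hp : TransitionParams K j (rate β j) (decay β lam j) (corr β lam j)
        (defectA β lam j) (defectB β lam j) (frozen β lam j))
    (hb : ‖bend β lam j‖ ≤ k)
    (hfr : ∀ s, logRadius β j ≤ s → s ≤ logRadius β (j + 1) →
        ‖lam * (Real.exp (2 * s) : ℝ) - frozen β lam j‖ ≤ K * (j : ℝ) ^ 3)
    (hcut : ∀ b : ℂ, ‖b‖ ≤ k → ∀ τ ∈ Set.Icc (0 : ℝ) 10,
      CutoffValues K τ (Complex.exp (b * ramp τ))
      (cutoffX τ) (deriv cutoffX τ) (deriv (deriv cutoffX) τ)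
      (cutoffY b τ) (deriv (cutoffY b) τ) (deriv (deriv (cutoffY b)) τ)
      (cutoffZ τ) (deriv cutoffZ τ) (deriv (deriv cutoffZ) τ))
    (hx : x ≠ 0) (h0 : logRadius β j ≤ Real.log ‖x‖) (h1 : Real.log ‖x‖ ≤ logRadius β (j + 1)) :
    ContDiffAt ℝ 2 (annulusFun β lam j₀ j) x ∧
    ‖Δ (annulusFun β lam j₀ j) x + lam * annulusFun β lam j₀ j x‖ ≤
      8000 * K ^ 3 * (j : ℝ) ^ 3 * (‖x‖ ^ 2)⁻¹ * ‖annulusFun β lam j₀ j x‖ ∧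
    (j : ℝ) ^ 2 * ‖annulusFun β lam j₀ j x‖ ≤ 200 * ‖x‖ * gradNorm (annulusFun β lam j₀ j) x ∧
    ‖annulusFun β lam j₀ j x‖ ≤
      (1 + 2 * Real.exp (3 * k) * Real.exp 5 + Real.exp 5 ^ 2 / 1000) * ‖coef β lam j₀ j‖ := by
  have hσ : ((-1 : ℂ) ^ j) ^ 2 = 1 := by rw [← pow_mul, mul_comm, pow_mul]; simp
  obtain ⟨hm, hm'⟩ := freq_cast j
  obtain ⟨T, w, hT, hw, hc, hu, hd, hl⟩ := transitionFun_spec (C := coef β lam j₀ j)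
    (q := decay β lam j) (ε := corr β lam j) (b := bend β lam j) (p := rate β j)
    (s₀ := logRadius β j) hσ hm hm' hx lam
  have hg := logGap_pos hβ hj
  have hr0 : 0 < rate β j := div_pos (by norm_num) hg
  set τ := rate β j * (Real.log ‖x‖ - logRadius β j) with hτ
  have hτ0 : 0 ≤ τ := mul_nonneg hr0.le (by linarith)
  have hτ1 : τ ≤ 10 := by
    calc τ ≤ rate β j * logGap β j := by
          rw [hτ, logGap]; gcongr
      _ = 10 := by rw [rate, div_mul_cancel₀ _ hg.ne']
  have hcv := hcut _ hb τ ⟨hτ0, hτ1⟩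
  have hl' := hfr _ h0 h1
  rw [exp_two_log_norm hx] at hl'
  obtain ⟨t1, t2⟩ := transition_estimates (w := w) hp hcv hl' hT
  refine ⟨hc, ?_, ?_, ?_⟩
  · rw [annulusFun, hl, norm_mul, hu, Complex.norm_real, Real.norm_of_nonneg (by positivity)]
    calc _ ≤ (‖x‖ ^ 2)⁻¹ * _ := mul_le_mul_of_nonneg_left t1 (by positivity)
      _ = _ := by ring
  · obtain ⟨g1, g2⟩ := polar_le_gradNorm hx hd
    rw [norm_mul, norm_mul, Complex.norm_I, norm_pow, norm_neg, norm_one, one_pow, one_mul,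
      one_mul] at g2
    rw [annulusFun, hu]
    refine t2.trans ?_
    linarith
  · rw [annulusFun, hu]
    -- On the annulus τ ≤ 10, so |T| ≤ e⁵ and the ramp is at most 3. Moreover ‖w‖ ≤ ‖C‖ because Re q
    -- ≥ 0 and s ≥ s₀.
    have hT5 : ‖T‖ ≤ Real.exp 5 := by
      rw [hT]; exact Real.exp_le_exp.2 (by linarith)
    refine (norm_trU_le hp hcv hT5).trans ?_
    have he : ‖Complex.exp (bend β lam j * ramp τ)‖ ≤ Real.exp (3 * k) := by
      rw [Complex.norm_exp]
      refine Real.exp_le_exp.2 ((Complex.re_le_norm _).trans ?_)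
      rw [norm_mul, Complex.norm_real, Real.norm_of_nonneg (ramp_nonneg _), mul_comm]
      have : ramp τ ≤ 3 := by
        rcases le_total τ 7 with h | h
        · rw [ramp_of_le h]; norm_num
        · linarith [ramp_le h]
      have := ramp_nonneg τ
      gcongr
    have hw' : ‖w‖ ≤ ‖coef β lam j₀ j‖ := by
      rw [hw]
      refine mul_le_of_le_one_right (norm_nonneg _) (Real.exp_le_one_iff.2 ?_)
      nlinarith [hp.q_re]
    gcongr

/-- The gain is exp(-Re q_{j+1} · gap), with Re q_{j+1} ≥ (j+1)²/2 and gap at least 2/(β(j+1)), that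
is, at most exp(-(j+1)/β). The form 2j + 1 of the bound is chosen to telescope to j². -/
theorem norm_stepFactor_le {k : ℝ} (hβ : 0 < β) (hj : 1 ≤ j) (hε : ‖corr β lam j‖ ≤ 1 / 1000)
    (hb : ‖bend β lam j‖ ≤ k) (hq : ((j + 1 : ℕ) : ℝ) ^ 2 / 2 ≤ (decay β lam (j + 1)).re)
    (hbig : 2 * β * (1 + 8 * k) ≤ j) :
    ‖stepFactor β lam j‖ ≤ Real.exp (-(1 / (4 * β)) * (2 * j + 1)) := by
  have hj0 : (0 : ℝ) < j := by exact_mod_cast hj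
  have h1 : ‖-(1 + corr β lam j)‖ ≤ Real.exp 1 := by
    rw [norm_neg]
    have := norm_add_le_of_le (a₁ := (1 : ℂ)) norm_one.le hε
    linarith [Real.add_one_le_exp 1]
  have ho : |rampOffset| ≤ 8 := by
    have a := ramp_nonneg 8
    have b := ramp_le (show (7 : ℝ) ≤ 8 by norm_num)
    rw [rampOffset, abs_le]; constructor <;> linarith
  have h2 : -8 * k ≤ (bend β lam j * rampOffset).re := by
    have := (Complex.abs_re_le_norm (bend β lam j * rampOffset))
    rw [norm_mul, Complex.norm_real] at this
    have h3 : ‖bend β lam j‖ * ‖rampOffset‖ ≤ k * 8 := by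
      have : ‖rampOffset‖ ≤ 8 := ho
      have hk := (norm_nonneg _).trans hb
      gcongr
    linarith [(abs_le.1 (this.trans h3)).1]
  have h3 : ((j : ℝ) + 1) / β ≤ (decay β lam (j + 1) * logGap β j).re := by
    rw [Complex.re_mul_ofReal]
    push_cast at hq
    calc ((j : ℝ) + 1) / β = ((j : ℝ) + 1) ^ 2 / 2 * (2 / β / (j + 1)) := by field_simp
      _ ≤ _ := by
        have := (logGap_bounds hβ hj).1
        have := decay_re_nonneg (β := β) (lam := lam) (j := j + 1)
        gcongr
  rw [stepFactor, norm_mul, Complex.norm_exp]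
  calc _ ≤ Real.exp 1 * Real.exp (8 * k - ((j : ℝ) + 1) / β) := by
        gcongr
        simp only [Complex.sub_re, Complex.neg_re]
        have : (5 : ℂ).re = 5 := rfl
        rw [this]
        linarith
    _ = Real.exp (1 + 8 * k - ((j : ℝ) + 1) / β) := by rw [← Real.exp_add]; ring_nf
    _ ≤ _ := by
        rw [Real.exp_le_exp]
        -- For large j half of the gain absorbs the bounded losses from `corr`, `bend` and the ramp
        -- offset.
        have h4 : 1 + 8 * k ≤ j / (2 * β) := by rw [le_div_iff₀ (by positivity)]; linarith
        have h5 : ((j : ℝ) + 1) / β - j / (2 * β) - (1 / (4 * β)) * (2 * j + 1) =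
          3 / (4 * β) := by field_simp; ring
        have h6 : 0 < 3 / (4 * β) := by positivity
        linarith

theorem norm_coef_le {c : ℝ} (hstep : ∀ j, j₀ ≤ j → ‖stepFactor β lam j‖ ≤ Real.exp (-c * (2 * j + 1)))
    (hj : j₀ ≤ j) :
    ‖coef β lam j₀ j‖ ≤ ‖coef β lam j₀ j₀‖ * Real.exp (c * j₀ ^ 2) * Real.exp (-c * j ^ 2) := by
  induction j, hj using Nat.le_induction with
  | base => rw [mul_assoc, ← Real.exp_add]; simp
  | succ j hj ih =>
    rw [coef_succ hj, norm_mul]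
    calc _ ≤ ‖coef β lam j₀ j₀‖ * Real.exp (c * j₀ ^ 2) * Real.exp (-c * j ^ 2) *
          Real.exp (-c * (2 * j + 1)) := by gcongr; exact hstep j hj
      _ = _ := by
        rw [mul_assoc _ (Real.exp _) (Real.exp _), ← Real.exp_add]
        push_cast
        ring_nf

theorem contDiff_innerExp : ContDiff ℝ 2 (innerExp β lam j₀) := by
  refine (contDiff_const.mul Complex.ofRealCLM.contDiff).sub (contDiff_const.mul ?_)
  exact Complex.ofRealCLM.contDiff.comp
    (contDiff_ramp.comp ((contDiff_id.sub contDiff_const).add contDiff_const))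

/-- Near the origin the inner function is a power of the complex coordinate. -/
theorem innerFun_eq_pow (hj₀ : 1 ≤ j₀) (h : x = 0 ∨ Real.log ‖x‖ ≤ logRadius β j₀ - 2) :
    innerFun β lam j₀ x = planeCoord x ^ (j₀ ^ 2) := by
  have hz : phase x ^ ((j₀ : ℤ) ^ 2) = phase x ^ (j₀ ^ 2) := by
    rw [← zpow_natCast]; push_cast; rfl
  rw [innerFun, mode, hz]
  by_cases hx : x = 0
  · subst hx
    have : j₀ ^ 2 ≠ 0 := by positivity
    simp only [phase, map_zero, zero_mul, zero_pow this, mul_zero]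
  · have h := h.resolve_left hx
    have hn : (‖x‖ : ℂ) ≠ 0 := Complex.ofReal_ne_zero.2 (norm_ne_zero_iff.2 hx)
    have e : Complex.exp (innerExp β lam j₀ (Real.log ‖x‖)) = (‖x‖ : ℂ) ^ (j₀ ^ 2) := by
      rw [innerExp, ramp_of_le (by linarith), Complex.ofReal_zero, mul_zero, sub_zero]
      have : ((j₀ : ℂ) ^ 2) = ((j₀ ^ 2 : ℕ) : ℂ) := by push_cast; rfl
      rw [this, Complex.exp_nat_mul, ← Complex.ofReal_exp, Real.exp_log (norm_pos_iff.2 hx)]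
    rw [e, phase, mul_pow, Complex.ofReal_inv, inv_pow]
    field_simp

theorem contDiffAt_innerFun (hj₀ : 1 ≤ j₀) (x : EuclideanSpace ℝ (Fin 2)) :
    ContDiffAt ℝ 2 (innerFun β lam j₀) x := by
  by_cases hx : x = 0
  · subst hx
    have he : innerFun β lam j₀ =ᶠ[𝓝 0] fun y => planeCoord y ^ (j₀ ^ 2) := by
      filter_upwards [Metric.ball_mem_nhds (0 : EuclideanSpace ℝ (Fin 2))
        (Real.exp_pos (logRadius β j₀ - 2))] with y hy
      rw [mem_ball_zero_iff] at hy
      refine innerFun_eq_pow hj₀ ?_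
      by_cases hy0 : y = 0
      · exact Or.inl hy0
      · right
        rw [Real.log_le_iff_le_exp (norm_pos_iff.2 hy0)]
        exact hy.le
    exact ((planeCoord.contDiff.pow _).contDiffAt).congr_of_eventuallyEq he
  · exact contDiffAt_mode hx (Complex.contDiff_exp.comp contDiff_innerExp).contDiffAt

/-- The estimates on the inner disc. -/
theorem innerFun_estimates (hj₀ : 1 ≤ j₀) : ∃ C : ℝ, ∀ x : EuclideanSpace ℝ (Fin 2), x ≠ 0 →
    Real.log ‖x‖ ≤ logRadius β j₀ →
    ‖Δ (innerFun β lam j₀) x + lam * innerFun β lam j₀ x‖ ≤ C * ‖innerFun β lam j₀ x‖ ∧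
    ‖innerFun β lam j₀ x‖ ≤ Real.exp (logRadius β j₀) * gradNorm (innerFun β lam j₀) x := by
  obtain ⟨h1, h2⟩ := (contDiff_innerExp (β := β) (lam := lam) (j₀ := j₀)).hasDerivAt_two
  set h := innerExp β lam j₀ with hh
  have e1 : ∀ s, HasDerivAt (fun s => Complex.exp (h s)) (Complex.exp (h s) * deriv h s) s :=
    fun s => (h1 s).cexp
  have e2 : ∀ s, HasDerivAt (fun s => Complex.exp (h s) * deriv h s)
      (Complex.exp (h s) * deriv h s * deriv h s + Complex.exp (h s) * deriv (deriv h) s) s :=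
    fun s => (e1 s).mul (h2 s)
  obtain ⟨d1, d2⟩ := continuous_deriv_deriv (contDiff_innerExp (β := β) (lam := lam) (j₀ := j₀))
  set V : ℝ → ℂ := fun s => deriv h s ^ 2 + deriv (deriv h) s - ((j₀ : ℂ) ^ 2) ^ 2 with hV
  have hVc : Continuous V := ((d1.pow 2).add d2).sub continuous_const
  obtain ⟨C, hC⟩ := isCompact_Icc.exists_bound_of_continuousOn
    (hVc.continuousOn (s := Set.Icc (logRadius β j₀ - 3) (logRadius β j₀)))
  have hC0 : 0 ≤ C := (norm_nonneg _).trans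
    (hC (logRadius β j₀) ⟨by linarith, le_rfl⟩)
  refine ⟨(Real.exp (2 * (logRadius β j₀ - 3)))⁻¹ * C + ‖lam‖, fun x hx hs => ⟨?_, ?_⟩⟩
  · have hl := laplacian_mode (m := (j₀ : ℤ) ^ 2) hx
      (Complex.contDiff_exp.comp contDiff_innerExp).contDiffAt e1 e2
    have hl' : Δ (innerFun β lam j₀) x =
        ((‖x‖ ^ 2)⁻¹ : ℝ) * V (Real.log ‖x‖) * innerFun β lam j₀ x := by
      refine hl.trans ?_
      rw [innerFun, mode, hV, Function.comp_apply, ← hh]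
      push_cast
      ring
    rw [hl', ← add_mul, norm_mul]
    gcongr
    refine norm_add_le_of_le ?_ le_rfl
    rw [norm_mul, Complex.norm_real, Real.norm_of_nonneg (by positivity), ← exp_two_log_norm hx]
    -- Below s₀ - 2 the function is a power of the complex coordinate, hence harmonic, so the
    -- singular factor r⁻² has to be bounded only on the remaining shell.
    rcases lt_or_ge (Real.log ‖x‖) (logRadius β j₀ - 2) with hlt | hge
    · have hev : h =ᶠ[𝓝 (Real.log ‖x‖)] fun s => (j₀ : ℂ) ^ 2 * s := by
        filter_upwards [gt_mem_nhds hlt] with s hs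
        rw [hh, innerExp, ramp_of_le (by linarith)]; simp
      have hd1 : deriv h =ᶠ[𝓝 (Real.log ‖x‖)] fun _ => (j₀ : ℂ) ^ 2 := by
        refine hev.deriv.trans (Eventually.of_forall fun s => ?_)
        have : HasDerivAt (fun s : ℝ => (j₀ : ℂ) ^ 2 * (s : ℂ)) ((j₀ : ℂ) ^ 2 * 1) s := by
          simpa using (hasDerivAt_id s).ofReal_comp.const_mul ((j₀ : ℂ) ^ 2)
        simpa using this.deriv
      have hV0 : V (Real.log ‖x‖) = 0 := by
        simp only [hV]
        rw [hd1.deriv_eq, hd1.self_of_nhds]; simp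
      rw [hV0, norm_zero, mul_zero]
      positivity
    · have := hC _ ⟨by linarith, hs⟩
      gcongr
      linarith
  · have hd := hasFDerivAt_mode (m := (j₀ : ℤ) ^ 2) hx (e1 (Real.log ‖x‖))
    -- The angular derivative alone has modulus j₀²|u|, whatever the radial profile.
    have hg := (polar_le_gradNorm (u := innerFun β lam j₀) hx hd.fderiv).2
    have hxle : ‖x‖ ≤ Real.exp (logRadius β j₀) :=
      (Real.log_le_iff_le_exp (norm_pos_iff.2 hx)).1 hs
    have hj : (1 : ℝ) ≤ (j₀ : ℝ) ^ 2 := one_le_pow₀ (by exact_mod_cast hj₀)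
    have e : ‖Complex.I * (((j₀ : ℤ) ^ 2 : ℤ) : ℂ) *
        mode (fun s => Complex.exp (h s)) ((j₀ : ℤ) ^ 2) x‖ =
        (j₀ : ℝ) ^ 2 * ‖innerFun β lam j₀ x‖ := by
      rw [norm_mul, norm_mul, Complex.norm_I, one_mul]
      congr 1
      simp
    rw [e] at hg
    calc _ ≤ (j₀ : ℝ) ^ 2 * ‖innerFun β lam j₀ x‖ := le_mul_of_one_le_left (norm_nonneg _) hj
      _ ≤ ‖x‖ * gradNorm (innerFun β lam j₀) x := hg
      _ ≤ _ := by
        have := gradNorm_nonneg (innerFun β lam j₀) x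
        gcongr

end

/-! ### Comparison with powers of ⟨x⟩ and the decaying function in the plane -/

theorem continuous_laplacian {n : ℕ} {u : EuclideanSpace ℝ (Fin n) → ℂ} (hu : ContDiff ℝ 2 u) :
    Continuous (Δ u) := by
  rw [laplacian_eq_iteratedFDeriv_orthonormalBasis u (EuclideanSpace.basisFun (Fin n) ℝ)]
  refine continuous_finsetSum _ fun i _ => ?_
  exact (ContinuousMultilinearMap.apply ℝ (fun _ : Fin 2 => EuclideanSpace ℝ (Fin n)) ℂ
    _).continuous.comp (hu.continuous_iteratedFDeriv le_rfl)

theorem one_le_japaneseBracket {n : ℕ} (x : EuclideanSpace ℝ (Fin n)) : 1 ≤ japaneseBracket x :=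
  Real.one_le_sqrt.2 (by linarith [sq_nonneg ‖x‖])

theorem japaneseBracket_pos {n : ℕ} (x : EuclideanSpace ℝ (Fin n)) : 0 < japaneseBracket x :=
  one_pos.trans_le (one_le_japaneseBracket x)

theorem japaneseBracket_le {n : ℕ} (x : EuclideanSpace ℝ (Fin n)) :
    japaneseBracket x ≤ 1 + ‖x‖ := by
  rw [japaneseBracket, Real.sqrt_le_left (by positivity)]
  nlinarith [norm_nonneg x]

theorem norm_le_japaneseBracket {n : ℕ} (x : EuclideanSpace ℝ (Fin n)) :
    ‖x‖ ≤ japaneseBracket x := Real.le_sqrt_of_sq_le (by linarith)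

theorem continuous_japaneseBracket_rpow {n : ℕ} (a : ℝ) :
    Continuous fun x : EuclideanSpace ℝ (Fin n) => japaneseBracket x ^ a := by
  have : Continuous fun x : EuclideanSpace ℝ (Fin n) => japaneseBracket x :=
    Real.continuous_sqrt.comp (continuous_const.add (continuous_norm.pow 2))
  exact this.rpow_const fun x => Or.inl (japaneseBracket_pos x).ne'

theorem rpow_le_rpow_abs {t B : ℝ} (a : ℝ) (h1 : 1 ≤ t) (hB : t ≤ B) : t ^ a ≤ B ^ |a| :=
  (Real.rpow_le_rpow_of_exponent_le h1 (le_abs_self a)).trans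
    (Real.rpow_le_rpow (by linarith) hB (abs_nonneg a))

theorem one_le_mul_rpow {t B : ℝ} (a : ℝ) (h1 : 1 ≤ t) (hB : t ≤ B) : 1 ≤ B ^ |a| * t ^ a := by
  have h := rpow_le_rpow_abs (-a) h1 hB
  rw [abs_neg] at h
  calc (1 : ℝ) = t ^ (-a) * t ^ a := by rw [← Real.rpow_add (by linarith)]; simp
    _ ≤ _ := by gcongr

/-- For |x| ≥ 1 the bracket lies between |x| and 2|x|, so powers of either sign can be exchanged at
the cost of a constant. -/
theorem rpow_comparable {r t : ℝ} (a : ℝ) (hr : 0 < r) (h1 : r ≤ t) (h2 : t ≤ 2 * r) :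
    r ^ a ≤ 2 ^ |a| * t ^ a ∧ t ^ a ≤ 2 ^ |a| * r ^ a := by
  have g1 : 1 ≤ t / r := by rwa [le_div_iff₀ hr, one_mul]
  have g2 : t / r ≤ 2 := by rwa [div_le_iff₀ hr]
  have e : t ^ a = (t / r) ^ a * r ^ a := by
    rw [← Real.mul_rpow (by linarith) hr.le, div_mul_cancel₀ _ hr.ne']
  have hra : 0 < r ^ a := Real.rpow_pos_of_pos hr a
  constructor
  · rw [e, ← mul_assoc]
    exact le_mul_of_one_le_left hra.le (one_le_mul_rpow a g1 g2)
  · rw [e]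
    exact mul_le_mul_of_nonneg_right (rpow_le_rpow_abs a g1 g2) hra.le

theorem annulus_radius_bounds {β : ℝ} {j : ℕ} {x : EuclideanSpace ℝ (Fin 2)} (hβ : 0 < β) (hj : 1 ≤ j)
    (hx : x ≠ 0) (h0 : logRadius β j ≤ Real.log ‖x‖) (h1 : Real.log ‖x‖ ≤ logRadius β (j + 1)) :
    (j : ℝ) ≤ ‖x‖ ^ (β / 2) ∧ ‖x‖ ^ (β / 2) ≤ j + 1 := by
  rw [Real.rpow_def_of_pos (norm_pos_iff.2 hx), mul_comm (Real.log _)]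
  refine ⟨(logRadius_le_iff hβ hj _).1 h0, ?_⟩
  have hj1 : (0 : ℝ) < (j : ℝ) + 1 := by positivity
  rw [← Real.le_log_iff_exp_le hj1]
  calc β / 2 * Real.log ‖x‖ ≤ β / 2 * logRadius β (j + 1) := by gcongr
    _ = Real.log (j + 1) := by rw [logRadius]; push_cast; field_simp

/-- A rapidly decaying function on the plane that is nearly an eigenfunction. -/
theorem exists_decaying_function {β : ℝ} (hβ : 1 < β) (lam : ℂ) :
    ∃ u : EuclideanSpace ℝ (Fin 2) → ℂ, ContDiff ℝ 2 u ∧ u ≠ 0 ∧ ∃ C c : ℝ, 0 < C ∧ 0 < c ∧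
      (∀ x, ‖Δ u x + lam * u x‖ ≤ C * japaneseBracket x ^ (3 * β / 2 - 2) * ‖u x‖) ∧
      (∀ x, japaneseBracket x ^ (β - 1) * ‖u x‖ ≤ C * gradNorm u x) ∧
      ∀ x, ‖u x‖ ≤ C * Real.exp (-c * ‖x‖ ^ β) := by
  have hβ0 : 0 < β := by linarith
  set k : ℝ := 7 + 4 * ‖lam‖ with hk
  obtain ⟨K₁, hK₁⟩ := exists_transitionParams hβ lam
  obtain ⟨K₀, hK₀⟩ := exists_cutoffValues k
  set K := max K₁ K₀
  have hcut := hK₀ K (le_max_right _ _)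
  obtain ⟨J, hJ⟩ := eventually_atTop.1 ((hK₁ K (le_max_left _ _)).and
    ((tendsto_natCast_atTop_atTop (R := ℝ)).eventually_ge_atTop (2 * β * (1 + 8 * k))))
  -- Even, so that the first annulus matches the inner disc, and beyond J, so that every annulus
  -- used satisfies the size conditions.
  set j₀ := 2 * (J + 4)
  have hev : Even j₀ := even_two_mul _
  have hj4 : 4 ≤ j₀ := by omega
  have hj1 : 1 ≤ j₀ := by omega
  have hgood : ∀ j, j₀ ≤ j → J ≤ j := fun j hj => by omega
  set u := gluedFun β lam j₀ with hu
  have hloc := gluedFun_local (lam := lam) hβ0 hj4 hev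
  rw [← hu] at hloc
  obtain ⟨Ci, hCi⟩ := innerFun_estimates (β := β) (lam := lam) hj1
  have hK1 : 1 ≤ K := ((hJ j₀ (hgood j₀ le_rfl)).1.2.1).one_le_K
  have hann : ∀ j, j₀ ≤ j → ∀ x : EuclideanSpace ℝ (Fin 2), x ≠ 0 → logRadius β j ≤ Real.log ‖x‖ →
      Real.log ‖x‖ ≤ logRadius β (j + 1) → _ := fun j hj x hx h0 h1 =>
    annulusFun_estimates (j₀ := j₀) hβ0 (hj1.trans hj) (hJ j (hgood j hj)).1.2.1
      (hJ j (hgood j hj)).1.2.2.1 (hJ j (hgood j hj)).1.2.2.2.2 hcut hx h0 h1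
  have hstep : ∀ j, j₀ ≤ j → ‖stepFactor β lam j‖ ≤ Real.exp (-(1 / (4 * β)) * (2 * j + 1)) :=
    fun j hj => norm_stepFactor_le hβ0 (hj1.trans hj) (hJ j (hgood j hj)).1.2.1.eps_le
      (hJ j (hgood j hj)).1.2.2.1 (hJ (j + 1) ((hgood j hj).trans j.le_succ)).1.2.2.2.1
      (hJ j (hgood j hj)).2
  set c := 1 / (4 * β) with hc
  have hc0 : 0 < c := by positivity
  set R := Real.exp (logRadius β j₀) with hR
  have hR0 : 0 < R := Real.exp_pos _
  have hcd : ContDiff ℝ 2 u := contDiff_iff_contDiffAt.2 fun x => by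
    rcases hloc x with ⟨-, he⟩ | ⟨j, hj, hx, h0, h1, he⟩
    · exact (contDiffAt_innerFun hj1 x).congr_of_eventuallyEq he
    · exact (hann j hj x hx h0 h1).1.congr_of_eventuallyEq he
  have hgrad : ∀ {v : EuclideanSpace ℝ (Fin 2) → ℂ} {x}, u =ᶠ[𝓝 x] v →
      gradNorm u x = gradNorm v x := fun he => by simp only [gradNorm, he.fderiv_eq]
  have hlog : ∀ {x : EuclideanSpace ℝ (Fin 2)}, Real.log ‖x‖ < logRadius β j₀ → ‖x‖ ≤ R := by
    intro x hx
    by_cases h0 : x = 0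
    · rw [h0, norm_zero]; exact hR0.le
    · exact ((Real.log_lt_iff_lt_exp (norm_pos_iff.2 h0)).1 hx).le
  have hr1 : ∀ {j} {x : EuclideanSpace ℝ (Fin 2)}, j₀ ≤ j → x ≠ 0 →
      logRadius β j ≤ Real.log ‖x‖ → 1 ≤ ‖x‖ := by
    intro j x hj hx h0
    have : (1 : ℝ) ≤ j := by exact_mod_cast hj1.trans hj
    have h : 0 ≤ Real.log ‖x‖ :=
      le_trans (mul_nonneg (by positivity) (Real.log_nonneg this)) h0
    exact (Real.log_nonneg_iff (norm_pos_iff.2 hx)).1 h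
  have hu0 : u 0 = 0 := by
    rcases hloc 0 with ⟨-, he⟩ | ⟨j, hj, hx, -⟩
    · rw [he.self_of_nhds, innerFun_eq_pow hj1 (Or.inl rfl), map_zero]
      exact zero_pow (by positivity)
    · exact absurd rfl hx
  set a := 3 * β / 2 - 2 with ha
  set C₁ := max (Ci * (1 + R) ^ |a|) (8000 * K ^ 3 * 2 ^ |a|) with hC₁
  set C₂ := max ((1 + R) ^ |β - 1| * R) (2 ^ |β - 1| * 800) with hC₂
  set D := (1 + 2 * Real.exp (3 * k) * Real.exp 5 + Real.exp 5 ^ 2 / 1000) *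
    (‖coef β lam j₀ j₀‖ * Real.exp (c * j₀ ^ 2)) with hD
  obtain ⟨S, hS⟩ := (isCompact_closedBall (0 : EuclideanSpace ℝ (Fin 2)) R).exists_bound_of_continuousOn
    hcd.continuous.continuousOn
  have hS0 : 0 ≤ S := (norm_nonneg _).trans (hS 0 (by simpa using hR0.le))
  set C₃ := max D (S * Real.exp (c / 4 * R ^ β)) with hC₃
  have b1 : ∀ x, x ≠ 0 → ‖Δ u x + lam * u x‖ ≤ C₁ * japaneseBracket x ^ a * ‖u x‖ := by
    intro x hx
    rcases hloc x with ⟨h, he⟩ | ⟨j, hj, -, h0, h1, he⟩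
    · rw [(laplacian_congr_nhds he).self_of_nhds, he.self_of_nhds]
      refine ((hCi x hx h.le).1).trans ?_
      gcongr
      have hb := one_le_mul_rpow (t := japaneseBracket x) a (one_le_japaneseBracket x)
        ((japaneseBracket_le x).trans (add_le_add_right (hlog h) 1))
      rcases le_total 0 Ci with h | h
      · calc Ci ≤ Ci * ((1 + R) ^ |a| * japaneseBracket x ^ a) := le_mul_of_one_le_right h hb
          _ = Ci * (1 + R) ^ |a| * japaneseBracket x ^ a := by ring
          _ ≤ _ := by
            have := (Real.rpow_pos_of_pos (japaneseBracket_pos x) a).le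
            gcongr
            exact le_max_left _ _
      · refine h.trans (mul_nonneg (le_max_of_le_right ?_)
          (Real.rpow_pos_of_pos (japaneseBracket_pos x) a).le)
        positivity
    · rw [(laplacian_congr_nhds he).self_of_nhds, he.self_of_nhds]
      refine ((hann j hj x hx h0 h1).2.1).trans (mul_le_mul_of_nonneg_right ?_ (norm_nonneg _))
      have hxp := norm_pos_iff.2 hx
      have h2 := (annulus_radius_bounds hβ0 (hj1.trans hj) hx h0 h1).1
      -- Here j ≤ r^{β/2} turns the error j³r⁻² into the power r^{3β/2-2}.
      have h3 : (j : ℝ) ^ 3 * (‖x‖ ^ 2)⁻¹ ≤ ‖x‖ ^ a := by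
        calc (j : ℝ) ^ 3 * (‖x‖ ^ 2)⁻¹ ≤ (‖x‖ ^ (β / 2)) ^ 3 * (‖x‖ ^ 2)⁻¹ := by gcongr
          _ = ‖x‖ ^ a := by
            rw [← Real.rpow_natCast, ← Real.rpow_mul hxp.le, ← Real.rpow_natCast,
              ← Real.rpow_neg hxp.le, ← Real.rpow_add hxp, ha]
            congr 1
            push_cast
            ring
      have hxr := hr1 hj hx h0
      have h4 := (rpow_comparable a hxp (norm_le_japaneseBracket x)
        (by linarith [japaneseBracket_le x])).1
      calc 8000 * K ^ 3 * (j : ℝ) ^ 3 * (‖x‖ ^ 2)⁻¹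
          = 8000 * K ^ 3 * ((j : ℝ) ^ 3 * (‖x‖ ^ 2)⁻¹) := by ring
        _ ≤ 8000 * K ^ 3 * (2 ^ |a| * japaneseBracket x ^ a) :=
          mul_le_mul_of_nonneg_left (h3.trans h4) (by positivity)
        _ = 8000 * K ^ 3 * 2 ^ |a| * japaneseBracket x ^ a := by ring
        _ ≤ _ := by
          have := (Real.rpow_pos_of_pos (japaneseBracket_pos x) a).le
          gcongr
          exact le_max_right _ _
  -- Polar coordinates miss the origin; the inequality is a closed condition, so density of the
  -- complement extends it.
  have b1' : ∀ x, ‖Δ u x + lam * u x‖ ≤ C₁ * japaneseBracket x ^ a * ‖u x‖ := by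
    have hcl : IsClosed {x | ‖Δ u x + lam * u x‖ ≤ C₁ * japaneseBracket x ^ a * ‖u x‖} :=
      isClosed_le ((continuous_laplacian hcd).add (continuous_const.mul hcd.continuous)).norm
        ((continuous_const.mul (continuous_japaneseBracket_rpow a)).mul hcd.continuous.norm)
    have hdense : Dense ({0}ᶜ : Set (EuclideanSpace ℝ (Fin 2))) := dense_compl_singleton 0
    intro x
    exact hcl.closure_subset_iff.2 (fun y hy => b1 y hy) (hdense x)
  have b2 : ∀ x, japaneseBracket x ^ (β - 1) * ‖u x‖ ≤ C₂ * gradNorm u x := by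
    intro x
    have hg0 := gradNorm_nonneg u x
    by_cases hx : x = 0
    · rw [hx, hu0, norm_zero, mul_zero, ← hx]
      exact mul_nonneg (le_max_of_le_left (by positivity)) hg0
    rcases hloc x with ⟨h, he⟩ | ⟨j, hj, -, h0, h1, he⟩
    · rw [hgrad he, he.self_of_nhds] at *
      have hb := rpow_le_rpow_abs (t := japaneseBracket x) (β - 1) (one_le_japaneseBracket x)
        ((japaneseBracket_le x).trans (add_le_add_right (hlog h) 1))
      calc _ ≤ (1 + R) ^ |β - 1| * (R * gradNorm (innerFun β lam j₀) x) := by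
            gcongr
            exact (hCi x hx h.le).2
        _ = (1 + R) ^ |β - 1| * R * gradNorm (innerFun β lam j₀) x := by ring
        _ ≤ _ := by gcongr; exact le_max_left _ _
    · rw [hgrad he, he.self_of_nhds] at *
      have hxp := norm_pos_iff.2 hx
      have h2 := (annulus_radius_bounds hβ0 (hj1.trans hj) hx h0 h1).2
      have hxr := hr1 hj hx h0
      have h4 := (rpow_comparable (β - 1) hxp (norm_le_japaneseBracket x)
        (by linarith [japaneseBracket_le x])).2
      have h3 : ‖x‖ ^ β ≤ 4 * (j : ℝ) ^ 2 := by
        have hj' : (1 : ℝ) ≤ j := by exact_mod_cast hj1.trans hj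
        calc ‖x‖ ^ β = (‖x‖ ^ (β / 2)) ^ 2 := by
              rw [← Real.rpow_natCast, ← Real.rpow_mul hxp.le]; congr 1; push_cast; ring
          _ ≤ ((j : ℝ) + 1) ^ 2 := by gcongr
          _ ≤ _ := by nlinarith
      have h5 : ‖x‖ ^ (β - 1) * ‖annulusFun β lam j₀ j x‖ ≤
          800 * gradNorm (annulusFun β lam j₀ j) x := by
        have e : ‖x‖ ^ β = ‖x‖ * ‖x‖ ^ (β - 1) := by
          rw [Real.rpow_sub_one hxp.ne']; field_simp
        refine le_of_mul_le_mul_left ?_ hxp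
        calc _ = ‖x‖ ^ β * ‖annulusFun β lam j₀ j x‖ := by rw [e]; ring
          _ ≤ 4 * (j : ℝ) ^ 2 * ‖annulusFun β lam j₀ j x‖ := by gcongr
          _ = 4 * ((j : ℝ) ^ 2 * ‖annulusFun β lam j₀ j x‖) := by ring
          _ ≤ 4 * (200 * ‖x‖ * gradNorm (annulusFun β lam j₀ j) x) :=
            mul_le_mul_of_nonneg_left (hann j hj x hx h0 h1).2.2.1 (by norm_num)
          _ = _ := by ring
      calc _ ≤ 2 ^ |β - 1| * ‖x‖ ^ (β - 1) * ‖annulusFun β lam j₀ j x‖ := by gcongr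
        _ = 2 ^ |β - 1| * (‖x‖ ^ (β - 1) * ‖annulusFun β lam j₀ j x‖) := by ring
        _ ≤ 2 ^ |β - 1| * (800 * gradNorm (annulusFun β lam j₀ j) x) := by gcongr
        _ = 2 ^ |β - 1| * 800 * gradNorm (annulusFun β lam j₀ j) x := by ring
        _ ≤ _ := by gcongr; exact le_max_right _ _
  have b3 : ∀ x, ‖u x‖ ≤ C₃ * Real.exp (-(c / 4) * ‖x‖ ^ β) := by
    intro x
    rcases hloc x with ⟨h, he⟩ | ⟨j, hj, hx, h0, h1, he⟩
    · have hxR := hlog h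
      calc ‖u x‖ ≤ S := hS x (by simpa using hxR)
        _ ≤ S * Real.exp (c / 4 * R ^ β + -(c / 4) * ‖x‖ ^ β) := by
          refine le_mul_of_one_le_right hS0 (Real.one_le_exp ?_)
          have : ‖x‖ ^ β ≤ R ^ β := Real.rpow_le_rpow (norm_nonneg _) hxR hβ0.le
          nlinarith
        _ = S * Real.exp (c / 4 * R ^ β) * Real.exp (-(c / 4) * ‖x‖ ^ β) := by
          rw [Real.exp_add]; ring
        _ ≤ _ := by gcongr; exact le_max_right _ _
    · rw [he.self_of_nhds]
      have hxp := norm_pos_iff.2 hx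
      have h2 := (annulus_radius_bounds hβ0 (hj1.trans hj) hx h0 h1).2
      have h3 : ‖x‖ ^ β ≤ 4 * (j : ℝ) ^ 2 := by
        have hj' : (1 : ℝ) ≤ j := by exact_mod_cast hj1.trans hj
        calc ‖x‖ ^ β = (‖x‖ ^ (β / 2)) ^ 2 := by
              rw [← Real.rpow_natCast, ← Real.rpow_mul hxp.le]; congr 1; push_cast; ring
          _ ≤ ((j : ℝ) + 1) ^ 2 := by gcongr
          _ ≤ _ := by nlinarith
      calc _ ≤ (1 + 2 * Real.exp (3 * k) * Real.exp 5 + Real.exp 5 ^ 2 / 1000) *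
            (‖coef β lam j₀ j₀‖ * Real.exp (c * j₀ ^ 2) * Real.exp (-c * j ^ 2)) := by
            refine ((hann j hj x hx h0 h1).2.2.2).trans ?_
            gcongr
            exact norm_coef_le hstep hj
        _ = D * Real.exp (-c * j ^ 2) := by rw [hD]; ring
        _ ≤ C₃ * Real.exp (-(c / 4) * ‖x‖ ^ β) := by
          -- The loss from c to c/4 comes from r^β ≤ (j+1)² ≤ 4j².
          gcongr ?_ * Real.exp ?_
          · exact le_max_left _ _
          · nlinarith
  have hne : u ≠ 0 := by
    intro h
    have h1 : ‖(EuclideanSpace.single 0 1 : EuclideanSpace ℝ (Fin 2))‖ = 1 := by simp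
    have hx : (EuclideanSpace.single 0 1 : EuclideanSpace ℝ (Fin 2)) ≠ 0 := by
      rw [← norm_ne_zero_iff, h1]; exact one_ne_zero
    have h2 := congrFun h (EuclideanSpace.single 0 1)
    have hs0 : 0 < logRadius β j₀ := by
      have : (1 : ℝ) < j₀ := by exact_mod_cast (show 1 < j₀ by omega)
      exact mul_pos (by positivity) (Real.log_pos this)
    rw [hu, gluedFun, if_pos (by rw [h1, Real.log_one]; exact hs0), innerFun, mode] at h2
    exact mul_ne_zero (Complex.exp_ne_zero _) (zpow_ne_zero _ (phase_ne_zero hx)) h2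
  have hC : 0 < max C₁ (max C₂ C₃) := by
    refine lt_max_of_lt_left (lt_max_of_lt_right ?_)
    positivity
  refine ⟨u, hcd, hne, max C₁ (max C₂ C₃), c / 4, hC, by positivity, fun x => ?_, fun x => ?_,
    fun x => ?_⟩
  · refine (b1' x).trans ?_
    have := (Real.rpow_pos_of_pos (japaneseBracket_pos x) a).le
    gcongr
    exact le_max_left _ _
  · refine (b2 x).trans ?_
    have := gradNorm_nonneg u x
    gcongr
    exact (le_max_left _ _).trans (le_max_right _ _)
  · refine (b3 x).trans ?_
    gcongr
    exact (le_max_right _ _).trans (le_max_right _ _)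

/-! ### From approximate solutions to exact potentials -/

/-- A function that nearly solves the eigenvalue equation solves it exactly with a zeroth order
potential. -/
theorem exists_zeroth_order_potential {n : ℕ} {lam : ℂ} {u : EuclideanSpace ℝ (Fin n) → ℂ}
    (hu : ContDiff ℝ 2 u) {C a : ℝ} (hC : 0 ≤ C)
    (h : ∀ x, ‖Δ u x + lam * u x‖ ≤ C * japaneseBracket x ^ a * ‖u x‖) :
    ∃ V : EuclideanSpace ℝ (Fin n) → ℂ, Measurable V ∧ IsClassicalSolution lam V 0 u ∧
      ∀ x, ‖V x‖ ≤ C * japaneseBracket x ^ a := by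
  have hL : Measurable fun x => Δ u x + lam * u x :=
    ((continuous_laplacian hu).add (continuous_const.mul hu.continuous)).measurable
  refine ⟨fun x => (Δ u x + lam * u x) / u x, hL.div hu.continuous.measurable,
    ⟨hu, fun x => ?_⟩, fun x => ?_⟩
  · have h0 : (Δ u x + lam * u x) / u x * u x = Δ u x + lam * u x := by
      by_cases hx : u x = 0
      · have h1 : ‖Δ u x + lam * u x‖ ≤ 0 := by simpa [hx] using h x
        rw [norm_le_zero_iff.1 h1, zero_div, zero_mul]
      · rw [div_mul_cancel₀ _ hx]
    rw [h0]
    simp [dotGrad]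
  · have hb := (Real.rpow_pos_of_pos (japaneseBracket_pos x) a).le
    rw [norm_div]
    exact div_le_of_le_mul₀ (norm_nonneg _) (by positivity) (h x)

/-- A function that nearly solves the eigenvalue equation and whose gradient is large solves it
exactly with a first order potential. -/
theorem exists_first_order_potential {n : ℕ} {lam : ℂ} {u : EuclideanSpace ℝ (Fin n) → ℂ}
    (hu : ContDiff ℝ 2 u) {C a b : ℝ} (hC : 0 ≤ C)
    (h : ∀ x, ‖Δ u x + lam * u x‖ ≤ C * japaneseBracket x ^ a * ‖u x‖)
    (hg : ∀ x, japaneseBracket x ^ b * ‖u x‖ ≤ C * gradNorm u x) :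
    ∃ W : EuclideanSpace ℝ (Fin n) → EuclideanSpace ℂ (Fin n), Measurable W ∧
      IsClassicalSolution lam 0 W u ∧ ∀ x, ‖W x‖ ≤ C ^ 2 * japaneseBracket x ^ (a - b) := by
  set L : EuclideanSpace ℝ (Fin n) → ℂ := fun x => Δ u x + lam * u x with hL
  set d : Fin n → EuclideanSpace ℝ (Fin n) → ℂ := fun i x =>
    fderiv ℝ u x (EuclideanSpace.single i 1) with hd
  have hLm : Continuous L := (continuous_laplacian hu).add (continuous_const.mul hu.continuous)
  have hdm : ∀ i, Continuous (d i) := fun i =>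
    (hu.continuous_fderiv (by norm_num)).clm_apply continuous_const
  have hgm : Continuous (gradNorm u) :=
    Real.continuous_sqrt.comp (continuous_finsetSum _ fun i _ => (hdm i).norm.pow 2)
  have hsq : ∀ x, gradNorm u x ^ 2 = ∑ i, ‖d i x‖ ^ 2 := fun x =>
    Real.sq_sqrt (Finset.sum_nonneg fun i _ => by positivity)
  have hbound : ∀ x, ‖L x‖ ≤ C ^ 2 * japaneseBracket x ^ (a - b) * gradNorm u x := by
    intro x
    have hp := japaneseBracket_pos x
    have ha := Real.rpow_pos_of_pos hp a
    have hb := Real.rpow_pos_of_pos hp b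
    have h1 : ‖u x‖ ≤ C * gradNorm u x / japaneseBracket x ^ b := by
      rw [le_div_iff₀ hb, mul_comm]; exact hg x
    calc ‖L x‖ ≤ C * japaneseBracket x ^ a * ‖u x‖ := h x
      _ ≤ C * japaneseBracket x ^ a * (C * gradNorm u x / japaneseBracket x ^ b) := by gcongr
      _ = _ := by rw [Real.rpow_sub hp]; ring
  -- The conjugate gradient direction gives the shortest W with W · ∇u = L, of length |L|/|∇u|.
  -- Where the gradient vanishes W is 0 by convention, and `hbound` gives L = 0.
  refine ⟨fun x => WithLp.toLp 2 fun i => L x * (starRingEnd ℂ) (d i x) / ((gradNorm u x ^ 2 : ℝ) : ℂ),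
    ?_, ⟨hu, fun x => ?_⟩, fun x => ?_⟩
  · refine (WithLp.measurable_toLp 2 _).comp (measurable_pi_lambda _ fun i => ?_)
    refine (hLm.measurable.mul ?_).div ?_
    · exact (Complex.continuous_conj.comp (hdm i)).measurable
    · exact (Complex.continuous_ofReal.comp (hgm.pow 2)).measurable
  · have key : dotGrad (fun x => WithLp.toLp 2 fun i =>
        L x * (starRingEnd ℂ) (d i x) / ((gradNorm u x ^ 2 : ℝ) : ℂ)) u x = L x := by
      by_cases hx : gradNorm u x = 0
      · have := hbound x
        rw [hx, mul_zero] at this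
        rw [dotGrad, norm_le_zero_iff.1 this]
        simp
      · have hx' : ((gradNorm u x ^ 2 : ℝ) : ℂ) ≠ 0 :=
          Complex.ofReal_ne_zero.2 (pow_ne_zero _ hx)
        have e : ∀ i, L x * (starRingEnd ℂ) (d i x) / ((gradNorm u x ^ 2 : ℝ) : ℂ) * d i x =
            L x / ((gradNorm u x ^ 2 : ℝ) : ℂ) * ((‖d i x‖ ^ 2 : ℝ) : ℂ) := fun i => by
          have := Complex.conj_mul' (d i x)
          push_cast
          rw [← this]; ring
        calc _ = ∑ i, L x / ((gradNorm u x ^ 2 : ℝ) : ℂ) * ((‖d i x‖ ^ 2 : ℝ) : ℂ) :=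
              Finset.sum_congr rfl fun i _ => e i
          _ = L x / ((gradNorm u x ^ 2 : ℝ) : ℂ) * ((gradNorm u x ^ 2 : ℝ) : ℂ) := by
              rw [← Finset.mul_sum, hsq, Complex.ofReal_sum]
          _ = L x := div_mul_cancel₀ _ hx'
    rw [key, hL]
    simp
  · have hp := Real.rpow_pos_of_pos (japaneseBracket_pos x) (a - b)
    have hg0 := gradNorm_nonneg u x
    have e : ‖(WithLp.toLp 2 fun i => L x * (starRingEnd ℂ) (d i x) / ((gradNorm u x ^ 2 : ℝ) : ℂ) :
        EuclideanSpace ℂ (Fin n))‖ = ‖L x‖ / gradNorm u x := by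
      rw [EuclideanSpace.norm_eq]
      have e1 : ∀ i, ‖L x * (starRingEnd ℂ) (d i x) / ((gradNorm u x ^ 2 : ℝ) : ℂ)‖ ^ 2 =
          (‖L x‖ / gradNorm u x ^ 2) ^ 2 * ‖d i x‖ ^ 2 := fun i => by
        rw [norm_div, norm_mul, RCLike.norm_conj, Complex.norm_real,
          Real.norm_of_nonneg (by positivity)]
        ring
      simp only [e1]
      rw [← Finset.mul_sum, ← hsq, ← mul_pow, Real.sqrt_sq (by positivity)]
      by_cases hx : gradNorm u x = 0
      · simp [hx]
      · field_simp
    rw [e]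
    exact div_le_of_le_mul₀ hg0 (by positivity) (hbound x)

/-- The potential is chosen according to which term attains β_c. A zeroth-order one has exponent
3β/2 - 2, equal to -N for β = (4-2N)/3; a first-order one gains the gradient factor β - 1 and has
exponent β/2 - 1, equal to -P for β = 2-2P. -/
theorem planar_case (lam : ℂ) (N P : ℝ) (h1 : 1 < betaC N P) :
    ∃ (V : EuclideanSpace ℝ (Fin 2) → ℂ)
      (W : EuclideanSpace ℝ (Fin 2) → EuclideanSpace ℂ (Fin 2))
      (u : EuclideanSpace ℝ (Fin 2) → ℂ),
      Measurable V ∧ Measurable W ∧ (V = 0 ∨ W = 0) ∧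
      IsClassicalSolution lam V W u ∧ u ≠ 0 ∧
      ∃ C c : ℝ, 0 < C ∧ 0 < c ∧
        (∀ x, ‖V x‖ ≤ C * japaneseBracket x ^ (-N)) ∧
        (∀ x, ‖W x‖ ≤ C * japaneseBracket x ^ (-P)) ∧
        ∀ x, ‖u x‖ ≤ C * Real.exp (-c * ‖x‖ ^ betaC N P) := by
  obtain ⟨u, hu, hne, C, c, hC, hc, hL, hg, hd⟩ := exists_decaying_function h1 lam
  have hpos : ∀ (x : EuclideanSpace ℝ (Fin 2)) (a : ℝ), 0 < japaneseBracket x ^ a := fun x a =>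
    Real.rpow_pos_of_pos (japaneseBracket_pos x) a
  rcases max_choice (2 - 2 * P) ((4 - 2 * N) / 3) with hm | hm
  · obtain ⟨W, hW, hs, hb⟩ := exists_first_order_potential hu hC.le hL hg
    -- A single constant must serve both W, bounded with C², and u, bounded with C.
    refine ⟨0, W, u, measurable_zero, hW, Or.inl rfl, hs, hne, C + C ^ 2, c, by positivity, hc,
      fun x => ?_, fun x => ?_, fun x => ?_⟩
    · have := hpos x (-N)
      rw [Pi.zero_apply, norm_zero]; positivity
    · have e : 3 * betaC N P / 2 - 2 - (betaC N P - 1) = -P := by rw [betaC, hm]; ring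
      have h2 := hb x
      rw [e] at h2
      refine h2.trans ?_
      have := hpos x (-P)
      gcongr
      linarith
    · refine (hd x).trans ?_
      gcongr
      linarith [sq_nonneg C]
  · obtain ⟨V, hV, hs, hb⟩ := exists_zeroth_order_potential hu hC.le hL
    refine ⟨V, 0, u, hV, measurable_zero, Or.inr rfl, hs, hne, C, c, hC, hc,
      fun x => ?_, fun x => ?_, hd⟩
    · have e : 3 * betaC N P / 2 - 2 = -N := by rw [betaC, hm]; ring
      have h2 := hb x
      rwa [e] at h2
    · have := hpos x (-P)
      rw [Pi.zero_apply, norm_zero]; positivity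

/-! ### Case (b): exponentially decaying solutions by a WKB expansion -/

open Polynomial

/-- The Riccati expression of a logarithmic derivative `p`, in the variable `1 / ⟨x⟩`. -/
noncomputable def riccati (d lam : ℂ) (p : ℂ[X]) : ℂ[X] :=
  (1 - X ^ 2) * (p ^ 2 - X ^ 2 * derivative p) + p * (C d * X + X ^ 3) + C lam

/-- The Riccati equation is solvable to any order in `1 / ⟨x⟩`. -/
theorem exists_riccati_approx (d lam μ : ℂ) (hμ : μ ^ 2 = -lam) (hμ0 : μ ≠ 0) (k : ℕ) :
    ∃ p : ℂ[X], p.eval 0 = -μ ∧ X ^ (k + 1) ∣ riccati d lam p := by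
  induction k with
  | zero =>
    refine ⟨C (-μ), by simp, ?_⟩
    rw [zero_add, pow_one, X_dvd_iff, coeff_zero_eq_eval_zero]
    simp [riccati, hμ]
  | succ k ih =>
    obtain ⟨p, hp, r, hr⟩ := ih
    -- Adding cX^{k+1} changes the coefficient of X^{k+1} by 2p(0)c = -2μc, which has to cancel
    -- r(0); this is where μ ≠ 0 is used.
    set c := r.eval 0 / (2 * μ) with hc
    refine ⟨p + C c * X ^ (k + 1), by simp [hp], ?_⟩
    have e : riccati d lam (p + C c * X ^ (k + 1)) = X ^ (k + 1) *
        (r + ((1 - X ^ 2) * (2 * p * C c + C c ^ 2 * X ^ (k + 1) - C c * C ((k : ℂ) + 1) * X) +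
          C c * (C d * X + X ^ 3))) := by
      rw [mul_add, ← hr]
      simp only [riccati, derivative_add, derivative_mul, derivative_C, derivative_X_pow]
      simp
      ring
    rw [e, pow_succ X (k + 1)]
    refine mul_dvd_mul_left _ ?_
    rw [X_dvd_iff, coeff_zero_eq_eval_zero]
    simp [hp, hc]
    field_simp
    ring

/-- An antiderivative of `p (1 / s)` on the positive half line. -/
noncomputable def invAntideriv (p : ℂ[X]) (s : ℝ) : ℂ :=
  ∫ t in (1 : ℝ)..s, p.eval ((t⁻¹ : ℝ) : ℂ)

theorem continuousOn_eval_inv (p : ℂ[X]) :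
    ContinuousOn (fun t : ℝ => p.eval ((t⁻¹ : ℝ) : ℂ)) (Set.Ioi 0) :=
  p.continuous.comp_continuousOn (Complex.continuous_ofReal.comp_continuousOn
    (continuousOn_inv₀.mono fun _ ht => ne_of_gt ht))

theorem hasDerivAt_invAntideriv (p : ℂ[X]) {s : ℝ} (hs : 0 < s) :
    HasDerivAt (invAntideriv p) (p.eval ((s⁻¹ : ℝ) : ℂ)) s := by
  have hc := continuousOn_eval_inv p
  refine intervalIntegral.integral_hasDerivAt_right
    (ContinuousOn.intervalIntegrable (hc.mono fun t ht => ?_))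
    (hc.stronglyMeasurableAtFilter isOpen_Ioi s hs) (hc.continuousAt (Ioi_mem_nhds hs))
  exact lt_of_lt_of_le (lt_min one_pos hs) ht.1

theorem contDiffOn_invAntideriv (p : ℂ[X]) : ContDiffOn ℝ 2 (invAntideriv p) (Set.Ioi 0) := by
  rw [show (2 : WithTop ℕ∞) = 1 + 1 by norm_num, contDiffOn_succ_iff_deriv_of_isOpen isOpen_Ioi]
  refine ⟨fun s hs => (hasDerivAt_invAntideriv p hs).differentiableAt.differentiableWithinAt,
    by simp, ?_⟩
  have h1 : ContDiffOn ℝ 1 (fun t : ℝ => p.eval ((t⁻¹ : ℝ) : ℂ)) (Set.Ioi 0) := by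
    refine ContDiff.comp_contDiffOn (g := fun z : ℂ => p.eval z) ?_ ?_
    · exact (p.differentiable.contDiff (n := 1)).restrict_scalars ℝ
    · exact Complex.ofRealCLM.contDiff.comp_contDiffOn
        (contDiffOn_id.inv fun t ht => ne_of_gt ht)
  exact h1.congr fun s hs => (hasDerivAt_invAntideriv p hs).deriv

/-- If `p 0` has negative real part, the antiderivative tends to `-∞` at a linear rate. -/
theorem exists_re_invAntideriv_le (p : ℂ[X]) (hp : (p.eval 0).re < 0) :
    ∃ M c : ℝ, 0 < c ∧ ∀ s, 1 ≤ s → (invAntideriv p s).re ≤ M - c * s := by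
  set c := -(p.eval 0).re / 2 with hc
  have hc0 : 0 < c := by rw [hc]; linarith
  have hlim : Tendsto (fun t : ℝ => (p.eval ((t⁻¹ : ℝ) : ℂ)).re) atTop (𝓝 (p.eval 0).re) := by
    have h1 : Tendsto (fun t : ℝ => ((t⁻¹ : ℝ) : ℂ)) atTop (𝓝 0) := by
      have := (Complex.continuous_ofReal.tendsto 0).comp (tendsto_inv_atTop_zero (𝕜 := ℝ))
      rwa [Complex.ofReal_zero] at this
    exact (Complex.continuous_re.tendsto _).comp ((p.continuous.tendsto 0).comp h1)
  obtain ⟨S, hS⟩ := eventually_atTop.1 (hlim.eventually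
    (gt_mem_nhds (show (p.eval 0).re < -c by rw [hc]; linarith)))
  set S' := max S 1
  have hS1 : 1 ≤ S' := le_max_right _ _
  -- Since Re p(1/s) tends to -2c, g is decreasing beyond S'; on the remaining compact interval
  -- continuity bounds it.
  set g : ℝ → ℝ := fun s => (invAntideriv p s).re + c * s with hg
  have hgd : ∀ s, 0 < s → HasDerivAt g ((p.eval ((s⁻¹ : ℝ) : ℂ)).re + c * 1) s := fun s hs =>
    (Complex.reCLM.hasFDerivAt.comp_hasDerivAt s (hasDerivAt_invAntideriv p hs)).add
      ((hasDerivAt_id s).const_mul c)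
  have hanti : AntitoneOn g (Set.Ici S') := by
    refine antitoneOn_of_deriv_nonpos (convex_Ici _)
      (fun s hs => (hgd s (by linarith [Set.mem_Ici.1 hs])).continuousAt.continuousWithinAt)
      (fun s hs => ?_) (fun s hs => ?_)
    · rw [interior_Ici] at hs
      exact (hgd s (by linarith [Set.mem_Ioi.1 hs])).differentiableAt.differentiableWithinAt
    · rw [interior_Ici] at hs
      have hs' := Set.mem_Ioi.1 hs
      rw [(hgd s (by linarith)).deriv]
      have := hS s ((le_max_left _ _).trans hs'.le)
      linarith
  obtain ⟨M, hM⟩ := isCompact_Icc.exists_bound_of_continuousOn (f := g) (s := Set.Icc 1 S')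
    fun s hs => (hgd s (by linarith [hs.1])).continuousAt.continuousWithinAt
  refine ⟨M, c, hc0, fun s hs => ?_⟩
  suffices g s ≤ M by simp only [hg] at this; linarith
  rcases le_total s S' with h | h
  · exact (le_abs_self _).trans (hM s ⟨hs, h⟩)
  · exact (hanti (Set.mem_Ici.2 le_rfl) (Set.mem_Ici.2 h) h).trans
      ((le_abs_self _).trans (hM S' ⟨hS1, le_rfl⟩))

theorem hasFDerivAt_japaneseBracket {n : ℕ} (x : EuclideanSpace ℝ (Fin n)) :
    HasFDerivAt (japaneseBracket (n := n)) ((japaneseBracket x)⁻¹ • innerSL ℝ x) x := by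
  have h1 : HasFDerivAt (fun y : EuclideanSpace ℝ (Fin n) => 1 + ‖y‖ ^ 2) (2 • innerSL ℝ x) x :=
    (hasStrictFDerivAt_norm_sq x).hasFDerivAt.const_add 1
  have h2 := h1.sqrt (by positivity)
  refine h2.congr_fderiv ?_
  ext v
  simp [japaneseBracket]
  ring

theorem contDiff_japaneseBracket {n : ℕ} : ContDiff ℝ 2 (japaneseBracket (n := n)) := by
  refine ContDiff.sqrt (contDiff_const.add (contDiff_norm_sq ℝ)) fun x => ?_
  positivity

/-- The function with logarithmic derivative `p (1 / ⟨x⟩)` in `⟨x⟩`. -/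
noncomputable def expFun (n : ℕ) (p : ℂ[X]) (x : EuclideanSpace ℝ (Fin n)) : ℂ :=
  Complex.exp (invAntideriv p (japaneseBracket x))

theorem contDiff_expFun {n : ℕ} (p : ℂ[X]) : ContDiff ℝ 2 (expFun n p) := by
  refine Complex.contDiff_exp.comp (contDiff_iff_contDiffAt.2 fun x => ?_)
  exact ((contDiffOn_invAntideriv p).contDiffAt (Ioi_mem_nhds (japaneseBracket_pos x))).comp x
    contDiff_japaneseBracket.contDiffAt

theorem hasFDerivAt_expFun {n : ℕ} (p : ℂ[X]) (x : EuclideanSpace ℝ (Fin n)) :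
    HasFDerivAt (expFun n p) ((innerSL ℝ x).smulRight
      (expFun n p x * (p.eval (((japaneseBracket x)⁻¹ : ℝ) : ℂ) *
        (((japaneseBracket x)⁻¹ : ℝ) : ℂ)))) x := by
  have h1 := ((hasDerivAt_invAntideriv p (japaneseBracket_pos x)).hasFDerivAt.comp x
    (hasFDerivAt_japaneseBracket x)).cexp
  refine h1.congr_fderiv ?_
  ext v
  simp [expFun]
  ring

/-- With ρ = ⟨x⟩ and w = 1/ρ one has |∇ρ|² = 1 - w² and Δρ = (n-1)w + w³, while F' = p(w) and F'' =
-w²p'(w). Substituting in Δu/u = (F'' + F'²)|∇ρ|² + F'Δρ gives the Riccati polynomial. Using ⟨x⟩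
instead of |x| avoids any singularity at the origin. -/
theorem laplacian_expFun {n : ℕ} (lam : ℂ) (p : ℂ[X]) (x : EuclideanSpace ℝ (Fin n)) :
    Δ (expFun n p) x + lam * expFun n p x =
      (riccati ((n : ℂ) - 1) lam p).eval (((japaneseBracket x)⁻¹ : ℝ) : ℂ) * expFun n p x := by
  set w : EuclideanSpace ℝ (Fin n) → ℂ := fun y => (((japaneseBracket y)⁻¹ : ℝ) : ℂ) with hw
  have hwd : HasFDerivAt w ((innerSL ℝ x).smulRight (-w x ^ 3)) x := by
    have h1 := (hasDerivAt_inv (japaneseBracket_pos x).ne').comp_hasFDerivAt x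
      (hasFDerivAt_japaneseBracket x)
    have h2 := Complex.ofRealCLM.hasFDerivAt.comp x h1
    refine h2.congr_fderiv ?_
    ext v
    simp [hw]
    ring
  have hpd : HasFDerivAt (fun y => p.eval (w y))
      ((innerSL ℝ x).smulRight (p.derivative.eval (w x) * (-w x ^ 3))) x := by
    have h1 := ((p.hasDerivAt (w x)).hasFDerivAt.restrictScalars ℝ).comp x hwd
    refine h1.congr_fderiv ?_
    ext v
    simp
    ring
  have hud := hasFDerivAt_expFun p x
  have hxd : ∀ i : Fin n, HasFDerivAt (fun y : EuclideanSpace ℝ (Fin n) => ((y i : ℝ) : ℂ))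
      (Complex.ofRealCLM.comp (EuclideanSpace.proj i : EuclideanSpace ℝ (Fin n) →L[ℝ] ℝ)) x :=
    fun i => (Complex.ofRealCLM.comp
      (EuclideanSpace.proj i : EuclideanSpace ℝ (Fin n) →L[ℝ] ℝ)).hasFDerivAt
  rw [laplacian_eq_sum_of_hasFDerivAt (contDiff_expFun p).contDiffAt
    (fun i y => expFun n p y * (p.eval (w y) * w y) * ((y i : ℝ) : ℂ))
    (fun i => expFun n p x * (((x i : ℝ) : ℂ) ^ 2 * ((p.eval (w x) * w x) ^ 2
      - p.derivative.eval (w x) * w x ^ 4 - p.eval (w x) * w x ^ 3) + p.eval (w x) * w x))]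
  · have hsum : ∑ i, ((x i : ℝ) : ℂ) ^ 2 * w x ^ 2 = 1 - w x ^ 2 := by
      have h1 : japaneseBracket x ^ 2 = 1 + ∑ i, x i ^ 2 := by
        rw [japaneseBracket, Real.sq_sqrt (by positivity), EuclideanSpace.norm_sq_eq]
        simp
      have h2 : (∑ i, ((x i : ℝ) : ℂ) ^ 2) = (japaneseBracket x : ℂ) ^ 2 - 1 := by
        have := congrArg (fun t : ℝ => (t : ℂ)) h1
        push_cast at this
        rw [this]; ring
      have h3 : (japaneseBracket x : ℂ) ≠ 0 := Complex.ofReal_ne_zero.2 (japaneseBracket_pos x).ne'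
      rw [← Finset.sum_mul, h2, hw]
      push_cast
      field_simp
    rw [← Finset.mul_sum, Finset.sum_add_distrib, ← Finset.sum_mul, Finset.sum_const,
      Finset.card_univ, Fintype.card_fin, nsmul_eq_mul]
    rw [← Finset.sum_mul] at hsum
    simp only [riccati, eval_add, eval_mul, eval_sub, eval_one, eval_pow, eval_X, eval_C]
    linear_combination (expFun n p x * (p.eval (w x) ^ 2 - p.derivative.eval (w x) * w x ^ 2
      - p.eval (w x) * w x)) * hsum
  · refine Eventually.of_forall fun y i => ?_
    rw [(hasFDerivAt_expFun p y).fderiv]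
    simp [hw, EuclideanSpace.inner_single_right]
    ring
  · intro i
    have h : HasFDerivAt (fun y => expFun n p y * (p.eval (w y) * w y) * ((y i : ℝ) : ℂ)) _ x :=
      (hud.mul (hpd.mul hwd)).mul (hxd i)
    rw [h.fderiv]
    simp [hw, EuclideanSpace.inner_single_right]
    ring

theorem exists_sqrt_neg_re_pos (lam : ℂ) (h : ¬ ∃ t : ℝ, 0 ≤ t ∧ lam = (t : ℂ)) :
    ∃ μ : ℂ, μ ^ 2 = -lam ∧ 0 < μ.re := by
  refine ⟨csqrt (-lam), csqrt_sq _, (csqrt_re_nonneg _).lt_of_ne fun h0 => h ?_⟩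
  refine ⟨(csqrt (-lam)).im ^ 2, sq_nonneg _, ?_⟩
  have h1 := csqrt_sq (-lam)
  -- A root with vanishing real part is purely imaginary, which makes λ the square of a real number.
  have h2 : csqrt (-lam) = (csqrt (-lam)).im * Complex.I := by
    apply Complex.ext <;> simp [← h0]
  rw [h2, mul_pow, Complex.I_sq] at h1
  push_cast
  linear_combination h1

/-- The Riccati remainder itself serves as V, and u, being an exponential, has no zeros. Truncating
at order ⌈N⌉ makes V decay at least like ⟨x⟩^{-N}, while Re p(0) = -Re μ < 0 gives the decay of u.
-/
theorem nonreal_case (n : ℕ) (lam : ℂ) (N : ℝ) (h : ¬ ∃ t : ℝ, 0 ≤ t ∧ lam = (t : ℂ)) :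
    ∃ (V : EuclideanSpace ℝ (Fin n) → ℂ) (u : EuclideanSpace ℝ (Fin n) → ℂ),
      Measurable V ∧ IsClassicalSolution lam V 0 u ∧ u ≠ 0 ∧
      ∃ C c : ℝ, 0 < C ∧ 0 < c ∧ (∀ x, ‖V x‖ ≤ C * japaneseBracket x ^ (-N)) ∧
        ∀ x, ‖u x‖ ≤ C * Real.exp (-c * ‖x‖) := by
  obtain ⟨μ, hμ, hμ0⟩ := exists_sqrt_neg_re_pos lam h
  have hμne : μ ≠ 0 := fun h => by simp [h] at hμ0
  obtain ⟨p, hp, r, hr⟩ := exists_riccati_approx ((n : ℂ) - 1) lam μ hμ hμne ⌈N⌉₊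
  obtain ⟨M, c, hc, hM⟩ := exists_re_invAntideriv_le p (by rw [hp, Complex.neg_re]; linarith)
  obtain ⟨K, hK⟩ := (isCompact_closedBall (0 : ℂ) 1).exists_bound_of_continuousOn
    r.continuous.continuousOn
  have hK0 : 0 ≤ K := (norm_nonneg _).trans (hK 0 (by simp))
  have hbr : Continuous (japaneseBracket (n := n)) := contDiff_japaneseBracket.continuous
  refine ⟨fun x => (riccati ((n : ℂ) - 1) lam p).eval (((japaneseBracket x)⁻¹ : ℝ) : ℂ),
    expFun n p, ?_, ⟨contDiff_expFun p, fun x => ?_⟩, ?_, K + Real.exp M, c, by positivity, hc,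
    fun x => ?_, fun x => ?_⟩
  · exact ((Polynomial.continuous _).comp (Complex.continuous_ofReal.comp
      (hbr.inv₀ fun x => (japaneseBracket_pos x).ne'))).measurable
  · rw [← laplacian_expFun]
    simp [dotGrad]
  · intro h0
    exact Complex.exp_ne_zero _ (congrFun h0 0)
  · have h1 := one_le_japaneseBracket x
    have h0 := japaneseBracket_pos x
    have hinv : (japaneseBracket x)⁻¹ ≤ 1 := inv_le_one_of_one_le₀ h1
    have hn : ‖(((japaneseBracket x)⁻¹ : ℝ) : ℂ)‖ = (japaneseBracket x)⁻¹ := by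
      rw [Complex.norm_real, Real.norm_of_nonneg (by positivity)]
    beta_reduce
    rw [hr, eval_mul, eval_pow, eval_X, norm_mul, norm_pow, hn, mul_comm]
    have h2 : (japaneseBracket x)⁻¹ ^ (⌈N⌉₊ + 1) ≤ japaneseBracket x ^ (-N) := by
      rw [inv_pow, ← Real.rpow_natCast, ← Real.rpow_neg h0.le]
      refine Real.rpow_le_rpow_of_exponent_le h1 ?_
      push_cast
      linarith [Nat.le_ceil N]
    have h3 : ‖r.eval (((japaneseBracket x)⁻¹ : ℝ) : ℂ)‖ ≤ K + Real.exp M :=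
      (hK _ (by rw [mem_closedBall_zero_iff, hn]; exact hinv)).trans
        (by linarith [Real.exp_pos M])
    gcongr
  · have h1 := hM _ (one_le_japaneseBracket x)
    rw [expFun, Complex.norm_exp]
    calc _ ≤ Real.exp (M + -c * ‖x‖) := by
          refine Real.exp_le_exp.2 (h1.trans ?_)
          nlinarith [norm_le_japaneseBracket x]
      _ = Real.exp M * Real.exp (-c * ‖x‖) := Real.exp_add _ _
      _ ≤ _ := by gcongr; linarith

theorem theorem1p2 (n : ℕ) (hn : 1 ≤ n) (lam : ℂ) (N P : ℝ) (hN : 0 ≤ N) (hP : 0 ≤ P)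
    (h : (betaZero N P = betaC N P ∧ 1 < betaC N P ∧ n = 2) ∨
      (betaC N P < 1 ∧ ¬ ∃ t : ℝ, 0 ≤ t ∧ lam = (t : ℂ))) :
    ∃ (V : EuclideanSpace ℝ (Fin n) → ℂ)
      (W : EuclideanSpace ℝ (Fin n) → EuclideanSpace ℂ (Fin n))
      (u : EuclideanSpace ℝ (Fin n) → ℂ),
      Measurable V ∧ Measurable W ∧ (V = 0 ∨ W = 0) ∧
      IsClassicalSolution lam V W u ∧ u ≠ 0 ∧
      ∃ C c : ℝ, 0 < C ∧ 0 < c ∧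
        (∀ x, ‖V x‖ ≤ C * japaneseBracket x ^ (-N)) ∧
        (∀ x, ‖W x‖ ≤ C * japaneseBracket x ^ (-P)) ∧
        ∃ A : ℤ, (A = -1 ∨ A = 0) ∧
          ∀ x, 2 ≤ ‖x‖ →
            ‖u x‖ ≤ C * Real.exp (-c * ‖x‖ ^ betaZero N P * Real.log ‖x‖ ^ A) := by
  rcases h with ⟨h0, h1, rfl⟩ | ⟨h1, hlam⟩
  · obtain ⟨V, W, u, hV, hW, hVW, hs, hne, C, c, hC, hc, hVb, hWb, hd⟩ :=
      planar_case lam N P h1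
    -- No logarithmic loss occurs: A = 0 works here, as it does in the other case.
    refine ⟨V, W, u, hV, hW, hVW, hs, hne, C, c, hC, hc, hVb, hWb, 0, Or.inr rfl, fun x _ => ?_⟩
    rw [h0, zpow_zero, mul_one]
    exact hd x
  · obtain ⟨V, u, hV, hs, hne, C, c, hC, hc, hVb, hd⟩ := nonreal_case n lam N hlam
    refine ⟨V, 0, u, hV, measurable_zero, Or.inr rfl, hs, hne, C, c, hC, hc, hVb, fun x => ?_, 0,
      Or.inr rfl, fun x _ => ?_⟩
    · have := Real.rpow_pos_of_pos (japaneseBracket_pos x) (-P)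
      rw [Pi.zero_apply, norm_zero]; positivity
    · rw [betaZero, max_eq_right h1.le, zpow_zero, mul_one, Real.rpow_one]
      exact hd x
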